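/- Let $A$ be a unital simple AF $C^*$-algebra, i.e. a nonzero unital $C^*$-algebra without closed two-sided ideals other than $0$ and $A$ that has an increasing sequence of finite-dimensional $*$-subalgebras with dense union. Let $\alpha=(\alpha_t)_{t\in\mathbb R}$ be a one-parameter group of $*$-automorphisms of $A$ such that $t\mapsto\alpha_t(x)$ is norm continuous for each $x\in A$, and let $\delta_\alpha(x)=\lim_{t\to 0}(\alpha_t(x)-x)/t$ be its generator, whose domain $D(\delta_\alpha)$ is the set of all $x\in A$ for which the limit exists in norm. A *canonical AF masa* of $A$ is a maximal abelian $C^*$-subalgebra $C$ of $A$ that is AF and for which there is an increasing sequence $0=A_0\subseteq A_1\subseteq A_2\subseteq\cdots$ of finite-dimensional $C^*$-subalgebras of $A$ with dense union such that $C\cap A_n\cap A_{n-1}'$ is a maximal abelian $C^*$-subalgebra of $A_n\cap A_{n-1}'$ for all $n\ge 1$, where $A_{n-1}'$ denotes the commutant of $A_{n-1}$ in $A$. Suppose that $D(\delta_\alpha)$ contains a canonical AF masa of $A$. Then for every $\varepsilon>0$ there is $\nu>0$ with the following property: for every unitary $u\in D(\delta_\alpha)$ with $\|\delta_\alpha(u)\|<\nu$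 there is a path $(u_t)_{t\in[0,1]}$ of unitaries of $A$ lying in $D(\delta_\alpha)$, continuous in $D(\delta_\alpha)$ for the graph norm (that is, both $t\mapsto u_t$ and $t\mapsto\delta_\alpha(u_t)$ are norm continuous), such that $u_0=1$, $u_1=u$ and $\|\delta_\alpha(u_t)\|<\varepsilon$ for all $t\in[0,1]$. -/

import Mathlib

open Filter Topology

/-- A strongly continuous one-parameter group of `*`-automorphisms of a C⋆-algebra. -/
structure OneParameterAutomorphismGroup (A : Type*) [CStarAlgebra A] where
  /-- The automorphism at time `t`. -/
  toFun : ℝ → A ≃⋆ₐ[ℂ] A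
  map_zero : ∀ x : A, toFun 0 x = x
  map_add : ∀ (s t : ℝ) (x : A), toFun (s + t) x = toFun s (toFun t x)
  continuous_orbit : ∀ x : A, Continuous fun t : ℝ => toFun t x

namespace OneParameterAutomorphismGroup

/-- The domain of the infinitesimal generator: those `x` for which the limit of
`(α_t(x) - x) / t` as `t → 0` exists, i.e. whose orbit is differentiable at `0`. -/
def generatorDomain {A : Type*} [CStarAlgebra A] (α : OneParameterAutomorphismGroup A) : Set A :=
  {x | DifferentiableAt ℝ (fun t : ℝ => α.toFun t x) 0}

/-- The infinitesimal generator `δ_α(x) = lim_{t → 0} (α_t(x) - x) / t`.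
It is meaningful for `x` in `generatorDomain α` only, and is used only there. -/
noncomputable def generator {A : Type*} [CStarAlgebra A] (α : OneParameterAutomorphismGroup A)
    (x : A) : A :=
  deriv (fun t : ℝ => α.toFun t x) 0

/-- On its domain the generator is the limit of difference quotients, and membership in the domain
is the existence of that limit. -/
theorem mem_generatorDomain_and_generator_eq_iff {A : Type*} [CStarAlgebra A]
    (α : OneParameterAutomorphismGroup A) (x y : A) :
    (x ∈ α.generatorDomain ∧ α.generator x = y) ↔
      Tendsto (fun t : ℝ => t⁻¹ • (α.toFun t x - x)) (𝓝[≠] 0) (𝓝 y) := by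
  have key : HasDerivAt (fun t : ℝ => α.toFun t x) y 0 ↔
      Tendsto (fun t : ℝ => t⁻¹ • (α.toFun t x - x)) (𝓝[≠] 0) (𝓝 y) := by
    rw [hasDerivAt_iff_tendsto_slope_zero]
    simp only [zero_add, α.map_zero]
  rw [← key]
  constructor
  · rintro ⟨h, rfl⟩
    exact DifferentiableAt.hasDerivAt h
  · intro h
    exact ⟨h.differentiableAt, h.deriv⟩

/-- The homotopy condition for `δ_α`. The path is continuous in the Banach `*`-algebra `D(δ_α)`:
the norm of the matrix `[x, δ_α(x); 0, x]` is equivalent to `max ‖x‖ ‖δ_α(x)‖`, so this means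
that both `t ↦ u_t` and `t ↦ δ_α(u_t)` are norm continuous. -/
def HomotopyCondition {A : Type*} [CStarAlgebra A] (α : OneParameterAutomorphismGroup A) : Prop :=
  ∀ ε : ℝ, 0 < ε → ∃ ν : ℝ, 0 < ν ∧
    ∀ u : A, u ∈ unitary A → u ∈ α.generatorDomain → ‖α.generator u‖ < ν →
      ∃ w : unitInterval → A,
        Continuous w ∧ Continuous (fun t => α.generator (w t)) ∧
        w 0 = 1 ∧ w 1 = u ∧
        ∀ t, w t ∈ unitary A ∧ w t ∈ α.generatorDomain ∧ ‖α.generator (w t)‖ < ε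

end OneParameterAutomorphismGroup

/-- A C⋆-algebra is simple if it is nonzero and has no closed two-sided ideals
other than `0` and itself. -/
def IsSimpleCStarAlgebra (A : Type*) [CStarAlgebra A] : Prop :=
  Nontrivial A ∧ ∀ I : TwoSidedIdeal A, IsClosed (I : Set A) → I = ⊥ ∨ I = ⊤

/-- A `*`-subalgebra `B` (not necessarily containing the unit of `A`) is AF if an increasing
sequence of finite-dimensional `*`-subalgebras of `B` has dense union in `B`. -/
def IsAFSubalgebra {A : Type*} [CStarAlgebra A] (B : NonUnitalStarSubalgebra ℂ A) : Prop :=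
  ∃ D : ℕ → NonUnitalStarSubalgebra ℂ A,
    Monotone D ∧ (∀ n, FiniteDimensional ℂ (D n)) ∧ (∀ n, D n ≤ B) ∧
      (B : Set A) ⊆ closure (⋃ n, (D n : Set A))

/-- An AF algebra. -/
def IsAFAlgebra (A : Type*) [CStarAlgebra A] : Prop :=
  IsAFSubalgebra (⊤ : NonUnitalStarSubalgebra ℂ A)

/-- An abelian C⋆-subalgebra of `A`, that is, a norm-closed commutative `*`-subalgebra. -/
def IsAbelianCStarSubalgebra {A : Type*} [CStarAlgebra A]
    (C : NonUnitalStarSubalgebra ℂ A) : Prop :=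
  IsClosed (C : Set A) ∧ ∀ x ∈ C, ∀ y ∈ C, x * y = y * x

/-- `C` is a masa (maximal abelian C⋆-subalgebra) of `B`. -/
def IsMasaOf {A : Type*} [CStarAlgebra A] (C B : NonUnitalStarSubalgebra ℂ A) : Prop :=
  C ≤ B ∧ IsAbelianCStarSubalgebra C ∧
    ∀ D : NonUnitalStarSubalgebra ℂ A, D ≤ B → IsAbelianCStarSubalgebra D → C ≤ D → D = C

/-- `C` is a canonical AF masa of `A`: a maximal abelian AF C⋆-subalgebra for which there is an
increasing sequence `0 = A₀ ⊆ A₁ ⊆ A₂ ⊆ …` of finite-dimensional C⋆-subalgebras with dense union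
in `A` such that `C ∩ Aₙ ∩ Aₙ₋₁'` is a masa of `Aₙ ∩ Aₙ₋₁'` for all `n ≥ 1`. -/
def IsCanonicalAFMasa {A : Type*} [CStarAlgebra A] (C : NonUnitalStarSubalgebra ℂ A) : Prop :=
  IsMasaOf C ⊤ ∧ IsAFSubalgebra C ∧
    ∃ F : ℕ → NonUnitalStarSubalgebra ℂ A,
      F 0 = ⊥ ∧ Monotone F ∧ (∀ n, FiniteDimensional ℂ (F n)) ∧
      Dense (⋃ n, (F n : Set A)) ∧
      ∀ n, IsMasaOf
        (C ⊓ (F (n + 1) ⊓ NonUnitalStarSubalgebra.centralizer ℂ (F n : Set A)))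
        (F (n + 1) ⊓ NonUnitalStarSubalgebra.centralizer ℂ (F n : Set A))

/-! The proof rests on near-innerness (`exists_nearly_inner`): for every `u` and `η` there are a
finite-dimensional subalgebra `B` almost containing `u` and a skew-adjoint `g ∈ B` such that `δ_α`
and `ad g` differ on `B` by at most `4η` in norm. Its two halves are independent: near-innerness
implies the homotopy property, and a canonical AF masa in the domain forces near-innerness.

Near-innerness gives homotopies. If `δ_α(u)` is small, then `α_t`, and hence `exp(t ad g)`, moves an
approximant of `u` in `B` only slightly for `0 ≤ t ≤ 1`. Averaging twice over this orbit and taking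
a unitary part yields a unitary `v ∈ B` near `u` whose first and second commutators with the
self-adjoint `h = ig` are small. What remains is a dimension-free fact
(`joinedIn_one_of_commutators_small`), in which `‖h‖` is not bounded. For a spectral projection `P`
of `h` below a level `c`, the cut `P v P + (1 - P)` fails to be unitary only near the level `c`,
where `h - c` is small; control of the second commutator makes its defect small after multiplication
by `h - c`. As `P` climbs through the finite spectrum the cuts move from `1` to `v`, and successive
unitary parts differ little along `h - c`, so powers of their quotient join them without creating a
large commutator with `h`.

The masa gives near-innerness. By the closed graph theorem `δ_α` is bounded on the masa `C`.
Simplicity makes `‖a y‖` almost `‖a‖‖y‖` for asymptotically central `y`, and this forces `α_t` to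
move symmetries of `C` far out in the tower uniformly little (`exists_norm_sub_le_mul`): two
asymptotically independent symmetries, both moved by almost the maximal amount `r`, would have a
product moved by more than `r`. The group generated by symmetries of the relative masas is therefore
almost fixed by `α`, with summable errors. Orbit averages give an almost multiplicative map of this
group into the graph of `δ_α`; Newton iteration corrects it to a homomorphism, and means over the
group make it unitary, conjugate to the inclusion, and the derivation inner on it
(`exists_unitary_conj_hasGen`).

So, after conjugating the tower by a unitary and subtracting an inner derivation, `δ_α` vanishes on
all relative masas from some level on. Subtracting instead a small inner derivation, and starting
the tower high enough, keeps this true. The commutant of these masas is generated by the initial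
finite-dimensional algebra and the masas themselves, so on it the derivation is determined by the
initial matrix units and is inner (`exists_implements`). Finite-dimensional parts of this commutant
serve as `B`. -/

namespace OneParameterAutomorphismGroup

/-! ### Calculus of the generator -/

variable {A : Type*} [CStarAlgebra A] (α : OneParameterAutomorphismGroup A)

/-- `x` lies in the domain of the generator, which maps it to `y`. -/
def HasGen (x y : A) : Prop := HasDerivAt (fun t : ℝ => α.toFun t x) y 0

variable {α}

theorem HasGen.mem {x y : A} (h : α.HasGen x y) : x ∈ α.generatorDomain := h.differentiableAt

theorem HasGen.generator_eq {x y : A} (h : α.HasGen x y) : α.generator x = y := h.deriv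

theorem hasGen_generator {x : A} (h : x ∈ α.generatorDomain) : α.HasGen x (α.generator x) :=
  DifferentiableAt.hasDerivAt h

theorem HasGen.unique {x y z : A} (h : α.HasGen x y) (h' : α.HasGen x z) : y = z :=
  HasDerivAt.unique h h'

variable (α)

theorem norm_toFun (t : ℝ) (x : A) : ‖α.toFun t x‖ = ‖x‖ :=
  StarAlgEquiv.norm_map (α.toFun t) x

/-- The automorphism at time `t` as a real continuous linear map. -/
noncomputable def clm (t : ℝ) : A →L[ℝ] A :=
  LinearMap.mkContinuous
    { toFun := fun x => α.toFun t x
      map_add' := fun x y => _root_.map_add (α.toFun t) x y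
      map_smul' := fun c x => by
        have := map_smul (α.toFun t) (c : ℂ) x
        simpa using this } 1 (fun x => by simp [norm_toFun])

@[simp] theorem clm_apply (t : ℝ) (x : A) : α.clm t x = α.toFun t x := rfl

theorem toFun_comm (s t : ℝ) (x : A) :
    α.toFun s (α.toFun t x) = α.toFun t (α.toFun s x) := by
  rw [← α.map_add, ← α.map_add, add_comm]

theorem toFun_toFun_neg (t : ℝ) (x : A) : α.toFun t (α.toFun (-t) x) = x := by
  rw [← α.map_add, add_neg_cancel, α.map_zero]

variable {α}

theorem HasGen.hasDerivAt {x y : A} (h : α.HasGen x y) (t : ℝ) :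
    HasDerivAt (fun s : ℝ => α.toFun s x) (α.toFun t y) t := by
  have h1 : HasDerivAt (fun s : ℝ => α.toFun (s - t) x) y t := by
    have h0 : HasDerivAt (fun t : ℝ => α.toFun t x) y (t - t) := by rw [sub_self]; exact h
    simpa using h0.comp_sub_const t t
  have h2 := (α.clm t).hasFDerivAt.comp_hasDerivAt t h1
  refine h2.congr_of_eventuallyEq (Eventually.of_forall fun s => ?_)
  simp [← α.map_add]

theorem HasGen.norm_orbit_sub_le {x y : A} (h : α.HasGen x y) (t : ℝ) :
    ‖α.toFun t x - x‖ ≤ ‖y‖ * |t| := by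
  have := Convex.norm_image_sub_le_of_norm_hasDerivWithin_le (s := Set.univ)
    (f := fun s : ℝ => α.toFun s x) (f' := fun s => α.toFun s y) (C := ‖y‖) (x := 0) (y := t)
    (fun s _ => (h.hasDerivAt s).hasDerivWithinAt) (fun s _ => (α.norm_toFun s y).le)
    convex_univ trivial trivial
  simpa [α.map_zero] using this

/-- Closedness of the generator: the automorphisms are isometric, so the orbit derivatives converge
uniformly in time. -/
theorem HasGen.of_tendsto {x y : A} {u v : ℕ → A} (h : ∀ n, α.HasGen (u n) (v n))
    (hu : Tendsto u atTop (𝓝 x)) (hv : Tendsto v atTop (𝓝 y)) : α.HasGen x y := by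
  have key := hasDerivAt_of_tendstoUniformly (l := atTop)
    (f := fun n (t : ℝ) => α.toFun t (u n)) (f' := fun n t => α.toFun t (v n))
    (g := fun t => α.toFun t x) (g' := fun t => α.toFun t y) ?_ ?_ ?_ 0
  · simpa [HasGen, α.map_zero] using key
  · rw [Metric.tendstoUniformly_iff]
    intro ε hε
    have := Metric.tendsto_nhds.1 hv ε hε
    filter_upwards [this] with n hn t
    rw [dist_eq_norm, ← map_sub, norm_toFun, ← dist_eq_norm, dist_comm]
    exact hn
  · exact Eventually.of_forall fun n t => (h n).hasDerivAt t
  · intro t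
    exact ((α.clm t).continuous.tendsto x).comp hu

theorem HasGen.add {x y x' y' : A} (h : α.HasGen x y) (h' : α.HasGen x' y') :
    α.HasGen (x + x') (y + y') := by
  have := HasDerivAt.fun_add h h'
  simpa only [HasGen, _root_.map_add] using this

theorem HasGen.smul (c : ℂ) {x y : A} (h : α.HasGen x y) : α.HasGen (c • x) (c • y) := by
  have := HasDerivAt.fun_const_smul c h
  simpa only [HasGen, map_smul] using this

theorem HasGen.mul {x y x' y' : A} (h : α.HasGen x y) (h' : α.HasGen x' y') :
    α.HasGen (x * x') (x * y' + y * x') := by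
  have := HasDerivAt.fun_mul h h'
  rw [add_comm]
  simpa only [HasGen, map_mul, α.map_zero] using this

theorem HasGen.star {x y : A} (h : α.HasGen x y) : α.HasGen (star x) (star y) := by
  have := HasDerivAt.star h
  simpa only [HasGen, map_star] using this

theorem hasGen_one : α.HasGen 1 0 := by
  simpa only [HasGen, map_one] using hasDerivAt_const (0 : ℝ) (1 : A)

theorem hasGen_zero : α.HasGen 0 0 := by
  simpa only [HasGen, _root_.map_zero] using hasDerivAt_const (0 : ℝ) (0 : A)

theorem HasGen.neg {x y : A} (h : α.HasGen x y) : α.HasGen (-x) (-y) := by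
  simpa using h.smul (-1)

theorem HasGen.sub {x y x' y' : A} (h : α.HasGen x y) (h' : α.HasGen x' y') :
    α.HasGen (x - x') (y - y') := by
  simpa [sub_eq_add_neg] using h.add h'.neg

theorem HasGen.sum {ι : Type*} (s : Finset ι) {f g : ι → A} (h : ∀ i ∈ s, α.HasGen (f i) (g i)) :
    α.HasGen (∑ i ∈ s, f i) (∑ i ∈ s, g i) := by
  classical
  induction s using Finset.induction_on with
  | empty => simpa using hasGen_zero
  | insert a s ha ih =>
    rw [Finset.sum_insert ha, Finset.sum_insert ha]
    exact (h a (Finset.mem_insert_self _ _)).add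
      (ih fun i hi => h i (Finset.mem_insert_of_mem hi))

theorem HasGen.inverse {x y z : A} (h : α.HasGen x y) (hz : x * z = 1) (hz' : z * x = 1) :
    α.HasGen z (-(z * y * z)) := by
  have hxu : IsUnit x := ⟨⟨x, z, hz, hz'⟩, rfl⟩
  have e : ∀ t : ℝ, α.toFun t z = Ring.inverse (α.toFun t x) := by
    intro t
    have := Ring.inverse_unit (⟨α.toFun t x, α.toFun t z, by rw [← map_mul, hz, map_one],
      by rw [← map_mul, hz', map_one]⟩ : Aˣ)
    exact this.symm
  let u : Aˣ := ⟨x, z, hz, hz'⟩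
  have h1 : HasFDerivAt (Ring.inverse (M₀ := A)) (-ContinuousLinearMap.mulLeftRight ℝ A ↑u⁻¹ ↑u⁻¹)
      ((fun t : ℝ => α.toFun t x) 0) := by
    have := hasFDerivAt_ringInverse (𝕜 := ℝ) u
    simpa only [α.map_zero] using this
  have h2 := h1.comp_hasDerivAt (0 : ℝ) h
  have h3 : (-ContinuousLinearMap.mulLeftRight ℝ A ↑u⁻¹ ↑u⁻¹) y = -(z * y * z) := by
    simp [u]
  rw [h3] at h2
  refine HasDerivAt.congr_of_eventuallyEq h2 (Eventually.of_forall fun t => ?_)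
  simp only [Function.comp]
  exact e t

variable (α)

/-- The average of the orbit over the unit interval. -/
noncomputable def orbitAverage (x : A) : A := ∫ t in (0 : ℝ)..1, α.toFun t x

theorem orbit_intervalIntegrable (x : A) (a b : ℝ) :
    IntervalIntegrable (fun t => α.toFun t x) MeasureTheory.volume a b :=
  (α.continuous_orbit x).intervalIntegrable a b

/-- The automorphism `α_s` shifts the interval of integration, so the derivative consists of the two
endpoint values. -/
theorem hasGen_integral (x : A) (a : ℝ) :
    α.HasGen (∫ t in (0 : ℝ)..a, α.toFun t x) (α.toFun a x - x) := by
  have e : ∀ s : ℝ, α.toFun s (∫ t in (0 : ℝ)..a, α.toFun t x) =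
      ∫ t in s..(s + a), α.toFun t x := by
    intro s
    rw [← α.clm_apply, ← ContinuousLinearMap.intervalIntegral_comp_comm _
      (α.orbit_intervalIntegrable x 0 a)]
    simp only [clm_apply, ← α.map_add]
    rw [intervalIntegral.integral_comp_add_left (fun t => α.toFun t x) s]
    simp
  have hc := α.continuous_orbit x
  have h1 : HasDerivAt (fun s : ℝ => ∫ t in (0 : ℝ)..(s + a), α.toFun t x) (α.toFun a x) 0 := by
    have := intervalIntegral.integral_hasDerivAt_right (α.orbit_intervalIntegrable x 0 (0 + a))
      hc.stronglyMeasurable.stronglyMeasurableAtFilter hc.continuousAt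
    have h2 := HasDerivAt.comp_add_const 0 a this
    simpa using h2
  have h2 : HasDerivAt (fun s : ℝ => ∫ t in (0 : ℝ)..s, α.toFun t x) x 0 := by
    have := intervalIntegral.integral_hasDerivAt_right (α.orbit_intervalIntegrable x 0 0)
      hc.stronglyMeasurable.stronglyMeasurableAtFilter hc.continuousAt
    simpa [α.map_zero] using this
  refine (h1.sub h2).congr_of_eventuallyEq (Eventually.of_forall fun s => ?_)
  change α.toFun s _ = (∫ t in (0 : ℝ)..(s + a), α.toFun t x) - ∫ t in (0 : ℝ)..s, α.toFun t x
  rw [e, intervalIntegral.integral_interval_sub_left] <;> exact α.orbit_intervalIntegrable x _ _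

theorem hasGen_orbitAverage (x : A) : α.HasGen (α.orbitAverage x) (α.toFun 1 x - x) :=
  α.hasGen_integral x 1

theorem norm_orbitAverage_le (x : A) : ‖α.orbitAverage x‖ ≤ ‖x‖ := by
  have := intervalIntegral.norm_integral_le_of_norm_le_const (a := (0 : ℝ)) (b := 1)
    (f := fun t => α.toFun t x) (C := ‖x‖) (fun t _ => (α.norm_toFun t x).le)
  simpa [orbitAverage] using this

theorem orbitAverage_sub (x y : A) :
    α.orbitAverage (x - y) = α.orbitAverage x - α.orbitAverage y := by
  simp only [orbitAverage, map_sub]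
  exact intervalIntegral.integral_sub (α.orbit_intervalIntegrable x 0 1)
    (α.orbit_intervalIntegrable y 0 1)

theorem norm_orbitAverage_sub_le (x : A) {c : ℝ}
    (h : ∀ t ∈ Set.Icc (0 : ℝ) 1, ‖α.toFun t x - x‖ ≤ c) : ‖α.orbitAverage x - x‖ ≤ c := by
  have e : α.orbitAverage x - x = ∫ t in (0 : ℝ)..1, (α.toFun t x - x) := by
    rw [intervalIntegral.integral_sub (α.orbit_intervalIntegrable x 0 1)
      intervalIntegrable_const]
    simp [orbitAverage]
  rw [e]
  have := intervalIntegral.norm_integral_le_of_norm_le_const (a := (0 : ℝ)) (b := 1)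
    (f := fun t => α.toFun t x - x) (C := c) (fun t ht => h t ?_)
  · simpa using this
  · rw [Set.uIoc_of_le zero_le_one] at ht
    exact ⟨ht.1.le, ht.2⟩

theorem dense_generatorDomain (x : A) {ε : ℝ} (hε : 0 < ε) :
    ∃ y z, α.HasGen y z ∧ ‖x - y‖ < ε := by
  have hd : HasDerivAt (fun s : ℝ => ∫ t in (0 : ℝ)..s, α.toFun t x) x 0 := by
    have hc := α.continuous_orbit x
    have := intervalIntegral.integral_hasDerivAt_right (α.orbit_intervalIntegrable x 0 0)
      hc.stronglyMeasurable.stronglyMeasurableAtFilter hc.continuousAt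
    simpa [α.map_zero] using this
  rw [hasDerivAt_iff_tendsto_slope_zero] at hd
  obtain ⟨t, ht⟩ := ((Metric.tendsto_nhds.1 hd ε hε)).exists
  refine ⟨_, _, (α.hasGen_integral x t).smul ((t⁻¹ : ℝ) : ℂ), ?_⟩
  rw [dist_eq_norm, norm_sub_rev] at ht
  rw [Complex.coe_smul]
  simpa using ht

end OneParameterAutomorphismGroup

/-! ### Sylvester equations, absolute values and unitary parts -/

section Sqrt

variable {A : Type*} [CStarAlgebra A]

/-- With `s` and `s'` close to `1` the left side is `2X` up to an error of norm at most `‖X‖`. This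
bound replaces differentiation of the functional calculus: identities such as `s * s = r`,
differenced or differentiated, become Sylvester equations. -/
theorem norm_le_of_sylvester {s s' X R : A} (hs : ‖s - 1‖ ≤ 1 / 2) (hs' : ‖s' - 1‖ ≤ 1 / 2)
    (h : s * X + X * s' = R) : ‖X‖ ≤ ‖R‖ := by
  have e : (2 : ℝ) • X = R - ((s - 1) * X + X * (s' - 1)) := by
    rw [← h, two_smul]; noncomm_ring
  have h1 : ‖(2 : ℝ) • X‖ ≤ ‖R‖ + (‖s - 1‖ * ‖X‖ + ‖X‖ * ‖s' - 1‖) := by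
    rw [e]
    refine (norm_sub_le _ _).trans ?_
    gcongr
    refine (norm_add_le _ _).trans ?_
    gcongr <;> exact norm_mul_le _ _
  rw [norm_smul] at h1
  simp only [Real.norm_ofNat] at h1
  nlinarith [norm_nonneg X]

theorem exists_sylvester {s : A} (hs : ‖s - 1‖ ≤ 1 / 2) (R : A) : ∃ X, s * X + X * s = R := by
  rcases subsingleton_or_nontrivial A with _ | _
  · exact ⟨0, Subsingleton.elim _ _⟩
  let L : A →L[ℝ] A := (2 : ℝ)⁻¹ • (ContinuousLinearMap.mul ℝ A (1 - s) +
    (ContinuousLinearMap.mul ℝ A).flip (1 - s))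
  have hL : ‖L‖ < 1 := by
    refine lt_of_le_of_lt (ContinuousLinearMap.opNorm_le_bound _ (by norm_num : (0 : ℝ) ≤ 1 / 2)
      fun X => ?_) (by norm_num : (1 / 2 : ℝ) < 1)
    have h1 : ‖(1 - s) * X‖ ≤ 1 / 2 * ‖X‖ :=
      (norm_mul_le _ _).trans (by rw [norm_sub_rev]; gcongr)
    have h2 : ‖X * (1 - s)‖ ≤ ‖X‖ * (1 / 2) :=
      (norm_mul_le _ _).trans (by rw [norm_sub_rev]; gcongr)
    have h3 : L X = (2 : ℝ)⁻¹ • ((1 - s) * X + X * (1 - s)) := rfl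
    rw [h3, norm_smul]
    have := norm_add_le ((1 - s) * X) (X * (1 - s))
    norm_num
    linarith
  obtain ⟨u, hu⟩ := isUnit_one_sub_of_norm_lt_one hL
  refine ⟨(↑u⁻¹ : A →L[ℝ] A) ((2 : ℝ)⁻¹ • R), ?_⟩
  set X := (↑u⁻¹ : A →L[ℝ] A) ((2 : ℝ)⁻¹ • R)
  have h1 : (u : A →L[ℝ] A) X = (2 : ℝ)⁻¹ • R := by
    change ((u : A →L[ℝ] A) * (↑u⁻¹ : A →L[ℝ] A)) _ = _
    rw [Units.mul_inv]; rfl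
  rw [hu] at h1
  have h2 : X - (2 : ℝ)⁻¹ • ((1 - s) * X + X * (1 - s)) = (2 : ℝ)⁻¹ • R := by
    exact h1
  have h3 : (2 : ℝ)⁻¹ • (s * X + X * s) = (2 : ℝ)⁻¹ • R := by
    rw [← h2]
    have : s * X + X * s = (2 : ℝ) • X - ((1 - s) * X + X * (1 - s)) := by
      rw [two_smul]; noncomm_ring
    rw [this, smul_sub, smul_smul]; norm_num
  exact smul_right_injective A (by norm_num : (2 : ℝ)⁻¹ ≠ 0) h3

/-- The absolute value `|y| = (y⋆ y) ^ (1 / 2)`. -/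
noncomputable def absValue (y : A) : A := cfc Real.sqrt (star y * y)

theorem isSelfAdjoint_absValue (y : A) : IsSelfAdjoint (absValue y) := cfc_predicate _ _

theorem spectrum_star_mul_self_real_nonneg (y : A) {x : ℝ} (hx : x ∈ spectrum ℝ (star y * y)) :
    0 ≤ x := by
  let := CStarAlgebra.spectralOrder A
  have := CStarAlgebra.spectralOrderedRing A
  exact spectrum_nonneg_of_nonneg (star_mul_self_nonneg y) hx

theorem absValue_mul_self (y : A) : absValue y * absValue y = star y * y := by
  unfold absValue
  rw [← cfc_mul Real.sqrt Real.sqrt (star y * y)]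
  conv_rhs => rw [← cfc_id ℝ (star y * y)]
  refine cfc_congr fun x hx => ?_
  simp [Real.mul_self_sqrt (spectrum_star_mul_self_real_nonneg y hx)]

theorem absValue_eq_one_of_unitary {y : A} (hy : star y * y = 1) : absValue y = 1 := by
  unfold absValue
  rw [hy, cfc_apply_one]
  simp

theorem isUnit_absValue {y : A} (hy : IsUnit y) : IsUnit (absValue y) := by
  have h : IsUnit (absValue y ^ 2) := by
    rw [pow_two, absValue_mul_self]
    exact hy.star.mul hy
  exact (isUnit_pow_iff two_ne_zero).1 h

/-- The unitary part `y |y|⁻¹` of an invertible element. -/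
noncomputable def unitaryPart (y : A) : A := y * Ring.inverse (absValue y)

theorem unitaryPart_mul_absValue {y : A} (hy : IsUnit y) : unitaryPart y * absValue y = y := by
  rw [unitaryPart, mul_assoc, Ring.inverse_mul_cancel _ (isUnit_absValue hy), mul_one]

theorem unitaryPart_mem {y : A} (hy : IsUnit y) : unitaryPart y ∈ unitary A := by
  have hu := isUnit_absValue hy
  have h1 : star (unitaryPart y) * unitaryPart y = 1 := by
    have hs : star (Ring.inverse (absValue y)) = Ring.inverse (absValue y) := by
      rw [← Ring.inverse_star, (isSelfAdjoint_absValue y).star_eq]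
    rw [unitaryPart, star_mul, hs]
    calc Ring.inverse (absValue y) * star y * (y * Ring.inverse (absValue y))
        = Ring.inverse (absValue y) * (star y * y) * Ring.inverse (absValue y) := by
          noncomm_ring
      _ = (Ring.inverse (absValue y) * absValue y) *
          (absValue y * Ring.inverse (absValue y)) := by
          rw [← absValue_mul_self]; noncomm_ring
      _ = 1 := by
          rw [Ring.inverse_mul_cancel _ hu, Ring.mul_inverse_cancel _ hu, one_mul]
  have h2 : IsUnit (unitaryPart y) := hy.mul (hu.ringInverse)
  obtain ⟨v, hv⟩ := h2
  refine Unitary.mem_iff.2 ⟨h1, ?_⟩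
  rw [← hv] at h1 ⊢
  have : star (v : A) = ↑v⁻¹ := by
    rw [← mul_one (star (v : A)), ← v.mul_inv, ← mul_assoc, h1, one_mul]
  rw [this, v.mul_inv]

theorem unitaryPart_eq_self {y : A} (hy : star y * y = 1) : unitaryPart y = y := by
  rw [unitaryPart, absValue_eq_one_of_unitary hy, Ring.inverse_one, mul_one]

theorem spectrum_near_one {r : A} {c : ℝ} (hc : ‖r - 1‖ ≤ c) {x : ℝ}
    (hx : x ∈ spectrum ℝ r) : |x - 1| ≤ c := by
  rcases subsingleton_or_nontrivial A with _ | _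
  · exact absurd hx (by simp)
  have h : x - 1 ∈ spectrum ℝ (r - algebraMap ℝ A 1) := by
    rw [← spectrum.sub_singleton_eq]
    exact ⟨x, hx, 1, rfl, rfl⟩
  have := spectrum.norm_le_norm_of_mem h
  rw [map_one] at this
  exact (Real.norm_eq_abs _ ▸ this).trans hc

theorem norm_absValue_sub_one_le {y : A} {c : ℝ} (hc : ‖star y * y - 1‖ ≤ c) :
    ‖absValue y - 1‖ ≤ c := by
  have hc0 : 0 ≤ c := (norm_nonneg _).trans hc
  have e : absValue y - 1 = cfc (fun x => Real.sqrt x - 1) (star y * y) := by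
    rw [cfc_sub (fun x => Real.sqrt x) (fun _ => 1) (star y * y), cfc_const_one ℝ (star y * y)]; rfl
  rw [e]
  refine norm_cfc_le hc0 fun x hx => ?_
  have h0 := spectrum_star_mul_self_real_nonneg y hx
  have h1 := spectrum_near_one hc hx
  have h2 : x - 1 = (Real.sqrt x - 1) * (Real.sqrt x + 1) := by
    nlinarith [Real.mul_self_sqrt h0]
  rw [h2, abs_mul] at h1
  rw [Real.norm_eq_abs]
  have h3 : 1 ≤ |Real.sqrt x + 1| := by
    rw [abs_of_nonneg (by positivity)]; linarith [Real.sqrt_nonneg x]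
  nlinarith [abs_nonneg (Real.sqrt x - 1)]

/-- `1 - |y| = (1 - y⋆ y) k` for some contraction `k` commuting with `y⋆ y`. -/
theorem exists_one_sub_absValue (y : A) : ∃ k : A, ‖k‖ ≤ 1 ∧
    1 - absValue y = (1 - star y * y) * k ∧ 1 - absValue y = k * (1 - star y * y) := by
  have hcont : ContinuousOn (fun x : ℝ => (1 + Real.sqrt x)⁻¹) (spectrum ℝ (star y * y)) := by
    refine Continuous.continuousOn (Continuous.inv₀ (by fun_prop) fun x => ?_)
    positivity
  have e1 : 1 - absValue y = cfc (fun x => 1 - Real.sqrt x) (star y * y) := by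
    rw [cfc_sub (fun _ => 1) (fun x => Real.sqrt x) (star y * y), cfc_const_one ℝ (star y * y)]; rfl
  have e2 : 1 - star y * y = cfc (fun x : ℝ => 1 - x) (star y * y) := by
    rw [cfc_sub (fun _ => 1) (fun x => x) (star y * y), cfc_const_one ℝ (star y * y), cfc_id' ℝ (star y * y)]
  have e3 : ∀ x ∈ spectrum ℝ (star y * y),
      1 - Real.sqrt x = (1 - x) * (1 + Real.sqrt x)⁻¹ := fun x hx => by
    have h0 := spectrum_star_mul_self_real_nonneg y hx
    have : (1 + Real.sqrt x) ≠ 0 := by positivity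
    field_simp
    nlinarith [Real.mul_self_sqrt h0]
  refine ⟨cfc (fun x : ℝ => (1 + Real.sqrt x)⁻¹) (star y * y), ?_, ?_, ?_⟩
  · refine norm_cfc_le zero_le_one fun x _ => ?_
    rw [Real.norm_eq_abs, abs_of_nonneg (by positivity)]
    exact inv_le_one_of_one_le₀ (by linarith [Real.sqrt_nonneg x])
  · rw [e1, e2, ← cfc_mul _ _ _ (by fun_prop) hcont]
    exact cfc_congr e3
  · rw [e1, e2, ← cfc_mul _ _ _ hcont (by fun_prop)]
    refine cfc_congr fun x hx => ?_
    rw [e3 x hx, mul_comm]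

end Sqrt

/-! ### Square roots and unitary parts in the domain of the generator -/

namespace OneParameterAutomorphismGroup

variable {A : Type*} [CStarAlgebra A] {α : OneParameterAutomorphismGroup A}

/-- Implicit differentiation of `s * s = r`. The remainder `α_t(s) - s - tX` satisfies a Sylvester
equation whose right side is `o(t)`, and is therefore itself `o(t)`. -/
theorem HasGen.of_mul_self {s r r' X : A} (hr : α.HasGen r r') (hs : ‖s - 1‖ ≤ 1 / 2)
    (hsr : s * s = r) (hX : s * X + X * s = r') : α.HasGen s X := by
  have hnorm : ∀ t : ℝ, ‖α.toFun t s - s - t • X‖ ≤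
      ‖α.toFun t r - r - t • r'‖ + ‖(α.toFun t s - s) * (t • X)‖ := by
    intro t
    have h1 : ‖α.toFun t s - 1‖ ≤ 1 / 2 := by
      rw [← map_one (α.toFun t), ← map_sub, norm_toFun]; exact hs
    have h2 := norm_le_of_sylvester (s := α.toFun t s) (s' := s) (X := α.toFun t s - s - t • X)
      h1 hs rfl
    refine h2.trans ?_
    have e : α.toFun t s * (α.toFun t s - s - t • X) + (α.toFun t s - s - t • X) * s =
        (α.toFun t r - r - t • r') - (α.toFun t s - s) * (t • X) := by
      rw [← hX, ← hsr, map_mul]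
      simp only [mul_sub, sub_mul, smul_add, smul_sub, mul_smul_comm, smul_mul_assoc]
      abel
    rw [e]
    exact norm_sub_le _ _
  have hr' := hasDerivAt_iff_isLittleO.1 hr
  rw [HasGen, hasDerivAt_iff_isLittleO]
  simp only [α.map_zero, sub_zero] at hr' ⊢
  have h3 : (fun t : ℝ => (α.toFun t s - s) * (t • X)) =o[𝓝 0] fun t : ℝ => t := by
    have h4 : (fun t : ℝ => α.toFun t s - s) =o[𝓝 0] fun _ => (1 : ℝ) := by
      rw [Asymptotics.isLittleO_one_iff]
      have := ((α.continuous_orbit s).tendsto 0).sub_const s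
      simpa [α.map_zero] using this
    have h5 : (fun t : ℝ => t • X) =O[𝓝 0] fun t : ℝ => t := by
      refine Asymptotics.IsBigO.of_bound ‖X‖ (Eventually.of_forall fun t => ?_)
      rw [norm_smul, mul_comm]
    simpa using h4.mul_isBigO h5
  have h6 := (hr'.norm_left.add h3.norm_left)
  refine Asymptotics.IsBigO.trans_isLittleO ?_ h6
  refine Asymptotics.IsBigO.of_bound 1 (Eventually.of_forall fun t => ?_)
  rw [one_mul, Real.norm_of_nonneg (by positivity)]
  exact hnorm t

/-- The path is `Y |Y|⁻¹`. The derivative of `|Y|` solves a Sylvester equation, so it depends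
continuously on the parameter and is bounded by `4c`; this gives continuity in the graph norm.
Members of `Y` that are already unitary do not move, which later preserves endpoints. -/
theorem exists_unitary_path {T : Type*} [TopologicalSpace T] {Y Z : T → A} (hY : Continuous Y)
    (hZ : Continuous Z) (hYZ : ∀ t, α.HasGen (Y t) (Z t)) (hu : ∀ t, IsUnit (Y t))
    (h1 : ∀ t, ‖star (Y t) * Y t - 1‖ ≤ 1 / 2) (hY2 : ∀ t, ‖Y t‖ ≤ 2) {c : ℝ}
    (hc : ∀ t, ‖Z t‖ ≤ c) :
    ∃ w : T → A, Continuous w ∧ Continuous (fun t => α.generator (w t)) ∧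
      (∀ t, star (Y t) * Y t = 1 → w t = Y t) ∧
      ∀ t, w t ∈ unitary A ∧ w t ∈ α.generatorDomain ∧ ‖α.generator (w t)‖ ≤ 20 * c := by
  set s : T → A := fun t => absValue (Y t) with hsdef
  set i : T → A := fun t => Ring.inverse (s t) with hidef
  have hs1 : ∀ t, ‖s t - 1‖ ≤ 1 / 2 := fun t => norm_absValue_sub_one_le (h1 t)
  have hsu : ∀ t, IsUnit (s t) := fun t => isUnit_absValue (hu t)
  set r' : T → A := fun t => star (Y t) * Z t + star (Z t) * Y t with hr'
  choose X hX using fun t => exists_sylvester (hs1 t) (r' t)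
  have hr'c : Continuous r' := by fun_prop
  have hsc : Continuous s := by
    refine continuous_iff_continuousAt.2 fun t0 => ?_
    rw [ContinuousAt, tendsto_iff_norm_sub_tendsto_zero]
    have hr : Tendsto (fun t => ‖star (Y t) * Y t - star (Y t0) * Y t0‖) (𝓝 t0) (𝓝 0) := by
      have : Continuous fun t => ‖star (Y t) * Y t - star (Y t0) * Y t0‖ := by fun_prop
      simpa using this.tendsto t0
    refine squeeze_zero (fun _ => norm_nonneg _) (fun t => ?_) hr
    refine norm_le_of_sylvester (hs1 t) (hs1 t0) ?_
    rw [← absValue_mul_self, ← absValue_mul_self]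
    noncomm_ring
  have hXc : Continuous X := by
    refine continuous_iff_continuousAt.2 fun t0 => ?_
    rw [ContinuousAt, tendsto_iff_norm_sub_tendsto_zero]
    have hr : Tendsto (fun t => ‖r' t - r' t0 - ((s t - s t0) * X t0 + X t0 * (s t - s t0))‖)
        (𝓝 t0) (𝓝 0) := by
      have : Continuous fun t =>
          ‖r' t - r' t0 - ((s t - s t0) * X t0 + X t0 * (s t - s t0))‖ := by fun_prop
      simpa using this.tendsto t0
    refine squeeze_zero (fun _ => norm_nonneg _) (fun t => ?_) hr
    refine norm_le_of_sylvester (hs1 t) (hs1 t) ?_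
    rw [← hX t, ← hX t0]
    noncomm_ring
  have hic : Continuous i := by
    refine continuous_iff_continuousAt.2 fun t0 => ?_
    obtain ⟨v, hv⟩ := hsu t0
    have := NormedRing.inverse_continuousAt v
    rw [hv] at this
    exact ContinuousAt.comp (f := s) (g := Ring.inverse) this hsc.continuousAt
  have hgen : ∀ t, α.HasGen (Y t * i t) (Y t * -(i t * X t * i t) + Z t * i t) := fun t => by
    have hr : α.HasGen (star (Y t) * Y t) (r' t) := (hYZ t).star.mul (hYZ t)
    have hs := HasGen.of_mul_self hr (hs1 t) (absValue_mul_self (Y t)) (hX t)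
    exact (hYZ t).mul (hs.inverse (Ring.mul_inverse_cancel _ (hsu t))
      (Ring.inverse_mul_cancel _ (hsu t)))
  have hin : ∀ t, ‖i t‖ ≤ 2 := fun t => by
    have e : i t = 1 - (s t - 1) * i t := by
      have := Ring.mul_inverse_cancel _ (hsu t)
      rw [sub_mul, this]; simp
    rcases subsingleton_or_nontrivial A with _ | _
    · rw [Subsingleton.elim (i t) 0]; simp
    have h2 : ‖i t‖ ≤ 1 + 1 / 2 * ‖i t‖ := by
      calc ‖i t‖ = ‖1 - (s t - 1) * i t‖ := by rw [← e]
        _ ≤ ‖(1 : A)‖ + ‖(s t - 1) * i t‖ := norm_sub_le _ _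
        _ ≤ 1 + 1 / 2 * ‖i t‖ := by
          rw [CStarRing.norm_one]
          gcongr
          exact (norm_mul_le _ _).trans (by gcongr; exact hs1 t)
    linarith
  refine ⟨fun t => Y t * i t, by fun_prop, ?_, fun t ht => unitaryPart_eq_self ht, fun t => ?_⟩
  · have : (fun t => α.generator (Y t * i t)) =
        fun t => Y t * -(i t * X t * i t) + Z t * i t := funext fun t => (hgen t).generator_eq
    rw [this]
    fun_prop
  · refine ⟨unitaryPart_mem (hu t), (hgen t).mem, ?_⟩
    rw [(hgen t).generator_eq]
    have hYn := hY2 t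
    have hc0 : 0 ≤ c := (norm_nonneg _).trans (hc t)
    have hr'n : ‖r' t‖ ≤ 2 * c + c * 2 := by
      refine (norm_add_le _ _).trans ?_
      gcongr
      · exact (norm_mul_le _ _).trans (by rw [norm_star]; gcongr; exact hc t)
      · exact (norm_mul_le _ _).trans (by rw [norm_star]; gcongr; exact hc t)
    have hXn : ‖X t‖ ≤ 4 * c :=
      (norm_le_of_sylvester (hs1 t) (hs1 t) (hX t)).trans (by linarith)
    have hw : ‖Y t * i t‖ ≤ 1 := by
      rcases subsingleton_or_nontrivial A with _ | _
      · rw [Subsingleton.elim (Y t * i t) 0]; simp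
      exact (CStarRing.norm_of_mem_unitary (unitaryPart_mem (hu t))).le
    have e : Y t * -(i t * X t * i t) + Z t * i t = -((Y t * i t) * (X t * i t)) + Z t * i t := by
      noncomm_ring
    rw [e]
    calc ‖-((Y t * i t) * (X t * i t)) + Z t * i t‖
        ≤ ‖Y t * i t‖ * (‖X t‖ * ‖i t‖) + ‖Z t‖ * ‖i t‖ := by
          refine (norm_add_le _ _).trans ?_
          rw [norm_neg]
          gcongr
          · exact (norm_mul_le _ _).trans (by gcongr; exact norm_mul_le _ _)
          · exact norm_mul_le _ _
      _ ≤ 1 * (4 * c * 2) + c * 2 := by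
          gcongr
          · exact hin t
          · exact hc t
          · exact hin t
      _ ≤ 20 * c := by linarith

end OneParameterAutomorphismGroup

/-! ### Functional calculus and a Sylvester estimate in finite dimension -/

section FiniteDimensional

variable {B : Type*} [CStarAlgebra B]

theorem finite_spectrum_complex [FiniteDimensional ℂ B] (a : B) : (spectrum ℂ a).Finite := by
  have hint : IsIntegral ℂ a := Algebra.IsIntegral.isIntegral a
  have hne : minpoly ℂ a ≠ 0 := minpoly.ne_zero hint
  refine (Polynomial.finite_setOfPred_isRoot hne).subset fun z hz => ?_
  have h1 := spectrum.subset_polynomial_aeval a (minpoly ℂ a) ⟨z, hz, rfl⟩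
  rw [minpoly.aeval] at h1
  rcases subsingleton_or_nontrivial B with _ | _
  · exact absurd h1 (by simp)
  rw [spectrum.zero_eq] at h1
  exact h1

theorem finite_spectrum_real [FiniteDimensional ℂ B] (a : B) : (spectrum ℝ a).Finite := by
  rw [← spectrum.preimage_algebraMap ℂ]
  exact (finite_spectrum_complex a).preimage (algebraMap ℝ ℂ).injective.injOn

theorem continuousOn_spectrum_real [FiniteDimensional ℂ B] (a : B) (f : ℝ → ℝ) :
    ContinuousOn f (spectrum ℝ a) := (finite_spectrum_real a).continuousOn f

theorem continuousOn_spectrum_complex [FiniteDimensional ℂ B] (a : B) (f : ℂ → ℂ) :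
    ContinuousOn f (spectrum ℂ a) := (finite_spectrum_complex a).continuousOn f

theorem norm_exp_le_of_spectrum_nonpos {c : B} (hc : IsSelfAdjoint c)
    (h : ∀ x ∈ spectrum ℝ c, x ≤ 0) :
    ‖NormedSpace.exp c‖ ≤ 1 ∧ ‖NormedSpace.exp c * c‖ ≤ 1 := by
  rw [← CFC.real_exp_eq_normedSpace_exp hc]
  constructor
  · refine norm_cfc_le zero_le_one fun x hx => ?_
    rw [Real.norm_eq_abs, Real.abs_exp]
    exact Real.exp_le_one_iff.2 (h x hx)
  · have e : cfc Real.exp c * c = cfc (fun x => Real.exp x * x) c := by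
      rw [cfc_mul Real.exp (fun x => x) c, cfc_id' ℝ c]
    rw [e]
    refine norm_cfc_le zero_le_one fun x hx => ?_
    have h0 := h x hx
    rw [Real.norm_eq_abs, abs_mul, Real.abs_exp, abs_of_nonpos h0]
    have h1 : -x ≤ Real.exp (-x) := by linarith [Real.add_one_le_exp (-x)]
    calc Real.exp x * -x ≤ Real.exp x * Real.exp (-x) := by gcongr
      _ = 1 := by rw [← Real.exp_add]; simp

/-- Neither `a` nor `b` is bounded in the estimate, only the first and second "commutators" `Y` and
`Z` are. The gain comes from `‖t a e^{-ta}‖ ≤ 1`. The parameter `τ` is free: a large `τ` makes `‖X‖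
/ τ` small, after which `Y` and `Z` must be small enough. -/
theorem norm_mul_le_of_sylvester {a b X Y Z : B} (ha : IsSelfAdjoint a) (hb : IsSelfAdjoint b)
    (ha0 : ∀ x ∈ spectrum ℝ a, 0 ≤ x) (hb0 : ∀ x ∈ spectrum ℝ b, 0 ≤ x)
    (hY : b * X + X * a = Y) (hZ : b * Y + Y * a = Z) {τ : ℝ} (hτ : 0 < τ) :
    ‖X * a‖ ≤ ‖X‖ / τ + ‖Y‖ + τ * ‖Z‖ := by
  have hsp : ∀ {a : B}, IsSelfAdjoint a → (∀ x ∈ spectrum ℝ a, 0 ≤ x) → ∀ t : ℝ, 0 ≤ t →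
      ‖NormedSpace.exp (t • (-a))‖ ≤ 1 ∧ ‖t • (NormedSpace.exp (t • (-a)) * a)‖ ≤ 1 := by
    intro a ha ha0 t ht
    have hs : IsSelfAdjoint (t • (-a)) := IsSelfAdjoint.smul (IsSelfAdjoint.all t) ha.neg
    have hx : ∀ x ∈ spectrum ℝ (t • (-a)), x ≤ 0 := by
      intro x hx
      have e : t • (-a) = cfc (fun x : ℝ => t * (-x)) a := by
        rw [cfc_const_mul t (fun x => -x) a, cfc_neg_id (R := ℝ) (a := a)]
      rw [e, cfc_map_spectrum (fun x : ℝ => t * (-x)) a] at hx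
      obtain ⟨y, hy, rfl⟩ := hx
      have := mul_nonneg ht (ha0 y hy)
      simp only [mul_neg]; linarith
    refine ⟨(norm_exp_le_of_spectrum_nonpos hs hx).1, ?_⟩
    have := (norm_exp_le_of_spectrum_nonpos hs hx).2
    have e : NormedSpace.exp (t • (-a)) * (t • (-a)) =
        -(t • (NormedSpace.exp (t • (-a)) * a)) := by
      rw [mul_smul_comm, mul_neg, smul_neg]
    rwa [e, norm_neg] at this
  set Ea : ℝ → B := fun t => NormedSpace.exp (t • (-a)) with hEa
  set Eb : ℝ → B := fun t => NormedSpace.exp (t • (-b)) with hEb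
  have dEa : ∀ t, HasDerivAt Ea (Ea t * (-a)) t := fun t => hasDerivAt_exp_smul_const (-a) t
  have dEb : ∀ t, HasDerivAt Eb (Eb t * (-b)) t := fun t => hasDerivAt_exp_smul_const (-b) t
  have cEa : ∀ t, Ea t * a = a * Ea t := fun t => by
    have : Commute (t • (-a)) a := ((Commute.refl a).neg_left).smul_left t
    exact this.exp_left
  -- The term `tY` is chosen to cancel the first-order part of the derivative of `e^{-tb} X e^{-ta}
  -- a`; what is left is `-e^{-tb} Z (t e^{-ta} a)`, of norm at most `‖Z‖`.
  set H : ℝ → B := fun t => Eb t * (X + t • Y) * (Ea t * a) with hH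
  have dH : ∀ t, HasDerivAt H (-(Eb t * Z * (t • (Ea t * a)))) t := by
    intro t
    have d1 : HasDerivAt (fun t : ℝ => X + t • Y) Y t := by
      have := ((hasDerivAt_id t).smul_const Y).const_add X
      simpa using this
    have d2 := ((dEb t).mul d1).mul ((dEa t).mul_const a)
    refine d2.congr_deriv ?_
    have e : -(Eb t * Z * (t • (Ea t * a))) =
        Eb t * (-(b * (X + t • Y)) + Y - (X + t • Y) * a) * (Ea t * a) := by
      have : -(b * (X + t • Y)) + Y - (X + t • Y) * a = -(t • Z) := by
        rw [← hZ, mul_add, add_mul, mul_smul_comm, smul_mul_assoc, smul_add]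
        nth_rewrite 2 [← hY]
        abel
      rw [this]
      simp only [mul_smul_comm, smul_mul_assoc, mul_neg, neg_mul]
    rw [e]
    have e2 : Ea t * -a * a = -(a * (Ea t * a)) := by
      rw [mul_neg, neg_mul, cEa t, mul_assoc, cEa t]
    rw [e2]
    simp only [Pi.mul_apply]
    generalize X + t • Y = V
    generalize Ea t = p, Eb t = q
    noncomm_ring
  have hbound : ‖H τ - H 0‖ ≤ ‖Z‖ * (τ - 0) := by
    refine norm_image_sub_le_of_norm_deriv_le_segment' (f := H)
      (f' := fun t => -(Eb t * Z * (t • (Ea t * a)))) (a := 0) (b := τ)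
      (fun t _ => (dH t).hasDerivWithinAt) (fun t ht => ?_) τ ⟨hτ.le, le_rfl⟩
    rw [norm_neg]
    calc ‖Eb t * Z * (t • (Ea t * a))‖ ≤ ‖Eb t‖ * ‖Z‖ * ‖t • (Ea t * a)‖ :=
          (norm_mul_le _ _).trans (by gcongr; exact norm_mul_le _ _)
      _ ≤ 1 * ‖Z‖ * 1 := by
          gcongr
          · exact (hsp hb hb0 t ht.1).1
          · exact (hsp ha ha0 t ht.1).2
      _ = ‖Z‖ := by ring
  have hH0 : H 0 = X * a := by simp [hH, hEa, hEb]
  have hHτ : ‖H τ‖ ≤ ‖X‖ / τ + ‖Y‖ := by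
    have e : H τ = τ⁻¹ • (Eb τ * (X + τ • Y) * (τ • (Ea τ * a))) := by
      rw [mul_smul_comm, smul_smul, inv_mul_cancel₀ hτ.ne', one_smul]
    rw [e, norm_smul, Real.norm_of_nonneg (by positivity)]
    have h1 : ‖Eb τ * (X + τ • Y) * (τ • (Ea τ * a))‖ ≤ 1 * (‖X‖ + τ * ‖Y‖) * 1 := by
      refine (norm_mul_le _ _).trans ?_
      gcongr
      · refine (norm_mul_le _ _).trans ?_
        gcongr
        · exact (hsp hb hb0 τ hτ.le).1
        · refine (norm_add_le _ _).trans ?_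
          rw [norm_smul, Real.norm_of_nonneg hτ.le]
      · exact (hsp ha ha0 τ hτ.le).2
    calc τ⁻¹ * ‖Eb τ * (X + τ • Y) * (τ • (Ea τ * a))‖
        ≤ τ⁻¹ * (1 * (‖X‖ + τ * ‖Y‖) * 1) := by gcongr
      _ = ‖X‖ / τ + ‖Y‖ := by field_simp
  have : ‖X * a‖ ≤ ‖H τ‖ + ‖H τ - H 0‖ := by
    rw [← hH0]
    calc ‖H 0‖ = ‖H τ - (H τ - H 0)‖ := by congr 1; abel
      _ ≤ _ := norm_sub_le _ _
  rw [sub_zero] at hbound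
  nlinarith

/-! ### Paths between unitaries that differ locally -/

/-- Both sides are chord lengths `2 |sin|`. The principal argument keeps the half-angles within `π /
2`, where the sine increases. -/
theorem norm_exp_mul_log_sub_one_le {z : ℂ} (hz : ‖z‖ = 1) {t : ℝ} (ht : t ∈ Set.Icc (0 : ℝ) 1) :
    ‖Complex.exp (t * Complex.log z) - 1‖ ≤ ‖z - 1‖ := by
  have hz0 : z ≠ 0 := by rintro rfl; simp at hz
  have hl : Complex.log z = (Complex.arg z : ℂ) * Complex.I := by
    rw [Complex.log, hz, Real.log_one]; simp
  have h1 : ‖z - 1‖ = ‖2 * Real.sin (Complex.arg z / 2)‖ := by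
    rw [← Complex.norm_exp_I_mul_ofReal_sub_one, mul_comm, ← hl, Complex.exp_log hz0]
  have h2 : ‖Complex.exp (t * Complex.log z) - 1‖ = ‖2 * Real.sin (t * Complex.arg z / 2)‖ := by
    rw [← Complex.norm_exp_I_mul_ofReal_sub_one, hl]
    congr 3
    push_cast
    ring
  rw [h1, h2, norm_mul, norm_mul]
  gcongr
  rw [Real.norm_eq_abs, Real.norm_eq_abs]
  have ha := Complex.abs_arg_le_pi z
  have hpi := Real.pi_pos
  have key : ∀ y : ℝ, |y| ≤ Real.pi / 2 → |Real.sin y| = Real.sin |y| := fun y hy => by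
    rcases abs_cases y with ⟨h, h'⟩ | ⟨h, h'⟩
    · rw [h] at hy ⊢
      exact abs_of_nonneg (Real.sin_nonneg_of_nonneg_of_le_pi h' (by linarith))
    · rw [h] at hy ⊢
      rw [Real.sin_neg]
      refine abs_of_nonpos ?_
      have := Real.sin_nonneg_of_nonneg_of_le_pi (x := -y) (by linarith) (by linarith)
      rw [Real.sin_neg] at this; linarith
  have e1 : |t * Complex.arg z / 2| = t * (|Complex.arg z| / 2) := by
    rw [abs_div, abs_mul, abs_of_nonneg ht.1]; norm_num; ring
  have e2 : |Complex.arg z / 2| = |Complex.arg z| / 2 := by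
    rw [abs_div]; norm_num
  have h3 : t * (|Complex.arg z| / 2) ≤ |Complex.arg z| / 2 :=
    mul_le_of_le_one_left (by positivity) ht.2
  have h4 : 0 ≤ t * (|Complex.arg z| / 2) := mul_nonneg ht.1 (by positivity)
  rw [key _ (by rw [e1]; linarith), key _ (by rw [e2]; linarith), e1, e2]
  exact Real.sin_le_sin_of_le_of_le_pi_div_two (by linarith) (by linarith) h3

variable [FiniteDimensional ℂ B]

/-- A unitary `v` is joined to `1` by unitaries `v_t` with `v_t - 1 = k_t (v - 1)`, `‖k_t‖ ≤ 1`. -/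
theorem exists_unitary_power {v : B} (hv : v ∈ unitary B) : ∃ p : ℝ → B,
    Continuous p ∧ p 0 = 1 ∧ p 1 = v ∧
      ∀ t ∈ Set.Icc (0 : ℝ) 1, p t ∈ unitary B ∧ ∃ k : B, ‖k‖ ≤ 1 ∧ p t - 1 = k * (v - 1) := by
  have hn : IsStarNormal v := ⟨by
    rw [commute_iff_eq, (Unitary.mem_iff.1 hv).1, (Unitary.mem_iff.1 hv).2]⟩
  have hc := continuousOn_spectrum_complex v
  have hs : ∀ z ∈ spectrum ℂ v, ‖z‖ = 1 := fun z hz => by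
    simpa using spectrum.subset_circle_of_unitary (𝕜 := ℂ) hv hz
  have hl : ∀ z ∈ spectrum ℂ v, Complex.log z = (Complex.arg z : ℂ) * Complex.I := fun z hz => by
    rw [Complex.log, hs z hz, Real.log_one]; simp
  set f : ℝ → ℂ → ℂ := fun t z => Complex.exp (t * Complex.log z) with hf
  have hf1 : ∀ t, ∀ z ∈ spectrum ℂ v, ‖f t z‖ = 1 := fun t z hz => by
    simp only [hf]
    rw [hl z hz, ← mul_assoc, ← Complex.ofReal_mul, Complex.norm_exp_ofReal_mul_I]
  refine ⟨fun t => cfc (f t) v, ?_, ?_, ?_, fun t ht => ⟨?_, ?_⟩⟩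
  · have : LipschitzWith (Real.toNNReal Real.pi) fun t => cfc (f t) v := by
      refine LipschitzWith.of_dist_le_mul fun s t => ?_
      rw [dist_eq_norm, ← cfc_sub _ _ v (hc _) (hc _), Real.coe_toNNReal _ Real.pi_pos.le,
        Real.dist_eq]
      refine norm_cfc_le (by positivity) fun z hz => ?_
      simp only [hf]
      rw [hl z hz]
      have e : Complex.exp (s * (Complex.arg z * Complex.I)) -
          Complex.exp (t * (Complex.arg z * Complex.I)) =
          Complex.exp (((t * Complex.arg z : ℝ) : ℂ) * Complex.I) *
            (Complex.exp (Complex.I * ((s - t) * Complex.arg z : ℝ)) - 1) := by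
        rw [mul_sub, ← Complex.exp_add, mul_one]
        push_cast
        ring_nf
      rw [e, norm_mul, Complex.norm_exp_ofReal_mul_I, one_mul,
        Complex.norm_exp_I_mul_ofReal_sub_one, norm_mul, Real.norm_eq_abs, Real.norm_eq_abs]
      have h1 : |Real.sin ((s - t) * Complex.arg z / 2)| ≤ |(s - t) * Complex.arg z / 2| :=
        Real.abs_sin_le_abs
      rw [abs_div, abs_mul] at h1
      have h2 := Complex.abs_arg_le_pi z
      have h3 : |s - t| * |Complex.arg z| ≤ |s - t| * Real.pi := by gcongr
      norm_num at h1 ⊢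
      linarith
    exact this.continuous
  · have : cfc (f 0) v = cfc (fun _ => (1 : ℂ)) v := cfc_congr fun z _ => by simp [hf]
    exact this.trans (cfc_const_one ℂ v)
  · have : cfc (f 1) v = cfc (fun z : ℂ => z) v := cfc_congr fun z hz => by
      have : z ≠ 0 := by rintro rfl; simpa using hs 0 hz
      simp [hf, Complex.exp_log this]
    exact this.trans (cfc_id' ℂ v)
  · have h1 : ∀ z ∈ spectrum ℂ v, star (f t z) * f t z = 1 := fun z hz => by
      have := Complex.conj_mul' (f t z)
      rw [hf1 t z hz] at this
      simpa using this
    rw [Unitary.mem_iff, ← cfc_star, ← cfc_mul _ _ v (hc _) (hc _), ← cfc_mul _ _ v (hc _) (hc _)]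
    have e1 : cfc (fun z => star (f t z) * f t z) v = 1 :=
      (cfc_congr h1).trans (cfc_const_one ℂ v)
    refine ⟨e1, ?_⟩
    rw [← e1]
    exact cfc_congr fun z _ => mul_comm _ _
  -- The quotient takes the value `0` at `z = 1` by the division convention; this is harmless
  -- because the numerator vanishes there. Continuity is automatic on a finite spectrum.
  · refine ⟨cfc (fun z => (f t z - 1) / (z - 1)) v, ?_, ?_⟩
    · refine norm_cfc_le zero_le_one fun z hz => ?_
      rw [norm_div]
      exact div_le_one_of_le₀ (norm_exp_mul_log_sub_one_le (hs z hz) ht) (norm_nonneg _)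
    · have e1 : cfc (f t) v - 1 = cfc (fun z => f t z - 1) v := by
        rw [cfc_sub (f t) (fun _ => 1) v (hc _) (hc _), cfc_const_one ℂ v]
      have e2 : v - 1 = cfc (fun z : ℂ => z - 1) v := by
        rw [cfc_sub (fun z => z) (fun _ => 1) v, cfc_const_one ℂ v, cfc_id' ℂ v]
      rw [e1, e2, ← cfc_mul _ _ v (hc _) (hc _)]
      refine cfc_congr fun z _ => ?_
      by_cases h1 : z = 1
      · subst h1; simp [hf]
      · have : z - 1 ≠ 0 := sub_ne_zero.2 h1
        field_simp

/-- The path is `w p_t` with `p_t` the powers of `w⋆ w'`. Since `p_t - 1` is a contraction times `w⋆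
w' - 1`, also `(p_t - 1) L` is at most `μ`; unitarity of `p_t` gives the same bound for `L (p_t -
1)` by taking adjoints. The commutators of `p_t` with `h` and with `L` agree, as these differ by a
scalar. -/
theorem joinedIn_of_local {h L w w' : B} {a κ μ ε : ℝ} (hL : L = h - algebraMap ℝ B a)
    (hw : w ∈ unitary B) (hw' : w' ∈ unitary B) (h1 : ‖h * w - w * h‖ ≤ κ)
    (h2 : ‖(w' - w) * L‖ ≤ μ) (hε : κ + 2 * μ < ε) (hLs : IsSelfAdjoint L) :
    JoinedIn {z | z ∈ unitary B ∧ ‖h * z - z * h‖ < ε} w w' := by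
  have hv : star w * w' ∈ unitary B := mul_mem (Unitary.star_mem hw) hw'
  obtain ⟨p, hp, hp0, hp1, hpt⟩ := exists_unitary_power hv
  refine JoinedIn.ofLine (f := fun t => w * p t) (by fun_prop) (by simp [hp0]) ?_ ?_
  · simp only [hp1]
    rw [← mul_assoc, (Unitary.mem_iff.1 hw).2, one_mul]
  · rintro _ ⟨t, ht, rfl⟩
    obtain ⟨hu, k, hk, hpk⟩ := hpt t ht
    refine ⟨mul_mem hw hu, ?_⟩
    have n1 : ‖(p t - 1) * L‖ ≤ μ := by
      have e : (star w * w' - 1) * L = star w * ((w' - w) * L) := by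
        rw [← mul_assoc, mul_sub, (Unitary.mem_iff.1 hw).1]
      rw [hpk, mul_assoc, e]
      calc ‖k * (star w * ((w' - w) * L))‖ ≤ ‖k‖ * ‖star w * ((w' - w) * L)‖ := norm_mul_le _ _
        _ ≤ 1 * ‖(w' - w) * L‖ := by
          gcongr
          rw [CStarRing.norm_mem_unitary_mul _ (Unitary.star_mem hw)]
        _ ≤ μ := by rw [one_mul]; exact h2
    have n2 : ‖L * (p t - 1)‖ ≤ μ := by
      have e : star (L * (p t - 1)) = -(star (p t) * ((p t - 1) * L)) := by
        rw [star_mul, star_sub, star_one, hLs.star_eq, ← mul_assoc, mul_sub,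
          (Unitary.mem_iff.1 hu).1]
        noncomm_ring
      rw [← norm_star, e, norm_neg, CStarRing.norm_mem_unitary_mul _ (Unitary.star_mem hu)]
      exact n1
    have e : h * (w * p t) - w * p t * h =
        (h * w - w * h) * p t + w * (L * (p t - 1) - (p t - 1) * L) := by
      have : L * (p t - 1) - (p t - 1) * L = h * p t - p t * h := by
        rw [hL, sub_mul, mul_sub (p t - 1), Algebra.commutes]
        noncomm_ring
      rw [this]; noncomm_ring
    rw [e]
    refine lt_of_le_of_lt (norm_add_le _ _) ?_
    rw [CStarRing.norm_mul_mem_unitary _ hu, CStarRing.norm_mem_unitary_mul _ hw]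
    have := norm_sub_le (L * (p t - 1)) ((p t - 1) * L)
    linarith

end FiniteDimensional

/-! ### Unitarity defect of a compressed unitary -/

section SpectralCut

variable {B : Type*} [CStarAlgebra B]

theorem norm_le_one_of_mem_unitary {u : B} (hu : u ∈ unitary B) : ‖u‖ ≤ 1 := by
  rcases subsingleton_or_nontrivial B with _ | _
  · rw [Subsingleton.elim u 0, norm_zero]; exact zero_le_one
  · exact (CStarRing.norm_of_mem_unitary hu).le

/-- If `f` is almost unitary along `L`, so that `(1 - f⋆f)L` and `(1 - ff⋆)L` are small, then the
unitary part of a small perturbation of `f` is close to `f` along `L`. -/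
theorem norm_unitaryPart_sub_mul_le {f L : B} {r κ : ℝ} (hf : ‖f‖ ≤ 2) (hL : IsSelfAdjoint L)
    (hr : 0 ≤ r) (hr1 : r ≤ 1) (hu : IsUnit (f + algebraMap ℝ B r))
    (h1 : ‖(1 - star f * f) * L‖ ≤ κ) (h2 : ‖(1 - f * star f) * L‖ ≤ κ) :
    ‖(unitaryPart (f + algebraMap ℝ B r) - f) * L‖ ≤ κ + 6 * r * ‖L‖ ∧
      ‖L * (unitaryPart (f + algebraMap ℝ B r) - f)‖ ≤ κ + 6 * r * ‖L‖ := by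
  set g := f + algebraMap ℝ B r with hg
  set w := unitaryPart g with hwdef
  set s := absValue g with hs
  have hw : w ∈ unitary B := unitaryPart_mem hu
  have hws : w * s = g := unitaryPart_mul_absValue hu
  obtain ⟨k, hk, hk1, hk2⟩ := exists_one_sub_absValue g
  have hss : s * s = star g * g := absValue_mul_self g
  have hsa : star s = s := (isSelfAdjoint_absValue g).star_eq
  have hrn : ‖algebraMap ℝ B r‖ ≤ r := by
    rcases subsingleton_or_nontrivial B with _ | _
    · rw [Subsingleton.elim (algebraMap ℝ B r) 0, norm_zero]; exact hr
    · rw [norm_algebraMap', Real.norm_of_nonneg hr]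
  have hsr : star (algebraMap ℝ B r) = algebraMap ℝ B r := by
    rw [← algebraMap_star_comm]; simp
  set ρ := algebraMap ℝ B r with hρ
  have hsg : star g = star f + ρ := by rw [hg, star_add, hsr]
  have hρc : ∀ x : B, ρ * x = x * ρ := fun x => Algebra.commutes r x
  have hpert : ∀ p q : B, ‖p‖ ≤ 2 → ‖q‖ ≤ 2 → ‖(1 - p * q) * L‖ ≤ κ →
      ‖(1 - (p + ρ) * (q + ρ)) * L‖ ≤ κ + 5 * r * ‖L‖ := by
    intro p q hp hq h
    have e : (1 - (p + ρ) * (q + ρ)) * L = (1 - p * q) * L - (p * ρ + ρ * q + ρ * ρ) * L := by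
      noncomm_ring
    rw [e]
    refine (norm_sub_le _ _).trans ?_
    have : ‖p * ρ + ρ * q + ρ * ρ‖ ≤ 5 * r := by
      refine (norm_add₃_le).trans ?_
      have a1 : ‖p * ρ‖ ≤ 2 * r := (norm_mul_le _ _).trans (by gcongr)
      have a2 : ‖ρ * q‖ ≤ r * 2 := (norm_mul_le _ _).trans (by gcongr)
      have a3 : ‖ρ * ρ‖ ≤ r * 1 := (norm_mul_le _ _).trans (by gcongr; exact hrn.trans hr1)
      linarith
    have := (norm_mul_le (p * ρ + ρ * q + ρ * ρ) L).trans
      (mul_le_mul_of_nonneg_right this (norm_nonneg L))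
    linarith
  have hf' : ‖star f‖ ≤ 2 := by rwa [norm_star]
  have p1 := hpert (star f) f hf' hf h1
  have p2 := hpert f (star f) hf hf' h2
  rw [← hg, ← hsg] at p1 p2
  have hρL : ‖ρ * L‖ ≤ r * ‖L‖ := (norm_mul_le _ _).trans (by gcongr)
  constructor
  · have e : (w - f) * L = w * (k * ((1 - star g * g) * L)) + ρ * L := by
      have : w - f = w * (1 - s) + ρ := by rw [mul_sub, hws, hg]; noncomm_ring
      rw [this, hk2]; noncomm_ring
    rw [e]
    refine (norm_add_le _ _).trans ?_
    rw [CStarRing.norm_mem_unitary_mul _ hw]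
    have : ‖k * ((1 - star g * g) * L)‖ ≤ 1 * (κ + 5 * r * ‖L‖) :=
      (norm_mul_le _ _).trans (by gcongr)
    linarith
  -- The unitary part conjugates `g⋆ g` to `g g⋆`, so the second hypothesis controls multiplication
  -- by `L` on the other side.
  · have hgs : g * star g = w * (star g * g) * star w := by
      rw [← hss, ← hws, star_mul, hsa]; noncomm_ring
    have hww := (Unitary.mem_iff.1 hw).1
    have hww' := (Unitary.mem_iff.1 hw).2
    have e : star (L * (w - f)) = k * (star w * ((1 - g * star g) * L)) + ρ * L := by
      have e1 : star w - star f = (1 - s) * star w + ρ := by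
        have := congrArg star hws
        rw [star_mul, hsa, hsg] at this
        rw [sub_mul, this]; noncomm_ring
      have e2 : (1 - star g * g) * star w = star w * (1 - g * star g) := by
        rw [hgs, mul_sub, ← mul_assoc, ← mul_assoc, hww]; noncomm_ring
      rw [star_mul, star_sub, hL.star_eq, e1, hk2, mul_assoc, e2]; noncomm_ring
    rw [← norm_star, e]
    refine (norm_add_le _ _).trans ?_
    have : ‖k * (star w * ((1 - g * star g) * L))‖ ≤ 1 * (κ + 5 * r * ‖L‖) := by
      refine (norm_mul_le _ _).trans ?_
      rw [CStarRing.norm_mem_unitary_mul _ (Unitary.star_mem hw)]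
      gcongr
    linarith

/-- Compression of a unitary to the range of a spectral projection `P`, extended by `1`: the defect
of unitarity is small along `h - c`. -/
theorem norm_one_sub_star_cut_mul_le {h u P : B} {c ν τ : ℝ} (hh : IsSelfAdjoint h)
    (hP : IsSelfAdjoint P) (hPP : P * P = P) (hPh : P * h = h * P)
    (ha : ∀ x ∈ spectrum ℝ ((algebraMap ℝ B c - h) * P), 0 ≤ x)
    (hb : ∀ x ∈ spectrum ℝ ((h - algebraMap ℝ B c) * (1 - P)), 0 ≤ x)
    (hP1 : ‖P‖ ≤ 1) (hQ1 : ‖1 - P‖ ≤ 1) (hu1 : ‖u‖ ≤ 1) (huu : star u * u = 1) (hτ : 0 < τ)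
    (h1 : ‖h * u - u * h‖ ≤ ν)
    (h2 : ‖h * (h * u - u * h) - (h * u - u * h) * h‖ ≤ ν) :
    ‖(1 - star (P * u * P + (1 - P)) * (P * u * P + (1 - P))) * (h - algebraMap ℝ B c)‖ ≤
      1 / τ + ν + τ * ν := by
  set γ := algebraMap ℝ B c with hγ
  have hγc : ∀ x : B, γ * x = x * γ := fun x => Algebra.commutes c x
  have hγs : star γ = γ := by rw [hγ, ← algebraMap_star_comm]; simp
  set X := (1 - P) * u * P with hX
  set a := (γ - h) * P with hadef
  set b := (h - γ) * (1 - P) with hbdef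
  have cP : (h - γ) * P = P * (h - γ) := by rw [sub_mul, mul_sub, hPh, hγc]
  have cP' : (γ - h) * P = P * (γ - h) := by rw [sub_mul, mul_sub, hPh, hγc]
  have has : IsSelfAdjoint a := by
    rw [IsSelfAdjoint, hadef, star_mul, star_sub, hP.star_eq, hγs, hh.star_eq, cP']
  have hbs : IsSelfAdjoint b := by
    rw [IsSelfAdjoint, hbdef, star_mul, star_sub, star_sub, star_one, hP.star_eq, hγs, hh.star_eq,
      sub_mul, mul_sub (h - γ), cP]
    noncomm_ring
  have hQP : (1 - P) * P = 0 := by rw [sub_mul, hPP, one_mul, sub_self]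
  have hQQ : (1 - P) * (1 - P) = 1 - P := by
    rw [mul_sub, hQP, mul_one, sub_zero]
  -- On the off-diagonal corner the commutator with `h` becomes a Sylvester operator with positive
  -- coefficients, the scalar `c` cancelling. It is used for `v = u` and for `v = [h, u]`, which
  -- provides the two levels needed by `norm_mul_le_of_sylvester`.
  have key : ∀ v : B, b * ((1 - P) * v * P) + (1 - P) * v * P * a =
      (1 - P) * (h * v - v * h) * P := by
    intro v
    have e1 : b * ((1 - P) * v * P) = (1 - P) * ((h - γ) * v) * P := by
      have : (h - γ) * (1 - P) = (1 - P) * (h - γ) := by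
        rw [mul_sub, cP]; noncomm_ring
      calc b * ((1 - P) * v * P) = (h - γ) * ((1 - P) * (1 - P)) * v * P := by
            rw [hbdef]; noncomm_ring
        _ = _ := by rw [hQQ, this]; noncomm_ring
    have e2 : (1 - P) * v * P * a = (1 - P) * (v * (γ - h)) * P := by
      calc (1 - P) * v * P * a = (1 - P) * v * (P * (γ - h)) * P := by
            rw [hadef]; noncomm_ring
        _ = (1 - P) * v * (γ - h) * (P * P) := by rw [← cP']; noncomm_ring
        _ = _ := by rw [hPP]; noncomm_ring
    rw [e1, e2]
    have : (1 - P) * (h * v - v * h) * P =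
      (1 - P) * ((h - γ) * v) * P + (1 - P) * (v * (γ - h)) * P
        + (1 - P) * (γ * v - v * γ) * P := by noncomm_ring
    rw [this, hγc v]; noncomm_ring
  have hcomp : ∀ v : B, ‖(1 - P) * v * P‖ ≤ ‖v‖ := fun v =>
    calc ‖(1 - P) * v * P‖ ≤ ‖1 - P‖ * ‖v‖ * ‖P‖ :=
          (norm_mul_le _ _).trans (by gcongr; exact norm_mul_le _ _)
      _ ≤ 1 * ‖v‖ * 1 := by gcongr
      _ = ‖v‖ := by ring
  have hXa := norm_mul_le_of_sylvester has hbs ha hb (key u) (key _) hτ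
  have hX1 : ‖X‖ ≤ 1 := (hcomp u).trans hu1
  have hXa' : ‖X * a‖ ≤ 1 / τ + ν + τ * ν := by
    refine hXa.trans ?_
    gcongr
    · exact (hcomp _).trans h1
    · exact (hcomp _).trans h2
  -- The defect of the cut is exactly `X⋆ X`, supported under `P`, where `h - c` equals `-a`.
  have e : (1 - star (P * u * P + (1 - P)) * (P * u * P + (1 - P))) * (h - γ) =
      -(star X * (X * a)) := by
    have hPQ : P * (1 - P) = 0 := by rw [mul_sub, hPP, mul_one, sub_self]
    have e1 : star (P * u * P + (1 - P)) * (P * u * P + (1 - P)) =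
        P * star u * P * u * P + (1 - P) := by
      rw [star_add, star_mul, star_mul, star_sub, star_one, hP.star_eq]
      calc (P * (star u * P) + (1 - P)) * (P * u * P + (1 - P))
          = P * star u * (P * P) * u * P + P * star u * (P * (1 - P)) +
            ((1 - P) * P) * u * P + (1 - P) * (1 - P) := by noncomm_ring
        _ = _ := by rw [hPP, hPQ, hQP, hQQ]; noncomm_ring
    have e2 : star X * X = P - P * star u * P * u * P := by
      rw [hX, star_mul, star_mul, star_sub, star_one, hP.star_eq]
      calc P * (star u * (1 - P)) * ((1 - P) * u * P)
          = P * star u * ((1 - P) * (1 - P)) * u * P := by noncomm_ring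
        _ = P * (star u * u) * P - P * star u * P * u * P := by rw [hQQ]; noncomm_ring
        _ = _ := by rw [huu, mul_one, hPP]
    have e3 : star X * X * P = star X * X := by
      rw [hX, mul_assoc, mul_assoc (1 - P), mul_assoc, mul_assoc u, hPP]
    rw [e1]
    calc (1 - (P * star u * P * u * P + (1 - P))) * (h - γ)
        = (P - P * star u * P * u * P) * (h - γ) := by congr 1; abel
      _ = star X * X * (h - γ) := by rw [e2]
      _ = star X * X * (P * (h - γ)) := by rw [← mul_assoc (star X * X), e3]
      _ = -(star X * (X * a)) := by rw [← cP, hadef]; noncomm_ring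
  rw [e, norm_neg]
  calc ‖star X * (X * a)‖ ≤ ‖star X‖ * ‖X * a‖ := norm_mul_le _ _
    _ ≤ 1 * ‖X * a‖ := by gcongr; rwa [norm_star]
    _ ≤ _ := by rw [one_mul]; exact hXa'

end SpectralCut

/-! ### Deforming a unitary to `1` through its spectral cuts -/

section SpectralCut

variable {B : Type*} [CStarAlgebra B]

/-- The spectral projection of `h` for the set `T`. -/
noncomputable def spectralProj (h : B) (T : Set ℝ) : B := cfc (T.indicator (1 : ℝ → ℝ)) h

/-- The compression of `u` to a spectral projection of `h`, extended by `1`. -/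
noncomputable def spectralCut (h u : B) (T : Set ℝ) : B :=
  spectralProj h T * u * spectralProj h T + (1 - spectralProj h T)

variable {h : B}

theorem isSelfAdjoint_spectralProj (h : B) (T : Set ℝ) : IsSelfAdjoint (spectralProj h T) :=
  cfc_predicate _ _

theorem norm_spectralProj_le (h : B) (T : Set ℝ) : ‖spectralProj h T‖ ≤ 1 := by
  refine norm_cfc_le zero_le_one fun x _ => ?_
  rw [Set.indicator]
  split_ifs <;> simp

theorem commute_spectralProj (hh : IsSelfAdjoint h) (T : Set ℝ) :
    spectralProj h T * h = h * spectralProj h T := by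
  have e : cfc (fun x : ℝ => x) h = h := cfc_id' ℝ h
  have := cfc_commute_cfc (T.indicator (1 : ℝ → ℝ)) (fun x : ℝ => x) h
  rw [e] at this
  exact this

variable [FiniteDimensional ℂ B]

theorem spectralProj_mul_spectralProj (h : B) (T T' : Set ℝ) :
    spectralProj h T * spectralProj h T' = spectralProj h (T ∩ T') := by
  rw [spectralProj, spectralProj, spectralProj, ← cfc_mul _ _ h (continuousOn_spectrum_real h _)
    (continuousOn_spectrum_real h _), Set.inter_indicator_one]
  rfl

theorem one_sub_spectralProj (hh : IsSelfAdjoint h) (T : Set ℝ) :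
    1 - spectralProj h T = spectralProj h Tᶜ := by
  rw [spectralProj, spectralProj, Set.indicator_compl, ← cfc_one ℝ h, ← cfc_sub _ _ h
    (continuousOn_spectrum_real h _) (continuousOn_spectrum_real h _)]
  rfl

theorem sub_algebraMap_mul_spectralProj (hh : IsSelfAdjoint h) (c : ℝ) (T : Set ℝ) :
    (h - algebraMap ℝ B c) * spectralProj h T =
      cfc (fun x => (x - c) * T.indicator (1 : ℝ → ℝ) x) h := by
  have e : h - algebraMap ℝ B c = cfc (fun x : ℝ => x - c) h := by
    rw [cfc_sub (fun x => x) (fun _ => c) h, cfc_id' ℝ h, cfc_const c h]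
  rw [e, spectralProj, ← cfc_mul _ _ h (continuousOn_spectrum_real h _)
    (continuousOn_spectrum_real h _)]

theorem spectrum_cfc_nonneg (hh : IsSelfAdjoint h) {f : ℝ → ℝ} (hf : ∀ x ∈ spectrum ℝ h, 0 ≤ f x) :
    ∀ x ∈ spectrum ℝ (cfc f h), 0 ≤ x := by
  intro x hx
  rw [cfc_map_spectrum f h hh (continuousOn_spectrum_real h f)] at hx
  obtain ⟨y, hy, rfl⟩ := hx
  exact hf y hy

variable {u : B} {ν τ : ℝ}

theorem norm_one_sub_star_spectralCut_mul_le (hh : IsSelfAdjoint h) {T : Set ℝ} {c : ℝ}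
    (hT : ∀ x ∈ spectrum ℝ h, x ∈ T → x ≤ c) (hT' : ∀ x ∈ spectrum ℝ h, x ∉ T → c ≤ x)
    (hu : u ∈ unitary B) (hτ : 0 < τ) (h1 : ‖h * u - u * h‖ ≤ ν)
    (h2 : ‖h * (h * u - u * h) - (h * u - u * h) * h‖ ≤ ν) :
    ‖(1 - star (spectralCut h u T) * spectralCut h u T) * (h - algebraMap ℝ B c)‖ ≤
      1 / τ + ν + τ * ν := by
  refine norm_one_sub_star_cut_mul_le hh (isSelfAdjoint_spectralProj h T) ?_
    (commute_spectralProj hh T) ?_ ?_ (norm_spectralProj_le h T) ?_ ?_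
    (Unitary.mem_iff.1 hu).1 hτ h1 h2
  · rw [spectralProj_mul_spectralProj, Set.inter_self]
  · have e : (algebraMap ℝ B c - h) * spectralProj h T =
        cfc (fun x => -((x - c) * T.indicator (1 : ℝ → ℝ) x)) h := by
      rw [cfc_neg, ← sub_algebraMap_mul_spectralProj hh, ← neg_mul, neg_sub]
    rw [e]
    refine spectrum_cfc_nonneg hh fun x hx => ?_
    rw [Set.indicator]
    split_ifs with hxT
    · have := hT x hx hxT
      simp only [Pi.one_apply]; linarith
    · simp
  · rw [one_sub_spectralProj hh, sub_algebraMap_mul_spectralProj hh]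
    refine spectrum_cfc_nonneg hh fun x hx => ?_
    rw [Set.indicator]
    split_ifs with hxT
    · have := hT' x hx hxT
      simp only [Pi.one_apply]; linarith
    · simp
  · rw [one_sub_spectralProj hh]; exact norm_spectralProj_le h _
  · exact norm_le_one_of_mem_unitary hu

theorem norm_spectralCut_le (hh : IsSelfAdjoint h) (hu : u ∈ unitary B) (T : Set ℝ) :
    ‖spectralCut h u T‖ ≤ 2 := by
  refine (norm_add_le _ _).trans ?_
  have h1 := norm_spectralProj_le h T
  have h2 : ‖1 - spectralProj h T‖ ≤ 1 := by
    rw [one_sub_spectralProj hh]; exact norm_spectralProj_le h _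
  have h3 : ‖spectralProj h T * u * spectralProj h T‖ ≤ 1 * 1 := by
    refine (norm_mul_le _ _).trans ?_
    gcongr
    rw [CStarRing.norm_mul_mem_unitary _ hu]
    exact h1
  linarith

theorem star_spectralCut (h u : B) (T : Set ℝ) :
    star (spectralCut h u T) = spectralCut h (star u) T := by
  rw [spectralCut, spectralCut, star_add, star_mul, star_mul, star_sub, star_one,
    (isSelfAdjoint_spectralProj h T).star_eq, mul_assoc]

/-- A unitary that agrees approximately with the spectral cut of `u` along `h - c`, for all `c`
separating `T` from the rest of the spectrum. -/
def IsUnitaryCut (h u : B) (κ : ℝ) (T : Set ℝ) (w : B) : Prop :=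
  w ∈ unitary B ∧ ∀ c : ℝ, |c| ≤ ‖h‖ → (∀ x ∈ spectrum ℝ h, x ∈ T → x ≤ c) →
    (∀ x ∈ spectrum ℝ h, x ∉ T → c ≤ x) →
    ‖(w - spectralCut h u T) * (h - algebraMap ℝ B c)‖ ≤ κ ∧
      ‖(h - algebraMap ℝ B c) * (w - spectralCut h u T)‖ ≤ κ

/-- A finite spectrum excludes only finitely many shifts. -/
theorem exists_small_isUnit_add (f : B) {δ : ℝ} (hδ : 0 < δ) :
    ∃ r : ℝ, 0 ≤ r ∧ r ≤ δ ∧ IsUnit (f + algebraMap ℝ B r) := by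
  have hfin : (Set.Icc 0 δ ∩ (fun r : ℝ => -r) ⁻¹' spectrum ℝ f).Finite :=
    ((finite_spectrum_real f).preimage neg_injective.injOn).subset Set.inter_subset_right
  have hinf : (Set.Icc 0 δ).Infinite := Set.Icc_infinite hδ
  obtain ⟨r, hr, hr'⟩ := hinf.exists_notMem_finite hfin
  refine ⟨r, hr.1, hr.2, ?_⟩
  have : -r ∉ spectrum ℝ f := fun h => hr' ⟨hr, h⟩
  rw [spectrum.notMem_iff, ← IsUnit.neg_iff, map_neg] at this
  convert this using 1
  abel

theorem exists_isUnitaryCut (hh : IsSelfAdjoint h) (hu : u ∈ unitary B) (hτ : 0 < τ) (hν : 0 < ν)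
    (h1 : ‖h * u - u * h‖ ≤ ν)
    (h2 : ‖h * (h * u - u * h) - (h * u - u * h) * h‖ ≤ ν) (T : Set ℝ) :
    ∃ w, IsUnitaryCut h u (1 / τ + ν + τ * ν + ν) T w := by
  -- The admissible shift depends on `‖h‖`, but only so that its cost `6 r ‖h - c‖`, with `‖h - c‖ ≤
  -- 2‖h‖`, is at most `ν`; the resulting estimate is free of `‖h‖`.
  obtain ⟨r, hr, hrδ, hru⟩ := exists_small_isUnit_add (spectralCut h u T)
    (δ := min 1 (ν / (12 * (‖h‖ + 1)))) (by positivity)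
  have hr1 : r ≤ 1 := hrδ.trans (min_le_left _ _)
  have hr2 : r * (12 * (‖h‖ + 1)) ≤ ν := by
    have := hrδ.trans (min_le_right _ _)
    rwa [le_div_iff₀ (by positivity)] at this
  refine ⟨unitaryPart (spectralCut h u T + algebraMap ℝ B r), unitaryPart_mem hru,
    fun c hc hT hT' => ?_⟩
  have hsu : star u ∈ unitary B := Unitary.star_mem hu
  have s1 : ‖h * star u - star u * h‖ ≤ ν := by
    rw [← norm_star, star_sub, star_mul, star_mul, star_star, hh.star_eq, norm_sub_rev]; exact h1
  have s2 : ‖h * (h * star u - star u * h) - (h * star u - star u * h) * h‖ ≤ ν := by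
    rw [← norm_star]
    simp only [star_sub, star_mul, star_star, hh.star_eq]
    refine le_trans (le_of_eq (congrArg _ ?_)) h2
    noncomm_ring
  have c1 := norm_one_sub_star_spectralCut_mul_le hh hT hT' hu hτ h1 h2
  have c2 := norm_one_sub_star_spectralCut_mul_le hh hT hT' hsu hτ s1 s2
  rw [← star_spectralCut, star_star] at c2
  have hLs : IsSelfAdjoint (h - algebraMap ℝ B c) := by
    refine hh.sub ?_
    rw [IsSelfAdjoint, ← algebraMap_star_comm]; simp
  have hL : ‖h - algebraMap ℝ B c‖ ≤ 2 * ‖h‖ := by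
    refine (norm_sub_le _ _).trans ?_
    have : ‖algebraMap ℝ B c‖ ≤ |c| := by
      rcases subsingleton_or_nontrivial B with _ | _
      · rw [Subsingleton.elim (algebraMap ℝ B c) 0, norm_zero]; exact abs_nonneg c
      · rw [norm_algebraMap', Real.norm_eq_abs]
    linarith
  have := norm_unitaryPart_sub_mul_le (norm_spectralCut_le hh hu T) hLs hr hr1 hru c1 c2
  have e : 6 * r * ‖h - algebraMap ℝ B c‖ ≤ ν := by
    calc 6 * r * ‖h - algebraMap ℝ B c‖ ≤ 6 * r * (2 * ‖h‖) := by gcongr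
      _ ≤ r * (12 * (‖h‖ + 1)) := by nlinarith
      _ ≤ ν := hr2
  exact ⟨this.1.trans (by linarith), this.2.trans (by linarith)⟩

/-- The cut itself has commutator `P [h, u] P` with `h`. Replacing the cut by `w` costs only the
commutator of the difference with `h - c`, which is small on both sides. -/
theorem IsUnitaryCut.norm_commutator_le (hh : IsSelfAdjoint h) {κ : ℝ} {T : Set ℝ} {w : B}
    (hw : IsUnitaryCut h u κ T w) {c : ℝ} (hc : |c| ≤ ‖h‖)
    (hT : ∀ x ∈ spectrum ℝ h, x ∈ T → x ≤ c) (hT' : ∀ x ∈ spectrum ℝ h, x ∉ T → c ≤ x)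
    (h1 : ‖h * u - u * h‖ ≤ ν) : ‖h * w - w * h‖ ≤ ν + 2 * κ := by
  obtain ⟨a1, a2⟩ := hw.2 c hc hT hT'
  set P := spectralProj h T
  have cP : P * h = h * P := commute_spectralProj hh T
  have e : h * w - w * h = P * (h * u - u * h) * P +
      ((h - algebraMap ℝ B c) * (w - spectralCut h u T) -
        (w - spectralCut h u T) * (h - algebraMap ℝ B c)) := by
    have hγ : algebraMap ℝ B c * (w - spectralCut h u T) =
      (w - spectralCut h u T) * algebraMap ℝ B c := Algebra.commutes c _
    have e1 : P * (h * u - u * h) * P =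
        h * spectralCut h u T - spectralCut h u T * h := by
      have : P * (h * u - u * h) * P = (P * h) * u * P - P * u * (h * P) := by noncomm_ring
      rw [this, cP, ← cP, spectralCut]
      change _ = h * (P * u * P + (1 - P)) - (P * u * P + (1 - P)) * h
      rw [mul_add, add_mul, mul_sub, sub_mul, mul_assoc (P * u), cP, mul_one, one_mul]
      noncomm_ring
    rw [e1, sub_mul, mul_sub _ h, hγ]
    noncomm_ring
  rw [e]
  refine (norm_add_le _ _).trans ?_
  have b1 : ‖P * (h * u - u * h) * P‖ ≤ ν := by
    calc ‖P * (h * u - u * h) * P‖ ≤ ‖P‖ * ‖h * u - u * h‖ * ‖P‖ :=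
          (norm_mul_le _ _).trans (by gcongr; exact norm_mul_le _ _)
      _ ≤ 1 * ‖h * u - u * h‖ * 1 := by gcongr <;> exact norm_spectralProj_le h T
      _ ≤ ν := by linarith
  have b2 := norm_sub_le ((h - algebraMap ℝ B c) * (w - spectralCut h u T))
    ((w - spectralCut h u T) * (h - algebraMap ℝ B c))
  linarith

/-- Consecutive spectral cuts agree approximately along `h - a`. -/
theorem norm_spectralCut_insert_sub_mul_le (hh : IsSelfAdjoint h) {T : Set ℝ} {a : ℝ}
    (haT : a ∉ T) (h1 : ‖h * u - u * h‖ ≤ ν) :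
    ‖(spectralCut h u (insert a T) - spectralCut h u T) * (h - algebraMap ℝ B a)‖ ≤ ν := by
  set P := spectralProj h T with hPdef
  set P' := spectralProj h (insert a T) with hP'def
  set L := h - algebraMap ℝ B a with hL
  -- The two projections differ by the eigenprojection at `a`, which `h - a` annihilates.
  have hPL : P' * L = P * L := by
    have c1 : ∀ T, spectralProj h T * L = L * spectralProj h T := fun T => by
      rw [hL, mul_sub, sub_mul, commute_spectralProj hh, ← Algebra.commutes]
    rw [c1, c1, sub_algebraMap_mul_spectralProj hh, sub_algebraMap_mul_spectralProj hh]
    refine cfc_congr fun x _ => ?_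
    by_cases hx : x = a
    · simp [hx]
    · by_cases hxT : x ∈ T <;> simp [Set.indicator, hx, hxT]
  have cL : P * L = L * P := by
    rw [hL, mul_sub, sub_mul, commute_spectralProj hh, ← Algebra.commutes]
  have e : (spectralCut h u (insert a T) - spectralCut h u T) * L =
      (P' - P) * (u * h - h * u) * P := by
    change (P' * u * P' + (1 - P') - (P * u * P + (1 - P))) * L = _
    have e0 : (P' - P) * L = 0 := by rw [sub_mul, hPL, sub_self]
    have e1 : u * h - h * u = u * L - L * u := by
      rw [hL, mul_sub, sub_mul, ← Algebra.commutes]; noncomm_ring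
    calc (P' * u * P' + (1 - P') - (P * u * P + (1 - P))) * L
        = P' * u * (P' * L) - P * u * (P * L) - (P' - P) * L := by noncomm_ring
      _ = (P' - P) * u * (P * L) := by rw [hPL, e0]; noncomm_ring
      _ = (P' - P) * u * L * P - (P' - P) * L * u * P := by rw [cL, e0]; noncomm_ring
      _ = _ := by rw [e1]; noncomm_ring
  have hPP : P' - P = spectralProj h {a} := by
    rw [hPdef, hP'def, spectralProj, spectralProj, spectralProj, ← cfc_sub _ _ h
      (continuousOn_spectrum_real h _) (continuousOn_spectrum_real h _)]
    refine cfc_congr fun x _ => ?_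
    by_cases hx : x = a
    · simp [hx, haT]
    · by_cases hxT : x ∈ T <;> simp [Set.indicator, hx, hxT]
  rw [e, hPP]
  calc ‖spectralProj h {a} * (u * h - h * u) * P‖
      ≤ ‖spectralProj h {a}‖ * ‖u * h - h * u‖ * ‖P‖ :=
        (norm_mul_le _ _).trans (by gcongr; exact norm_mul_le _ _)
    _ ≤ 1 * ‖u * h - h * u‖ * 1 := by
        gcongr <;> exact norm_spectralProj_le h _
    _ ≤ ν := by rw [norm_sub_rev]; linarith

/-- In a finite-dimensional C⋆-algebra, a unitary whose first and second commutators with a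
self-adjoint element are small is joined to `1` by unitaries almost commuting with that element;
the estimate is independent of the algebra. -/
theorem joinedIn_one_of_commutators_small (hh : IsSelfAdjoint h) (hu : u ∈ unitary B) {ε : ℝ}
    (hτ : 0 < τ) (hν : 0 < ν) (hε : 6 / τ + 15 * ν + 6 * (τ * ν) < ε)
    (h1 : ‖h * u - u * h‖ ≤ ν)
    (h2 : ‖h * (h * u - u * h) - (h * u - u * h) * h‖ ≤ ν) :
    JoinedIn {z | z ∈ unitary B ∧ ‖h * z - z * h‖ < ε} 1 u := by
  set κ := 1 / τ + ν + τ * ν + ν with hκ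
  have hκε : 6 * κ + 3 * ν < ε := by
    have : 6 / τ = 6 * (1 / τ) := by ring
    rw [hκ]; linarith
  have hκ0 : 0 < κ := by positivity
  have hLs : ∀ c : ℝ, IsSelfAdjoint (h - algebraMap ℝ B c) := fun c => by
    refine hh.sub ?_
    rw [IsSelfAdjoint, ← algebraMap_star_comm]; simp
  set S := (finite_spectrum_real h).toFinset with hS
  have hSm : ∀ x, x ∈ S ↔ x ∈ spectrum ℝ h := fun x => by simp [hS]
  have hbd : ∀ x ∈ spectrum ℝ h, |x| ≤ ‖h‖ := fun x hx => by
    rcases subsingleton_or_nontrivial B with _ | _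
    · simp at hx
    · simpa using spectrum.norm_le_norm_of_mem hx
  -- Induction over the lower parts `T` of the spectrum, adding the largest point each time.
  -- Quantifying over every unitary cut `w` lets the last step apply to `u` itself. Since each step
  -- produces its own bound on the commutators along its segment, errors do not accumulate with the
  -- number of eigenvalues.
  have main : ∀ T : Finset ℝ, T ⊆ S → (∀ x ∈ T, ∀ y ∈ S, y ≤ x → y ∈ T) →
      ∀ w, IsUnitaryCut h u κ (T : Set ℝ) w →
        JoinedIn {z | z ∈ unitary B ∧ ‖h * z - z * h‖ < ε} 1 w := by
    intro T
    induction T using Finset.induction_on_max with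
    | empty =>
      intro _ _ w hw
      have hc := hw.2 (-‖h‖) (by simp) (by simp)
        (fun x hx _ => by have := neg_abs_le x; have := hbd x hx; linarith)
      have h0 : spectralCut h u ((∅ : Finset ℝ) : Set ℝ) = 1 := by
        have : spectralProj h ((∅ : Finset ℝ) : Set ℝ) = 0 := by simp [spectralProj]
        rw [spectralCut, this]; simp
      rw [h0] at hc
      exact joinedIn_of_local (κ := 0) (μ := κ) rfl (one_mem _) hw.1 (by simp) hc.1
        (by linarith) (hLs _)
    | insert a T ha ih =>
      intro hTS hlow w hw
      have haS : a ∈ S := hTS (Finset.mem_insert_self _ _)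
      have hTS' : T ⊆ S := fun x hx => hTS (Finset.mem_insert_of_mem hx)
      have haT : a ∉ T := fun h' => lt_irrefl _ (ha a h')
      obtain ⟨w₀, hw₀⟩ := exists_isUnitaryCut hh hu hτ hν h1 h2 (T : Set ℝ)
      have hj := ih hTS' (fun x hx y hy hyx => by
        have := hlow x (Finset.mem_insert_of_mem hx) y hy hyx
        rcases Finset.mem_insert.1 this with rfl | h'
        · exact absurd (ha x hx) (not_lt.2 hyx)
        · exact h') w₀ hw₀
      have hac := hbd a ((hSm a).1 haS)
      have c1 : ∀ x ∈ spectrum ℝ h, x ∈ (T : Set ℝ) → x ≤ a := fun x _ hx => (ha x hx).le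
      have c2 : ∀ x ∈ spectrum ℝ h, x ∉ (T : Set ℝ) → a ≤ x := fun x hx hxT => by
        by_contra hlt
        have := hlow a (Finset.mem_insert_self _ _) x ((hSm x).2 hx) (not_le.1 hlt).le
        rcases Finset.mem_insert.1 this with rfl | h'
        · exact hlt le_rfl
        · exact hxT h'
      have hins : ((insert a T : Finset ℝ) : Set ℝ) = insert a (T : Set ℝ) := by simp
      rw [hins] at hw
      have k1 := hw.2 a hac (fun x hx hxT => by
          rcases hxT with rfl | h'
          · exact le_rfl
          · exact c1 x hx h')
        (fun x hx hxT => c2 x hx fun h' => hxT (Or.inr h'))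
      have k0 := hw₀.2 a hac c1 c2
      refine hj.trans (joinedIn_of_local (κ := ν + 2 * κ) (μ := 2 * κ + ν) rfl hw₀.1 hw.1
        (hw₀.norm_commutator_le hh hac c1 c2 h1) ?_ (by linarith) (hLs a))
      have k2 := norm_spectralCut_insert_sub_mul_le (u := u) hh (T := (T : Set ℝ)) (a := a)
        (by simpa using haT) h1
      have e : (w - w₀) * (h - algebraMap ℝ B a) =
          (w - spectralCut h u (insert a (T : Set ℝ))) * (h - algebraMap ℝ B a) -
          (w₀ - spectralCut h u (T : Set ℝ)) * (h - algebraMap ℝ B a) +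
          (spectralCut h u (insert a (T : Set ℝ)) - spectralCut h u (T : Set ℝ)) *
            (h - algebraMap ℝ B a) := by noncomm_ring
      rw [e]
      refine (norm_add_le _ _).trans ?_
      have := norm_sub_le ((w - spectralCut h u (insert a (T : Set ℝ))) * (h - algebraMap ℝ B a))
        ((w₀ - spectralCut h u (T : Set ℝ)) * (h - algebraMap ℝ B a))
      linarith [k1.1, k0.1]
  -- For the whole spectrum the cut is `u`, so `u` is its own unitary cut with zero error.
  refine main S Finset.Subset.rfl (fun _ _ y hy _ => hy) u ⟨hu, fun c _ _ _ => ?_⟩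
  have h0 : spectralCut h u (S : Set ℝ) = u := by
    have : spectralProj h (S : Set ℝ) = 1 := by
      rw [spectralProj, ← cfc_one ℝ h]
      exact cfc_congr fun x hx => by simp [(hSm x).2 hx]
    simp [spectralCut, this]
  simp [h0, hκ0.le]

end SpectralCut

/-! ### Asymptotic multiplicativity of the norm in simple algebras -/

section Simple

variable {A : Type*} [CStarAlgebra A]

/-- The two-sided ideal generated by a nonzero element of a simple C⋆-algebra contains `1`. -/
theorem IsSimpleCStarAlgebra.exists_sum_eq_one (hA : IsSimpleCStarAlgebra A) {q : A} (hq : q ≠ 0) :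
    ∃ (ι : Type) (_ : Fintype ι) (c d : ι → A), ∑ i, c i * q * d i = 1 := by
  have := hA.1
  let J : AddSubgroup A := AddSubgroup.closure (Set.range fun p : A × A => p.1 * q * p.2)
  have hJl : ∀ x y, y ∈ J → x * y ∈ J := by
    intro x y hy
    induction hy using AddSubgroup.closure_induction with
    | mem y hy =>
      obtain ⟨p, rfl⟩ := hy
      exact AddSubgroup.subset_closure ⟨(x * p.1, p.2), by simp only [mul_assoc]⟩
    | zero => simp
    | add y z _ _ hy hz => rw [mul_add]; exact add_mem hy hz
    | neg y _ hy => rw [mul_neg]; exact neg_mem hy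
  have hJr : ∀ x y, x ∈ J → x * y ∈ J := by
    intro x y hx
    induction hx using AddSubgroup.closure_induction with
    | mem x hx =>
      obtain ⟨p, rfl⟩ := hx
      exact AddSubgroup.subset_closure ⟨(p.1, p.2 * y), by simp only [mul_assoc]⟩
    | zero => simp
    | add y z _ _ hy hz => rw [add_mul]; exact add_mem hy hz
    | neg y _ hy => rw [neg_mul]; exact neg_mem hy
  let K : TwoSidedIdeal A := TwoSidedIdeal.mk' (J.topologicalClosure : Set A)
    (zero_mem _) (fun h h' => add_mem h h') (fun h => neg_mem h)
    (fun {x y} hy => map_mem_closure (continuous_const_mul x) hy fun z hz => hJl x z hz)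
    (fun {x y} hx =>
      map_mem_closure (f := fun z => z * y) (continuous_mul_const y) hx fun z hz => hJr z y hz)
  have hK : (K : Set A) = (J.topologicalClosure : Set A) := TwoSidedIdeal.coe_mk' ..
  have hqJ : q ∈ J := AddSubgroup.subset_closure ⟨(1, 1), by simp⟩
  have hqK : q ∈ K := by
    rw [← SetLike.mem_coe, hK]; exact J.le_topologicalClosure hqJ
  have h1 : (1 : A) ∈ closure (J : Set A) := by
    rcases hA.2 K (by rw [hK]; exact J.isClosed_topologicalClosure) with h | h
    · rw [h] at hqK
      exact absurd ((TwoSidedIdeal.mem_bot _).1 hqK) hq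
    · have : (1 : A) ∈ (K : Set A) := by rw [h]; exact Set.mem_univ _
      rwa [hK] at this
  -- An element of the algebraic ideal at distance less than `1` from `1` is invertible, so no
  -- closure is needed to reach `1`.
  obtain ⟨z, hzJ, hz⟩ := Metric.mem_closure_iff.1 h1 1 one_pos
  have hzu : IsUnit z := by
    have : ‖1 - z‖ < 1 := by rwa [← dist_eq_norm]
    have h2 := (Units.oneSub (1 - z) this).isUnit
    simpa using h2
  have hsum : ∃ (ι : Type) (_ : Fintype ι) (c d : ι → A), ∑ i, c i * q * d i = z := by
    clear hz hzu
    induction hzJ using AddSubgroup.closure_induction with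
    | mem y hy =>
      obtain ⟨p, rfl⟩ := hy
      exact ⟨Unit, inferInstance, fun _ => p.1, fun _ => p.2, by simp⟩
    | zero => exact ⟨Empty, inferInstance, fun _ => 0, fun _ => 0, by simp⟩
    | add y z _ _ hy hz =>
      obtain ⟨ι, _, c, d, rfl⟩ := hy
      obtain ⟨ι', _, c', d', rfl⟩ := hz
      exact ⟨ι ⊕ ι', inferInstance, Sum.elim c c', Sum.elim d d', by simp⟩
    | neg y _ hy =>
      obtain ⟨ι, _, c, d, rfl⟩ := hy
      exact ⟨ι, inferInstance, fun i => -c i, d, by simp⟩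
  obtain ⟨ι, _, c, d, h⟩ := hsum
  refine ⟨ι, inferInstance, c, fun i => d i * Ring.inverse z, ?_⟩
  rw [← Ring.mul_inverse_cancel z hzu]
  nth_rewrite 2 [← h]
  rw [Finset.sum_mul]
  simp only [mul_assoc]

section Order

variable [PartialOrder A] [StarOrderedRing A]

theorem exists_inv_sqrt {W : A} (hW : 1 ≤ W) : ∃ V : A, IsSelfAdjoint V ∧ V * W * V = 1 := by
  have hWs : IsSelfAdjoint W := (zero_le_one.trans hW).isSelfAdjoint
  have hsp : ∀ x ∈ spectrum ℝ W, 1 ≤ x := by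
    have : algebraMap ℝ A 1 ≤ W := by simpa using hW
    exact (algebraMap_le_iff_le_spectrum (a := W)).1 this
  have hc : ContinuousOn (fun x : ℝ => (√x)⁻¹) (spectrum ℝ W) :=
    Real.continuous_sqrt.continuousOn.inv₀ fun x hx => by
      have := hsp x hx
      exact (Real.sqrt_pos.2 (by linarith)).ne'
  refine ⟨cfc (fun x : ℝ => (√x)⁻¹) W, cfc_predicate _ _, ?_⟩
  have e : W = cfc (fun x : ℝ => x) W := (cfc_id' ℝ W).symm
  have : cfc (fun x : ℝ => (√x)⁻¹) W * W * cfc (fun x : ℝ => (√x)⁻¹) W =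
      cfc (fun x : ℝ => (√x)⁻¹ * x * (√x)⁻¹) W := by
    rw [cfc_mul (fun x : ℝ => (√x)⁻¹ * x) _ W (hc.mul continuousOn_id) hc,
      cfc_mul _ (fun x : ℝ => x) W hc continuousOn_id, cfc_id' ℝ W]
  rw [this, ← cfc_one ℝ W]
  refine cfc_congr fun x hx => ?_
  have h1 := hsp x hx
  have h2 : √x ≠ 0 := (Real.sqrt_pos.2 (by linarith)).ne'
  have h3 : x = √x * √x := (Real.mul_self_sqrt (by linarith)).symm
  simp only [Pi.one_apply]
  nth_rewrite 2 [h3]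
  field_simp

/-- In a simple C⋆-algebra, every nonzero self-adjoint `e` admits a finite family `b_i ∈ eA` with
`∑ b_i⋆ b_i = 1`. -/
theorem IsSimpleCStarAlgebra.exists_sum_star_mul_self_eq_one (hA : IsSimpleCStarAlgebra A) {e : A}
    (he : IsSelfAdjoint e) (he0 : e ≠ 0) :
    ∃ (ι : Type) (_ : Fintype ι) (f : ι → A), ∑ i, star (e * f i) * (e * f i) = 1 := by
  have hee : e * e ≠ 0 := by
    rw [← norm_ne_zero_iff]
    nth_rewrite 1 [← he.star_eq]
    rw [CStarRing.norm_star_mul_self]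
    have := norm_ne_zero_iff.2 he0
    positivity
  obtain ⟨ι, _, c, d, h⟩ := hA.exists_sum_eq_one hee
  -- From `∑ c e² d = 1` and the inequality `x⋆y + y⋆x ≤ x⋆x + y⋆y`, the family made of the `d` and
  -- the `c⋆` satisfies `W ≥ 2`; multiplying by an inverse square root of `W` normalises it.
  let f₀ : ι ⊕ ι → A := Sum.elim d fun i => star (c i)
  set W := ∑ i, star (e * f₀ i) * (e * f₀ i) with hW
  have hW1 : 1 ≤ W := by
    have e1 : W = ∑ i, (star (e * d i) * (e * d i) + star (e * star (c i)) * (e * star (c i))) := by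
      rw [hW, Fintype.sum_sum_type, Finset.sum_add_distrib]; rfl
    have e2 : (1 : A) + 1 = ∑ i, (star (e * star (c i)) * (e * d i) +
        star (e * d i) * (e * star (c i))) := by
      rw [Finset.sum_add_distrib]
      congr 1
      · rw [← h]
        simp only [star_mul, star_star, he.star_eq, mul_assoc]
      · rw [← star_one A, ← h, star_sum]
        simp only [star_mul, he.star_eq, mul_assoc]
    have e3 : (1 : A) + 1 ≤ W := by
      rw [e1, e2]
      refine Finset.sum_le_sum fun i _ => ?_
      have := star_mul_self_nonneg (e * d i - e * star (c i))
      rw [← sub_nonneg]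
      refine this.trans_eq ?_
      rw [star_sub]; noncomm_ring
    exact (le_add_of_nonneg_left zero_le_one).trans e3
  obtain ⟨V, hV, hVW⟩ := exists_inv_sqrt hW1
  refine ⟨ι ⊕ ι, inferInstance, fun i => f₀ i * V, ?_⟩
  rw [← hVW, hW, Finset.mul_sum, Finset.sum_mul]
  refine Finset.sum_congr rfl fun i _ => ?_
  rw [← mul_assoc e, star_mul (e * f₀ i) V, hV.star_eq]
  simp only [mul_assoc]

/-- Let `e` be supported where `a⋆a` exceeds `l = ‖a‖² - η`, so that `e a⋆a e ≥ l e²`, and let `b_i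
= e f_i` with `∑ b_i⋆ b_i = 1`. Then `l y⋆y ≤ ∑ (a b_i y)⋆ (a b_i y)`. Moving `b_i` past `y` turns
the right side into `∑ (a y b_i)⋆ (a y b_i)`, which is at most `‖a y‖²`. -/
theorem IsSimpleCStarAlgebra.norm_mul_ge_aux (hA : IsSimpleCStarAlgebra A) (a : A) {η : ℝ}
    (hη : 0 < η) :
    ∃ (ι : Type) (_ : Fintype ι) (b : ι → A), ∃ ρ : ℝ, 0 < ρ ∧ ∀ y : A, ‖y‖ ≤ 1 →
      (∀ i, ‖b i * y - y * b i‖ ≤ ρ) → (‖a‖ ^ 2 - η) * ‖y‖ ^ 2 ≤ ‖a * y‖ ^ 2 + η := by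
  rcases le_or_gt (‖a‖ ^ 2 - η) 0 with hl | hl
  · refine ⟨Empty, inferInstance, fun _ => 0, 1, one_pos, fun y _ _ => ?_⟩
    have := mul_nonpos_of_nonpos_of_nonneg hl (sq_nonneg ‖y‖)
    have := sq_nonneg ‖a * y‖
    linarith
  have := hA.1
  set l := ‖a‖ ^ 2 - η with hl_def
  set c := star a * a with hc
  have hcs : IsSelfAdjoint c := IsSelfAdjoint.star_mul_self a
  have hcont : Continuous fun t : ℝ => √(max 0 (t - l)) := by fun_prop
  set e := cfc (fun t : ℝ => √(max 0 (t - l))) c with he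
  have hes : IsSelfAdjoint e := cfc_predicate _ _
  have he0 : e ≠ 0 := by
    intro h0
    have hle : ∀ x ∈ spectrum ℝ c, ‖x‖ ≤ l := fun x hx => by
      have h1 := norm_apply_le_norm_cfc (fun t : ℝ => √(max 0 (t - l))) c hx hcont.continuousOn
      rw [← he, h0, norm_zero, norm_le_zero_iff, Real.sqrt_eq_zero (le_max_left _ _)] at h1
      have h2 := le_max_right 0 (x - l)
      rw [Real.norm_of_nonneg (spectrum_star_mul_self_real_nonneg a hx)]
      linarith
    have h1 : ‖c‖ ≤ l := by
      rw [← cfc_id' ℝ c]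
      exact norm_cfc_le hl.le hle
    rw [hc, CStarRing.norm_star_mul_self, ← pow_two] at h1
    linarith
  obtain ⟨ι, _, f, hf⟩ := hA.exists_sum_star_mul_self_eq_one hes he0
  set b : ι → A := fun i => e * f i with hb
  set M := ∑ i, 2 * ‖a‖ ^ 2 * ‖b i‖ with hM
  have hM0 : 0 ≤ M := Finset.sum_nonneg fun i _ => by positivity
  refine ⟨ι, inferInstance, b, η / (M + 1), by positivity, fun y hy hby => ?_⟩
  have hece : l • (e * e) ≤ e * c * e := by
    rw [← sub_nonneg]
    have h1 : e * c * e - l • (e * e) =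
        cfc (fun t : ℝ => √(max 0 (t - l)) * t * √(max 0 (t - l)) -
          l * (√(max 0 (t - l)) * √(max 0 (t - l)))) c := by
      rw [cfc_sub _ _ c (by fun_prop) (by fun_prop), cfc_const_mul _ _ c (by fun_prop),
        cfc_mul _ _ c (by fun_prop) (by fun_prop), cfc_mul _ _ c (by fun_prop) (by fun_prop),
        cfc_mul _ _ c (by fun_prop) (by fun_prop), cfc_id' ℝ c]
    rw [h1]
    refine cfc_nonneg fun x _ => ?_
    have h2 := Real.mul_self_sqrt (le_max_left 0 (x - l))
    have h3 : √(max 0 (x - l)) * x * √(max 0 (x - l)) -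
        l * (√(max 0 (x - l)) * √(max 0 (x - l))) = max 0 (x - l) * (x - l) := by
      linear_combination (x - l) * h2
    rw [h3]
    rcases le_total (x - l) 0 with h | h
    · rw [max_eq_left h, zero_mul]
    · rw [max_eq_right h]; positivity
  have hlow : l • (star y * y) ≤ ∑ i, star (a * b i * y) * (a * b i * y) := by
    have h1 : star y * y = ∑ i, star (f i * y) * (e * e) * (f i * y) := by
      have : star y * y = star y * (∑ i, star (e * f i) * (e * f i)) * y := by rw [hf, mul_one]
      rw [this, Finset.mul_sum, Finset.sum_mul]
      refine Finset.sum_congr rfl fun i _ => ?_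
      simp only [star_mul, hes.star_eq, mul_assoc]
    rw [h1, Finset.smul_sum]
    refine Finset.sum_le_sum fun i _ => ?_
    have h2 := star_left_conjugate_le_conjugate hece (f i * y)
    refine (le_of_eq ?_).trans (h2.trans_eq ?_)
    · simp only [mul_smul_comm, smul_mul_assoc]
    · simp only [hb, hc, star_mul, hes.star_eq, mul_assoc]
  have hup : ‖∑ i, star (a * y * b i) * (a * y * b i)‖ ≤ ‖a * y‖ ^ 2 := by
    have h0 : 0 ≤ ∑ i, star (a * y * b i) * (a * y * b i) :=
      Finset.sum_nonneg fun i _ => star_mul_self_nonneg _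
    have h1 : ∑ i, star (a * y * b i) * (a * y * b i) ≤ algebraMap ℝ A (‖a * y‖ ^ 2) := by
      have : algebraMap ℝ A (‖a * y‖ ^ 2) =
          ∑ i, star (b i) * algebraMap ℝ A (‖a * y‖ ^ 2) * b i := by
        simp only [mul_assoc, ← Algebra.commutes]
        rw [← Finset.mul_sum, hf, mul_one]
      rw [this]
      refine Finset.sum_le_sum fun i _ => ?_
      have h2 := star_left_conjugate_le_conjugate
        (CStarAlgebra.star_mul_le_algebraMap_norm_sq (a := a * y)) (b i)
      refine (le_of_eq ?_).trans h2
      simp only [star_mul, mul_assoc]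
    refine (CStarAlgebra.norm_le_norm_of_nonneg_of_le h0 h1).trans_eq ?_
    rw [norm_algebraMap', Real.norm_of_nonneg (by positivity)]
  have herr : ‖∑ i, star (a * b i * y) * (a * b i * y) -
      ∑ i, star (a * y * b i) * (a * y * b i)‖ ≤ η := by
    rw [← Finset.sum_sub_distrib]
    refine (norm_sum_le _ _).trans ?_
    have : ∀ i, ‖star (a * b i * y) * (a * b i * y) - star (a * y * b i) * (a * y * b i)‖ ≤
        2 * ‖a‖ ^ 2 * ‖b i‖ * (η / (M + 1)) := by
      intro i
      have n1 : ‖a * b i * y‖ ≤ ‖a‖ * ‖b i‖ := by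
        calc ‖a * b i * y‖ ≤ ‖a‖ * ‖b i‖ * ‖y‖ :=
              (norm_mul_le _ _).trans (by gcongr; exact norm_mul_le _ _)
          _ ≤ ‖a‖ * ‖b i‖ * 1 := by gcongr
          _ = _ := mul_one _
      have n2 : ‖a * y * b i‖ ≤ ‖a‖ * ‖b i‖ := by
        calc ‖a * y * b i‖ ≤ ‖a‖ * ‖y‖ * ‖b i‖ :=
              (norm_mul_le _ _).trans (by gcongr; exact norm_mul_le _ _)
          _ ≤ ‖a‖ * 1 * ‖b i‖ := by gcongr
          _ = _ := by rw [mul_one]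
      have n3 : ‖a * b i * y - a * y * b i‖ ≤ ‖a‖ * (η / (M + 1)) := by
        have : a * b i * y - a * y * b i = a * (b i * y - y * b i) := by noncomm_ring
        rw [this]
        exact (norm_mul_le _ _).trans (by gcongr; exact hby i)
      have e1 : star (a * b i * y) * (a * b i * y) - star (a * y * b i) * (a * y * b i) =
          star (a * b i * y - a * y * b i) * (a * b i * y) +
            star (a * y * b i) * (a * b i * y - a * y * b i) := by
        rw [star_sub]; noncomm_ring
      rw [e1]
      calc _ ≤ ‖star (a * b i * y - a * y * b i)‖ * ‖a * b i * y‖ +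
            ‖star (a * y * b i)‖ * ‖a * b i * y - a * y * b i‖ :=
            (norm_add_le _ _).trans (add_le_add (norm_mul_le _ _) (norm_mul_le _ _))
        _ ≤ ‖a‖ * (η / (M + 1)) * (‖a‖ * ‖b i‖) + ‖a‖ * ‖b i‖ * (‖a‖ * (η / (M + 1))) := by
            rw [norm_star, norm_star]
            gcongr
        _ = _ := by ring
    refine (Finset.sum_le_sum fun i _ => this i).trans ?_
    rw [← Finset.sum_mul, ← hM, mul_div_assoc', div_le_iff₀ (by positivity)]
    nlinarith
  have h0 : 0 ≤ l • (star y * y) := smul_nonneg hl.le (star_mul_self_nonneg y)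
  have h1 := CStarAlgebra.norm_le_norm_of_nonneg_of_le h0 hlow
  rw [norm_smul, Real.norm_of_nonneg hl.le, CStarRing.norm_star_mul_self, ← pow_two] at h1
  have h2 := norm_sub_norm_le (∑ i, star (a * b i * y) * (a * b i * y))
    (∑ i, star (a * y * b i) * (a * y * b i))
  linarith

end Order

/-- In a simple C⋆-algebra `‖a y‖` is almost `‖a‖ ‖y‖` for `y` almost commuting with finitely many
elements depending on `a`. -/
theorem IsSimpleCStarAlgebra.norm_mul_ge (hA : IsSimpleCStarAlgebra A) (a : A) {η : ℝ}
    (hη : 0 < η) :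
    ∃ (ι : Type) (_ : Fintype ι) (b : ι → A), ∃ ρ : ℝ, 0 < ρ ∧ ∀ y : A, ‖y‖ ≤ 1 →
      (∀ i, ‖b i * y - y * b i‖ ≤ ρ) → (‖a‖ ^ 2 - η) * ‖y‖ ^ 2 ≤ ‖a * y‖ ^ 2 + η := by
  let _ := CStarAlgebra.spectralOrder A
  have := CStarAlgebra.spectralOrderedRing A
  exact hA.norm_mul_ge_aux a hη

end Simple

/-! ### Tail symmetries are moved uniformly little -/

section TailSymmetries

variable {A : Type*} [CStarAlgebra A]

/-- The self-adjoint unitaries of `C` that commute with `F`. -/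
def tailSymmetries (C F : NonUnitalStarSubalgebra ℂ A) : Set A :=
  {v | v ∈ C ∧ star v = v ∧ v * v = 1 ∧ ∀ x ∈ F, x * v = v * x}

theorem tailSymmetries_anti {C F F' : NonUnitalStarSubalgebra ℂ A} (h : F ≤ F') :
    tailSymmetries C F' ⊆ tailSymmetries C F :=
  fun _ hv => ⟨hv.1, hv.2.1, hv.2.2.1, fun x hx => hv.2.2.2 x (h hx)⟩

theorem mem_unitary_of_mem_tailSymmetries {C F : NonUnitalStarSubalgebra ℂ A} {v : A}
    (hv : v ∈ tailSymmetries C F) : v ∈ unitary A := by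
  rw [Unitary.mem_iff, hv.2.1]
  exact ⟨hv.2.2.1, hv.2.2.1⟩

/-- Unitaries commuting with the members of an exhausting sequence are asymptotically central. -/
theorem exists_norm_commutator_le {F : ℕ → NonUnitalStarSubalgebra ℂ A} (hF : Monotone F)
    (hd : Dense (⋃ n, (F n : Set A))) {ι : Type*} [Fintype ι] (z : ι → A) {ε : ℝ} (hε : 0 < ε) :
    ∃ m, ∀ v ∈ unitary A, (∀ x ∈ F m, x * v = v * x) → ∀ i, ‖z i * v - v * z i‖ ≤ ε := by
  have h1 : ∀ i, ∃ m, ∃ x ∈ F m, ‖z i - x‖ ≤ ε / 2 := by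
    intro i
    obtain ⟨x, hx, hx'⟩ := Metric.mem_closure_iff.1 (hd (z i)) (ε / 2) (half_pos hε)
    obtain ⟨m, hm⟩ := Set.mem_iUnion.1 hx
    exact ⟨m, x, hm, by rw [← dist_eq_norm]; exact hx'.le⟩
  choose m x hx hxz using h1
  refine ⟨Finset.univ.sup m, fun v hv hvc i => ?_⟩
  have hxi : x i * v = v * x i := hvc _ (hF (Finset.le_sup (Finset.mem_univ i)) (hx i))
  have e : z i * v - v * z i = (z i - x i) * v - v * (z i - x i) := by
    rw [sub_mul, mul_sub, hxi]; abel
  rw [e]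
  refine (norm_sub_le _ _).trans ?_
  rw [CStarRing.norm_mul_mem_unitary _ hv, CStarRing.norm_mem_unitary_mul _ hv]
  linarith [hxz i]

/-- The lower bound gives `w ≥ 0.88 r²`. Since `r + η + w ≤ 1.11 r`, the upper bound gives `w` at
most about `0.56 r²`. -/
theorem false_of_independence_estimates {r η p q w : ℝ} (hr : 0 < r) (hr1 : r ≤ 1 / 10)
    (hη : η = r ^ 4 / 100) (hw : 0 ≤ w) (hp : 95 / 100 * r < p) (hq : 95 / 100 * r < q)
    (hw1 : w ≤ r * r) (hlow : (p ^ 2 - η) * q ^ 2 ≤ w ^ 2 + η)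
    (hup : 4 * w ≤ (r + η + w) ^ 2 + r ^ 2 + 2 * η) : False := by
  have hs0 : 0 < r ^ 2 := by positivity
  have hs : r ^ 2 ≤ 1 / 100 := by nlinarith
  have h4 : r ^ 4 = r ^ 2 * r ^ 2 := by ring
  have hηr : η ≤ r ^ 2 / 10000 := by rw [hη]; nlinarith
  have hηr' : η ≤ r / 100000 := by nlinarith
  have hp2 : 9025 / 10000 * r ^ 2 ≤ p ^ 2 := by nlinarith
  have hq2 : 9025 / 10000 * r ^ 2 ≤ q ^ 2 := by nlinarith
  have h1 : (9 / 10 * r ^ 2) * (9 / 10 * r ^ 2) ≤ (p ^ 2 - η) * q ^ 2 := by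
    apply mul_le_mul <;> nlinarith
  have h2 : (88 / 100 * r ^ 2) ^ 2 ≤ w ^ 2 := by nlinarith
  have hW : 88 / 100 * r ^ 2 ≤ w := abs_le_of_sq_le_sq' h2 hw |>.2
  have hw2 : w ≤ r / 10 := by nlinarith
  have hsq : (r + η + w) ^ 2 ≤ (111 / 100 * r) ^ 2 := by
    have : 0 ≤ η := by rw [hη]; positivity
    gcongr
    linarith
  nlinarith

namespace OneParameterAutomorphismGroup

variable (α : OneParameterAutomorphismGroup A)

/-- The generator is bounded on a closed subalgebra contained in its domain. -/
theorem exists_norm_generator_le {C : NonUnitalStarSubalgebra ℂ A} (hC : IsClosed (C : Set A))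
    (hCD : (C : Set A) ⊆ α.generatorDomain) :
    ∃ K : ℝ, 0 < K ∧ ∀ c ∈ C, ‖α.generator c‖ ≤ K * ‖c‖ := by
  let V : Submodule ℂ A := C.toSubmodule
  have hV : IsClosed (V : Set A) := hC
  have : CompleteSpace V := hV.completeSpace_coe
  have hg : ∀ c : V, α.HasGen c (α.generator c) := fun c => α.hasGen_generator (hCD c.2)
  let T : V →ₗ[ℂ] A :=
    { toFun := fun c => α.generator c
      map_add' := fun x y => ((hg x).add (hg y)).generator_eq
      map_smul' := fun r x => ((hg x).smul r).generator_eq }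
  have hT : Continuous T := by
    refine T.continuous_of_isClosed_graph ?_
    refine IsSeqClosed.isClosed fun p q hp hq => ?_
    have h1 : ∀ n, α.HasGen (p n).1 (p n).2 := fun n => by
      have : (p n).2 = α.generator (p n).1 := (LinearMap.mem_graph_iff T _).1 (hp n)
      rw [this]; exact hg _
    have h2 := HasGen.of_tendsto h1 ((continuous_subtype_val.comp continuous_fst).continuousAt.tendsto.comp hq)
      (continuous_snd.continuousAt.tendsto.comp hq)
    exact (LinearMap.mem_graph_iff T _).2 h2.generator_eq.symm
  refine ⟨‖(⟨T, hT⟩ : V →L[ℂ] A)‖ + 1, by positivity, fun c hc => ?_⟩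
  have := (⟨T, hT⟩ : V →L[ℂ] A).le_opNorm ⟨c, hc⟩
  refine this.trans ?_
  change _ * ‖c‖ ≤ _
  gcongr
  linarith

/-- Almost commuting with `α_t(v)` is thereby arranged by letting `v` almost commute with
`α_{-t}`-translates. -/
theorem norm_commutator_toFun (t : ℝ) (z v : A) :
    ‖z * α.toFun t v - α.toFun t v * z‖ =
      ‖α.toFun (-t) z * v - v * α.toFun (-t) z‖ := by
  rw [← α.norm_toFun t (α.toFun (-t) z * v - v * α.toFun (-t) z)]
  rw [map_sub, map_mul, map_mul, α.toFun_toFun_neg]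

variable {C : NonUnitalStarSubalgebra ℂ A} {F : ℕ → NonUnitalStarSubalgebra ℂ A}

/-- If `α_t` moves the tail symmetries by at most `r ≤ 1/10`, then it moves deeper symmetries
by at most `0.95 r`: otherwise asymptotically independent products of two symmetries would be
moved too far. -/
theorem exists_norm_sub_le_mul (hA : IsSimpleCStarAlgebra A)
    (hC : ∀ x ∈ C, ∀ y ∈ C, x * y = y * x) (hF : Monotone F)
    (hd : Dense (⋃ n, (F n : Set A))) {t r : ℝ} {m : ℕ} (hr : 0 < r) (hr1 : r ≤ 1 / 10)
    (h : ∀ v ∈ tailSymmetries C (F m), ‖α.toFun t v - v‖ ≤ r) :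
    ∃ m', ∀ v ∈ tailSymmetries C (F m'), ‖α.toFun t v - v‖ ≤ 95 / 100 * r := by
  by_contra! hcon
  obtain ⟨u, hu, hur⟩ := hcon m
  have huu := mem_unitary_of_mem_tailSymmetries hu
  set x := α.toFun t u * u with hx
  set a := x - 1 with ha
  have ha' : a = (α.toFun t u - u) * u := by rw [ha, hx, sub_mul, hu.2.2.1]
  have han : ‖a‖ = ‖α.toFun t u - u‖ := by rw [ha', CStarRing.norm_mul_mem_unitary _ huu]
  set η := r ^ 4 / 100 with hη
  have hη0 : 0 < η := by positivity
  obtain ⟨ι, _, b, ρ, hρ, hb⟩ := hA.norm_mul_ge a hη0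
  -- The elements `b` depend on `u` through `a`, so `v` is chosen after `u`, deep enough to almost
  -- commute with all of them and with their translates.
  obtain ⟨m₁, hm₁⟩ := exists_norm_commutator_le hF hd
    (Sum.elim (Sum.elim b fun i => α.toFun (-t) (b i))
      ![α.toFun (-t) u, x, α.toFun (-t) x]) (ε := min (ρ / 2) (η / 2)) (by positivity)
  obtain ⟨v, hv, hvr⟩ := hcon (max m m₁)
  have hvm := tailSymmetries_anti (C := C) (hF (le_max_left m m₁)) hv
  have hvm₁ := tailSymmetries_anti (C := C) (hF (le_max_right m m₁)) hv
  have hvu := mem_unitary_of_mem_tailSymmetries hv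
  have hc := hm₁ v hvu hvm₁.2.2.2
  have hcb : ∀ i, ‖b i * v - v * b i‖ ≤ ρ / 2 := fun i =>
    (hc (Sum.inl (Sum.inl i))).trans (min_le_left _ _)
  have hcb' : ∀ i, ‖b i * α.toFun t v - α.toFun t v * b i‖ ≤ ρ / 2 := fun i => by
    rw [norm_commutator_toFun]
    exact (hc (Sum.inl (Sum.inr i))).trans (min_le_left _ _)
  have hcu : ‖u * α.toFun t v - α.toFun t v * u‖ ≤ η / 2 := by
    rw [norm_commutator_toFun]
    exact (hc (Sum.inr 0)).trans (min_le_right _ _)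
  have hcx : ‖x * v - v * x‖ ≤ η / 2 := (hc (Sum.inr 1)).trans (min_le_right _ _)
  have hcx' : ‖x * α.toFun t v - α.toFun t v * x‖ ≤ η / 2 := by
    rw [norm_commutator_toFun]
    exact (hc (Sum.inr 2)).trans (min_le_right _ _)
  clear hc
  have huv : u * v = v * u := hC u hu.1 v hv.1
  have hαv : α.toFun t v * α.toFun t v = 1 := by rw [← map_mul, hv.2.2.1, map_one]
  have hαu : α.toFun t u * α.toFun t u = 1 := by rw [← map_mul, hu.2.2.1, map_one]
  have hαvu : α.toFun t v ∈ unitary A := by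
    rw [Unitary.mem_iff, ← map_star, hv.2.1]; exact ⟨hαv, hαv⟩
  have hαuu : α.toFun t u ∈ unitary A := by
    rw [Unitary.mem_iff, ← map_star, hu.2.1]; exact ⟨hαu, hαu⟩
  set p := α.toFun t v with hp
  set q := α.toFun t u with hq
  set y := p * v with hy
  set c := y - 1 with hcdef
  have hcn : ‖c‖ = ‖p - v‖ := by
    have : c = (p - v) * v := by rw [hcdef, hy, sub_mul, hv.2.2.1]
    rw [this, CStarRing.norm_mul_mem_unitary _ hvu]
  have hcomm : ∀ z : A, ∀ τ : ℝ, ‖z * v - v * z‖ ≤ τ / 2 → ‖z * p - p * z‖ ≤ τ / 2 →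
      ‖z * y - y * z‖ ≤ τ := by
    intro z τ h1 h2
    have e : z * y - y * z = (z * p - p * z) * v + p * (z * v - v * z) := by
      rw [hy]; noncomm_ring
    rw [e]
    refine (norm_add_le _ _).trans ?_
    rw [CStarRing.norm_mul_mem_unitary _ hvu, CStarRing.norm_mem_unitary_mul _ hαvu]
    linarith
  have hw : u * v ∈ tailSymmetries C (F m) := by
    refine ⟨mul_mem hu.1 hv.1, ?_, ?_, fun z hz => ?_⟩
    · rw [star_mul, hu.2.1, hv.2.1, huv]
    · calc u * v * (u * v) = u * (v * u) * v := by noncomm_ring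
        _ = (u * u) * (v * v) := by rw [← huv]; noncomm_ring
        _ = 1 := by rw [hu.2.2.1, hv.2.2.1, one_mul]
    · rw [← mul_assoc, hu.2.2.2 z hz, mul_assoc, hvm.2.2.2 z hz, mul_assoc]
  have hwr : ‖q * p * (u * v) - 1‖ ≤ r := by
    have h1 := h _ hw
    rw [map_mul] at h1
    have e : q * p * (u * v) - 1 = (q * p - u * v) * (u * v) := by rw [sub_mul, hw.2.2.1]
    rw [e, CStarRing.norm_mul_mem_unitary _ (mul_mem huu hvu)]
    exact h1
  have hpq : p * q = q * p := by rw [hp, hq, ← map_mul, ← map_mul, huv]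
  -- Up to a commutator of `u` with `α_t(v)`, this is `(1 + a)(1 + c) - 1`, the displacement of the
  -- symmetry `uv`, which is at most `r`.
  have hxy : ‖a + c + a * c‖ ≤ r + η := by
    have e : a + c + a * c = (q * p * (u * v) - 1) + q * (u * p - p * u) * v := by
      rw [ha, hcdef, hx, hy]; noncomm_ring
    rw [e]
    refine (norm_add_le _ _).trans ?_
    rw [CStarRing.norm_mul_mem_unitary _ hvu, CStarRing.norm_mem_unitary_mul _ hαuu]
    linarith
  -- Multiplying the displacement of `uv` by `α_t(v)` and `v` on the two sides converts the sum into
  -- a difference, because `v² = 1`.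
  have hac : ‖a - c‖ ≤ r := by
    have e : a - c = p * (q * p * (u * v) - 1) * v := by
      have h1 : p * (q * p * (u * v)) * v = (p * q) * p * u * (v * v) := by noncomm_ring
      rw [mul_sub, sub_mul, h1, hpq, mul_assoc q p p, hαv, hv.2.2.1, ha, hcdef, hx, hy]
      simp
    rw [e, CStarRing.norm_mul_mem_unitary _ hvu, CStarRing.norm_mem_unitary_mul _ hαvu]
    exact hwr
  have hcomm' : ‖a * c - c * a‖ ≤ η := by
    have e : a * c - c * a = x * y - y * x := by rw [ha, hcdef]; noncomm_ring
    rw [e]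
    exact hcomm x η hcx hcx'
  have ha1 : ‖a‖ ≤ r := han.trans_le (h u hu)
  have hc1 : ‖c‖ ≤ r := hcn.trans_le (h v hvm)
  have ha2 : 95 / 100 * r < ‖a‖ := by rw [han]; exact hur
  have hc2 : 95 / 100 * r < ‖c‖ := by rw [hcn]; exact hvr
  have hlow := hb c (hc1.trans (by linarith)) fun i => by
    have e : b i * c - c * b i = b i * y - y * b i := by rw [hcdef]; noncomm_ring
    rw [e]; exact hcomm _ ρ (hcb i) (hcb' i)
  have hw1 : ‖a * c‖ ≤ r * r := (norm_mul_le _ _).trans (by gcongr)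
  have hup : 4 * ‖a * c‖ ≤ (r + η + ‖a * c‖) ^ 2 + r ^ 2 + 2 * η := by
    -- Polarization bounds `‖ac‖` by about `r² / 2`, whereas simplicity makes it nearly `‖a‖‖c‖ >
    -- 0.9 r²`.
    have e : (4 : ℝ) • (a * c) = (a + c) * (a + c) - (a - c) * (a - c) +
        (2 : ℝ) • (a * c - c * a) := by
      have h4 : (4 : ℝ) • (a * c) = a * c + a * c + a * c + a * c := by
        rw [show (4 : ℝ) = 1 + 1 + 1 + 1 by norm_num]; simp only [add_smul, one_smul]
      have h2 : (2 : ℝ) • (a * c - c * a) = (a * c - c * a) + (a * c - c * a) := two_smul _ _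
      rw [h4, h2]; noncomm_ring
    have n1 : ‖a + c‖ ≤ r + η + ‖a * c‖ := by
      have : a + c = (a + c + a * c) - a * c := by abel
      rw [this]
      exact (norm_sub_le _ _).trans (by linarith)
    have n2 : ‖(4 : ℝ) • (a * c)‖ = 4 * ‖a * c‖ := by rw [norm_smul]; norm_num
    have n3 : ‖(2 : ℝ) • (a * c - c * a)‖ ≤ 2 * η := by
      rw [norm_smul]; norm_num; exact hcomm'
    rw [← n2, e]
    have n4 : ‖(a + c) * (a + c)‖ ≤ (r + η + ‖a * c‖) ^ 2 := by
      rw [pow_two]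
      exact (norm_mul_le _ _).trans (mul_le_mul n1 n1 (norm_nonneg _) (by positivity))
    have n5 : ‖(a - c) * (a - c)‖ ≤ r ^ 2 := by
      rw [pow_two]
      exact (norm_mul_le _ _).trans (mul_le_mul hac hac (norm_nonneg _) hr.le)
    have n6 := norm_add_le ((a + c) * (a + c) - (a - c) * (a - c)) ((2 : ℝ) • (a * c - c * a))
    have n7 := norm_sub_le ((a + c) * (a + c)) ((a - c) * (a - c))
    linarith
  exact false_of_independence_estimates hr hr1 hη (norm_nonneg _) ha2 hc2 hw1 hlow hup

/-- Boundedness of the generator on `C` makes all symmetries uniformly Lipschitz in time, which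
starts the contraction at a time `τ` with `Kτ ≤ 1/10`. Iteration reaches displacement `ετ/2` at time
`τ`; at most `1/τ` such steps cover `[0, 1]` at cost `ε/2`, and the remaining time, shorter than
`τ`, costs another `ε/2`. -/
theorem exists_forall_norm_sub_le (hA : IsSimpleCStarAlgebra A)
    (hCc : IsClosed (C : Set A)) (hC : ∀ x ∈ C, ∀ y ∈ C, x * y = y * x)
    (hCD : (C : Set A) ⊆ α.generatorDomain) (hF : Monotone F)
    (hd : Dense (⋃ n, (F n : Set A))) {ε : ℝ} (hε : 0 < ε) :
    ∃ m, ∀ v ∈ tailSymmetries C (F m), ∀ t ∈ Set.Icc (0 : ℝ) 1, ‖α.toFun t v - v‖ ≤ ε := by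
  have := hA.1
  obtain ⟨K, hK, hKC⟩ := α.exists_norm_generator_le hCc hCD
  have hlip : ∀ m, ∀ v ∈ tailSymmetries C (F m), ∀ t : ℝ, ‖α.toFun t v - v‖ ≤ K * |t| := by
    intro m v hv t
    have h1 := (α.hasGen_generator (hCD hv.1)).norm_orbit_sub_le t
    have h2 := hKC v hv.1
    rw [CStarRing.norm_of_mem_unitary (mem_unitary_of_mem_tailSymmetries hv), mul_one] at h2
    exact h1.trans (by gcongr)
  set τ := min (1 / (10 * K)) (ε / (2 * K)) with hτ
  have hτ0 : 0 < τ := by positivity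
  have hτ1 : K * τ ≤ 1 / 10 := by
    calc K * τ ≤ K * (1 / (10 * K)) := by gcongr; exact min_le_left _ _
      _ = 1 / 10 := by field_simp
  have hτ2 : K * τ ≤ ε / 2 := by
    calc K * τ ≤ K * (ε / (2 * K)) := by gcongr; exact min_le_right _ _
      _ = ε / 2 := by field_simp
  have hiter : ∀ n : ℕ, ∃ m, ∀ v ∈ tailSymmetries C (F m),
      ‖α.toFun τ v - v‖ ≤ (95 / 100) ^ n * (1 / 10) := by
    intro n
    induction n with
    | zero =>
      refine ⟨0, fun v hv => (hlip 0 v hv τ).trans ?_⟩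
      rw [abs_of_pos hτ0]; simpa using hτ1
    | succ n ih =>
      obtain ⟨m, hm⟩ := ih
      have hle : ((95 : ℝ) / 100) ^ n ≤ 1 := pow_le_one₀ (by norm_num) (by norm_num)
      obtain ⟨m', hm'⟩ := α.exists_norm_sub_le_mul hA hC hF hd
        (r := (95 / 100) ^ n * (1 / 10)) (by positivity) (by linarith) hm
      exact ⟨m', fun v hv => (hm' v hv).trans (le_of_eq (by ring))⟩
  obtain ⟨n, hn⟩ := exists_pow_lt_of_lt_one (show (0 : ℝ) < ε * τ / 2 by positivity)
    (show (95 / 100 : ℝ) < 1 by norm_num)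
  obtain ⟨m, hm⟩ := hiter n
  refine ⟨m, fun v hv t ht => ?_⟩
  have hmτ : ‖α.toFun τ v - v‖ ≤ ε * τ / 2 := (hm v hv).trans (by
    have : (0 : ℝ) ≤ (95 / 100) ^ n := by positivity
    linarith)
  have hk : ∀ k : ℕ, ‖α.toFun (k * τ) v - v‖ ≤ k * (ε * τ / 2) := by
    intro k
    induction k with
    | zero => simp [α.map_zero]
    | succ k ih =>
      have e : α.toFun ((k + 1 : ℕ) * τ) v - v =
          α.toFun (k * τ) (α.toFun τ v - v) + (α.toFun (k * τ) v - v) := by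
        rw [map_sub, ← α.map_add]
        push_cast
        rw [add_mul, one_mul]; abel
      rw [e]
      refine (norm_add_le _ _).trans ?_
      rw [α.norm_toFun]
      push_cast
      linarith
  set k := ⌊t / τ⌋₊ with hkdef
  have hk1 : k * τ ≤ t := by
    have := Nat.floor_le (div_nonneg ht.1 hτ0.le)
    rwa [le_div_iff₀ hτ0] at this
  have hk2 : t < (k + 1) * τ := by
    have := Nat.lt_floor_add_one (t / τ)
    rwa [div_lt_iff₀ hτ0] at this
  have e : α.toFun t v - v = α.toFun (k * τ) (α.toFun (t - k * τ) v - v) +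
      (α.toFun (k * τ) v - v) := by
    rw [map_sub, ← α.map_add]
    rw [add_sub_cancel]; abel
  rw [e]
  refine (norm_add_le _ _).trans ?_
  rw [α.norm_toFun]
  have h1 := hlip m v hv (t - k * τ)
  rw [abs_of_nonneg (by linarith)] at h1
  have h2 : K * (t - k * τ) ≤ K * τ := by gcongr; linarith
  have h3 : (k : ℝ) * (ε * τ / 2) ≤ ε / 2 := by
    have := ht.2
    nlinarith
  linarith [hk k]

end OneParameterAutomorphismGroup

end TailSymmetries

/-! ### Means over an exhausting sequence of finite groups -/

theorem isUnit_and_norm_le_of_norm_sub_le {R : Type*} [NormedRing R] [CompleteSpace R] {a a' x : R} (ha : a * a' = 1) (ha' : a' * a = 1)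
    (hn : ‖a‖ ≤ 1) (hn' : ‖a'‖ ≤ 1) (hx : ‖x - a‖ ≤ 1 / 2) :
    ‖x‖ ≤ 2 ∧ ∃ y, x * y = 1 ∧ y * x = 1 ∧ ‖y‖ ≤ 2 := by
  have h1 : ‖-(a' * (x - a))‖ < 1 := by
    rw [norm_neg]
    calc ‖a' * (x - a)‖ ≤ 1 * (1 / 2) :=
          (norm_mul_le _ _).trans (mul_le_mul hn' hx (norm_nonneg _) one_pos.le)
      _ < 1 := by norm_num
  have e : x = a * (1 - -(a' * (x - a))) := by
    rw [sub_neg_eq_add, mul_add, ← mul_assoc, ha]; simp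
  set v := Units.oneSub _ h1 with hv
  have hvv : (v : R) = 1 - -(a' * (x - a)) := rfl
  rw [← hvv] at e
  set y := (↑v⁻¹ : R) * a' with hy
  have hxy : x * y = 1 := by
    rw [e, hy, mul_assoc, ← mul_assoc (v : R), Units.mul_inv, one_mul, ha]
  have hyx : y * x = 1 := by
    nth_rewrite 1 [e]
    rw [hy, mul_assoc, ← mul_assoc a', ha', one_mul, Units.inv_mul]
  refine ⟨?_, y, hxy, hyx, ?_⟩
  · have : x = a + (x - a) := by abel
    rw [this]
    exact (norm_add_le _ _).trans (by linarith)
  · have : y = a' - a' * (x - a) * y := by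
      rw [mul_assoc, sub_mul, hxy, mul_sub, ← mul_assoc a' a, ha']; simp
    have h2 : ‖y‖ ≤ 1 + 1 * (1 / 2) * ‖y‖ := by
      nth_rewrite 1 [this]
      refine (norm_sub_le _ _).trans (add_le_add hn' ?_)
      refine (norm_mul_le _ _).trans ?_
      gcongr
      exact (norm_mul_le _ _).trans (mul_le_mul hn' hx (norm_nonneg _) one_pos.le)
    linarith

/-- An exhaustion of a commutative group by finite subgroups `H n`, with sets `T n` of tail elements
such that `H (n + 1) ⊆ H n * T n`. -/
structure GroupExhaustion (G : Type*) [CommGroup G] where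
  /-- The finite subgroups. -/
  H : ℕ → Subgroup G
  /-- The tail elements. -/
  T : ℕ → Set G
  finite : ∀ n, Finite (H n)
  mono : Monotone H
  exhaust : ∀ g, ∃ n, g ∈ H n
  tail_zero : ∀ g, g ∈ T 0
  step : ∀ n, ∀ g ∈ H (n + 1), ∃ k ∈ H n, ∃ k' ∈ T n, g = k * k'

namespace GroupExhaustion

variable {G : Type*} [CommGroup G] (E : GroupExhaustion G)
variable {V W : Type*} [NormedAddCommGroup V] [NormedSpace ℝ V]
  [NormedAddCommGroup W] [NormedSpace ℝ W]

noncomputable instance (n : ℕ) : Fintype (E.H n) := @Fintype.ofFinite _ (E.finite n)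

/-- The average of `f` over `H n`. -/
noncomputable def avg (n : ℕ) (f : G → V) : V :=
  (Fintype.card (E.H n) : ℝ)⁻¹ • ∑ k : E.H n, f k

theorem card_pos (n : ℕ) : (0 : ℝ) < Fintype.card (E.H n) := by
  exact_mod_cast Fintype.card_pos

theorem avg_const (n : ℕ) (v : V) : E.avg n (fun _ => v) = v := by
  rw [avg, Finset.sum_const, Finset.card_univ, ← Nat.cast_smul_eq_nsmul ℝ, smul_smul,
    inv_mul_cancel₀ (E.card_pos n).ne', one_smul]

theorem avg_add (n : ℕ) (f g : G → V) :
    E.avg n (fun k => f k + g k) = E.avg n f + E.avg n g := by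
  simp only [avg, Finset.sum_add_distrib, smul_add]

theorem avg_sub (n : ℕ) (f g : G → V) :
    E.avg n (fun k => f k - g k) = E.avg n f - E.avg n g := by
  simp only [avg, Finset.sum_sub_distrib, smul_sub]

theorem map_avg (n : ℕ) (f : G → V) (L : V →L[ℝ] W) :
    L (E.avg n f) = E.avg n fun k => L (f k) := by
  simp only [avg, map_smul, map_sum]

theorem norm_avg_le (n : ℕ) {f : G → V} {c : ℝ} (h : ∀ k, ‖f k‖ ≤ c) : ‖E.avg n f‖ ≤ c := by
  rw [avg, norm_smul, norm_inv, Real.norm_of_nonneg (E.card_pos n).le]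
  rw [inv_mul_le_iff₀ (E.card_pos n)]
  refine (norm_sum_le _ _).trans ?_
  refine (Finset.sum_le_sum fun (k : E.H n) _ => h k).trans_eq ?_
  rw [Finset.sum_const, Finset.card_univ, nsmul_eq_mul]

theorem avg_mul_left {n : ℕ} {g : G} (hg : g ∈ E.H n) (f : G → V) :
    E.avg n (fun k => f (g * k)) = E.avg n f := by
  rw [avg, avg]
  congr 1
  exact Fintype.sum_equiv (Equiv.mulLeft (⟨g, hg⟩ : E.H n)) _ _ fun k => rfl

theorem avg_mem {n : ℕ} {f : G → V} {S : Submodule ℝ V} (h : ∀ k, f k ∈ S) : E.avg n f ∈ S :=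
  S.smul_mem _ (S.sum_mem fun k _ => h k)

/-- Averaging over `H (n + 1)` is averaging the translates of the `H n`-average. A translation by an
element of `H n` has no effect on the latter, so only the tail factor counts. -/
theorem norm_avg_succ_sub_le {n : ℕ} {f : G → V} {c : ℝ}
    (h : ∀ k, ∀ k' ∈ E.T n, ‖f (k * k') - f k‖ ≤ c) :
    ‖E.avg (n + 1) f - E.avg n f‖ ≤ c := by
  have h1 : E.avg (n + 1) f = E.avg (n + 1) fun g => E.avg n fun k => f (g * k) := by
    have : E.avg (n + 1) (fun g => E.avg n fun k => f (g * k)) =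
        E.avg n fun k => E.avg (n + 1) fun g => f (k * g) := by
      simp only [avg]
      rw [← Finset.smul_sum, Finset.sum_comm, smul_comm, Finset.smul_sum]
      simp only [mul_comm]
    rw [this]
    have h2 : ∀ k : E.H n, (E.avg (n + 1) fun g => f (k * g)) = E.avg (n + 1) f := fun k =>
      E.avg_mul_left (E.mono (Nat.le_succ n) k.2) f
    conv_rhs => rw [avg]
    rw [Finset.sum_congr rfl fun k _ => h2 k]
    exact (E.avg_const n _).symm
  have h3 : ∀ g : E.H (n + 1), ‖(E.avg n fun k => f (g * k)) - E.avg n f‖ ≤ c := by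
    rintro ⟨g, hg⟩
    obtain ⟨k₀, hk₀, k', hk', rfl⟩ := E.step n g hg
    rw [← E.avg_mul_left hk₀ f, ← avg_sub]
    refine E.norm_avg_le n fun k => ?_
    have := h (k₀ * k) k' hk'
    rwa [mul_right_comm] at this
  rw [h1]
  rw [← E.avg_const (n + 1) (E.avg n f)]
  rw [← avg_sub, avg, norm_smul, norm_inv, Real.norm_of_nonneg (E.card_pos _).le,
    inv_mul_le_iff₀ (E.card_pos _)]
  refine (norm_sum_le _ _).trans ?_
  refine (Finset.sum_le_sum fun k _ => h3 k).trans_eq ?_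
  rw [Finset.sum_const, Finset.card_univ, nsmul_eq_mul]

/-- `m` is the limit of the averages of `f`. -/
def HasMean (f : G → V) (m : V) : Prop := Tendsto (fun n => E.avg n f) atTop (𝓝 m)

variable {E}

theorem HasMean.unique {f : G → V} {m m' : V} (h : E.HasMean f m) (h' : E.HasMean f m') : m = m' :=
  tendsto_nhds_unique h h'

variable (E) in
theorem hasMean_const (v : V) : E.HasMean (fun _ => v) v := by
  simp only [HasMean, avg_const]; exact tendsto_const_nhds

theorem HasMean.add {f g : G → V} {m m' : V} (h : E.HasMean f m) (h' : E.HasMean g m') :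
    E.HasMean (fun k => f k + g k) (m + m') := by
  simp only [HasMean, avg_add]; exact Tendsto.add h h'

theorem HasMean.sub {f g : G → V} {m m' : V} (h : E.HasMean f m) (h' : E.HasMean g m') :
    E.HasMean (fun k => f k - g k) (m - m') := by
  simp only [HasMean, avg_sub]; exact Tendsto.sub h h'

theorem HasMean.map {f : G → V} {m : V} (h : E.HasMean f m) (L : V →L[ℝ] W) :
    E.HasMean (fun k => L (f k)) (L m) := by
  simp only [HasMean, ← map_avg]; exact (L.continuous.tendsto m).comp h

theorem HasMean.mul_left {f : G → V} {m : V} (h : E.HasMean f m) (g : G) :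
    E.HasMean (fun k => f (g * k)) m := by
  obtain ⟨n, hn⟩ := E.exhaust g
  refine Tendsto.congr' ?_ h
  filter_upwards [eventually_ge_atTop n] with i hi
  exact (E.avg_mul_left (E.mono hi hn) f).symm

theorem HasMean.norm_le {f : G → V} {m : V} (h : E.HasMean f m) {c : ℝ} (hc : ∀ k, ‖f k‖ ≤ c) :
    ‖m‖ ≤ c :=
  le_of_tendsto h.norm (Eventually.of_forall fun n => E.norm_avg_le n hc)

theorem HasMean.mem {f : G → V} {m : V} (h : E.HasMean f m) {S : Submodule ℝ V}
    (hS : IsClosed (S : Set V)) (hf : ∀ k, f k ∈ S) : m ∈ S :=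
  hS.mem_of_tendsto h (Eventually.of_forall fun _ => E.avg_mem hf)

variable (E) in
theorem exists_hasMean [CompleteSpace V] {f : G → V} {c : ℕ → ℝ} (hc : Summable c)
    (h : ∀ n, ∀ k, ∀ k' ∈ E.T n, ‖f (k * k') - f k‖ ≤ c n) : ∃ m, E.HasMean f m := by
  have : CauchySeq fun n => E.avg n f := by
    refine cauchySeq_of_dist_le_of_summable c (fun n => ?_) hc
    rw [dist_comm, dist_eq_norm]
    exact E.norm_avg_succ_sub_le (h n)
  exact cauchySeq_tendsto_of_complete this

/-! ### Approximate homomorphisms into a Banach algebra are close to homomorphisms -/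

variable {R : Type*} [NormedRing R] [NormedAlgebra ℝ R]

theorem HasMean.const_mul {f : G → R} {m : R} (h : E.HasMean f m) (a : R) :
    E.HasMean (fun k => a * f k) (a * m) := h.map (ContinuousLinearMap.mul ℝ R a)

theorem HasMean.mul_const {f : G → R} {m : R} (h : E.HasMean f m) (a : R) :
    E.HasMean (fun k => f k * a) (m * a) := h.map ((ContinuousLinearMap.mul ℝ R).flip a)

variable [CompleteSpace R]

/-- One Newton step: averaging `x(k)⁻¹ x(kg)` over `k` makes the defect of multiplicativity
quadratically smaller. -/
theorem exists_newton_step {x y : G → R} (hxy : ∀ g, x g * y g = 1) (hyx : ∀ g, y g * x g = 1)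
    (hx : ∀ g, ‖x g‖ ≤ 2) (hy : ∀ g, ‖y g‖ ≤ 2) {θ : ℕ → ℝ} (hθ : Summable θ)
    (h : ∀ n g h, (g ∈ E.T n ∨ h ∈ E.T n) → ‖x (g * h) - x g * x h‖ ≤ θ n) :
    ∃ x' : G → R, (∀ g, E.HasMean (fun k => y k * x (k * g)) (x' g)) ∧
      (∀ n, ∀ g ∈ E.T n, ‖x' g - x g‖ ≤ 2 * θ n) ∧
      ∀ n g h, (g ∈ E.T n ∨ h ∈ E.T n) → ‖x' (g * h) - x' g * x' h‖ ≤ 8 * θ 0 * θ n := by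
  have hm : ∀ g, ∃ m, E.HasMean (fun k => y k * x (k * g)) m := by
    intro g
    refine E.exists_hasMean (hθ.mul_left 10) fun n k k' hk' => ?_
    have hθn : 0 ≤ θ n := (norm_nonneg _).trans (h n k' k (Or.inl hk'))
    set c₁ := x (k' * k) - x k' * x k with hc₁
    set c₂ := x (k' * (k * g)) - x k' * x (k * g) with hc₂
    have e : y (k * k') * x (k * k' * g) - y k * x (k * g) =
        y (k * k') * c₂ - y (k * k') * c₁ * (y k * x (k * g)) := by
      have e1 : k * k' * g = k' * (k * g) := by rw [mul_comm k k', mul_assoc]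
      have e2 : y (k * k') * x (k' * k) = 1 := by rw [mul_comm k' k]; exact hyx _
      have e3 : y (k * k') * c₁ * (y k * x (k * g)) =
          y (k * k') * x (k' * k) * (y k * x (k * g)) -
            y (k * k') * x k' * (x k * y k) * x (k * g) := by rw [hc₁]; noncomm_ring
      rw [e3, e2, hxy, hc₂, e1]; noncomm_ring
    rw [e]
    have n1 : ‖y (k * k') * c₂‖ ≤ 2 * θ n :=
      (norm_mul_le _ _).trans (mul_le_mul (hy _) (h n _ _ (Or.inl hk')) (norm_nonneg _) two_pos.le)
    have n2 : ‖y (k * k') * c₁‖ ≤ 2 * θ n :=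
      (norm_mul_le _ _).trans (mul_le_mul (hy _) (h n _ _ (Or.inl hk')) (norm_nonneg _) two_pos.le)
    have n3 : ‖y k * x (k * g)‖ ≤ 2 * 2 :=
      (norm_mul_le _ _).trans (mul_le_mul (hy _) (hx _) (norm_nonneg _) two_pos.le)
    have n4 : ‖y (k * k') * c₁ * (y k * x (k * g))‖ ≤ 2 * θ n * (2 * 2) :=
      (norm_mul_le _ _).trans (mul_le_mul n2 n3 (norm_nonneg _) (by positivity))
    have := norm_sub_le (y (k * k') * c₂) (y (k * k') * c₁ * (y k * x (k * g)))
    linarith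
  choose x' hx' using hm
  have hd : ∀ n k g, (k ∈ E.T n ∨ g ∈ E.T n) → ‖y k * x (k * g) - x g‖ ≤ 2 * θ n := by
    intro n k g hkg
    have e : y k * x (k * g) - x g = y k * (x (k * g) - x k * x g) := by
      rw [mul_sub, ← mul_assoc, hyx, one_mul]
    rw [e]
    exact (norm_mul_le _ _).trans (mul_le_mul (hy _) (h n _ _ hkg) (norm_nonneg _) two_pos.le)
  have hD : ∀ n, ∀ g ∈ E.T n, ‖x' g - x g‖ ≤ 2 * θ n := fun n g hg =>
    ((hx' g).sub (E.hasMean_const (x g))).norm_le fun k => hd n k g (Or.inr hg)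
  refine ⟨x', hx', hD, fun n g h' hgh => ?_⟩
  have hθ0 : 0 ≤ θ 0 := (norm_nonneg _).trans (h 0 1 1 (Or.inl (E.tail_zero _)))
  have hθn : 0 ≤ θ n := (norm_nonneg _).trans (h n g h' hgh)
  -- The mean of a product of two first-order terms. By `x(kg) y(kg) = 1` and translation
  -- invariance, its expansion has the new multiplicative defect, up to another product of
  -- first-order terms, as its mean; hence the quadratic gain.
  have hQ : E.HasMean (fun k => (y k * x (k * g) - x g) * (y (k * g) * x (k * g * h') - x h'))
      (x' (g * h') - x g * x' h' - (x' g - x g) * x h') := by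
    have t1 : E.HasMean (fun k => x g * (y (k * g) * x (k * g * h'))) (x g * x' h') := by
      have := ((hx' h').mul_left g).const_mul (x g)
      simpa only [mul_comm g] using this
    have t2 : E.HasMean (fun k => (y k * x (k * g) - x g) * x h') ((x' g - x g) * x h') :=
      ((hx' g).sub (E.hasMean_const (x g))).mul_const (x h')
    have t3 := ((hx' (g * h')).sub t1).sub t2
    refine (congrArg (fun f => E.HasMean f _) (funext fun k => ?_)).mp t3
    have e : y k * x (k * (g * h')) = y k * x (k * g) * (y (k * g) * x (k * g * h')) := by
      rw [mul_assoc (y k), ← mul_assoc (x (k * g)), hxy, one_mul, mul_assoc k]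
    rw [e]; noncomm_ring
  have hQn : ‖x' (g * h') - x g * x' h' - (x' g - x g) * x h'‖ ≤ 2 * θ n * (2 * θ 0) := by
    refine hQ.norm_le fun k => ?_
    refine (norm_mul_le _ _).trans ?_
    rcases hgh with hg | hh
    · exact mul_le_mul (hd n k g (Or.inr hg)) (hd 0 _ _ (Or.inl (E.tail_zero _))) (norm_nonneg _)
        (by positivity)
    · rw [mul_comm (2 * θ n)]
      exact mul_le_mul (hd 0 _ _ (Or.inl (E.tail_zero _))) (hd n _ _ (Or.inr hh)) (norm_nonneg _)
        (by positivity)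
  have hDn : ‖(x' g - x g) * (x' h' - x h')‖ ≤ 2 * θ n * (2 * θ 0) := by
    refine (norm_mul_le _ _).trans ?_
    rcases hgh with hg | hh
    · exact mul_le_mul (hD n g hg) (hD 0 _ (E.tail_zero _)) (norm_nonneg _) (by positivity)
    · rw [mul_comm (2 * θ n)]
      exact mul_le_mul (hD 0 _ (E.tail_zero _)) (hD n _ hh) (norm_nonneg _) (by positivity)
  have e : x' (g * h') - x' g * x' h' =
      (x' (g * h') - x g * x' h' - (x' g - x g) * x h') - (x' g - x g) * (x' h' - x h') := by
    noncomm_ring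
  rw [e]
  refine (norm_sub_le _ _).trans ?_
  linarith

/-- A map of `G` to a Banach algebra that is multiplicative up to small errors, summable along the
tails, is close to a multiplicative map. -/
theorem exists_hom_near {a a' x : G → R} (ha : ∀ g, a g * a' g = 1) (ha' : ∀ g, a' g * a g = 1)
    (hn : ∀ g, ‖a g‖ ≤ 1) (hn' : ∀ g, ‖a' g‖ ≤ 1) (hx : ∀ g, ‖x g - a g‖ ≤ 1 / 4)
    {θ : ℕ → ℝ} (hθ : Summable θ) (hθ0 : θ 0 ≤ 1 / 16)
    (h : ∀ n g h, (g ∈ E.T n ∨ h ∈ E.T n) → ‖x (g * h) - x g * x h‖ ≤ θ n)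
    {S : Subalgebra ℝ R} (hS : IsClosed (S : Set R))
    (hSinv : ∀ z ∈ S, ∀ z', z * z' = 1 → z' * z = 1 → z' ∈ S) (hxS : ∀ g, x g ∈ S) :
    ∃ ψ : G → R, (∀ g h, ψ (g * h) = ψ g * ψ h) ∧ (∀ n, ∀ g ∈ E.T n, ‖ψ g - x g‖ ≤ 4 * θ n) ∧
      (∀ g, ‖ψ g - a g‖ ≤ 1 / 2) ∧ ∀ g, ψ g ∈ S := by
  have hθnn : ∀ n, (∃ g, g ∈ E.T n) → 0 ≤ θ n := fun n ⟨g, hg⟩ =>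
    (norm_nonneg _).trans (h n g 1 (Or.inl hg))
  have hθ00 : 0 ≤ θ 0 := hθnn 0 ⟨1, E.tail_zero _⟩
  -- The drift bound is the partial sum of `2 (1/2)^j θ 0`. It never exceeds `1/4`, which together
  -- with the initial `1/4` keeps every iterate within `1/2` of the invertible `a`.
  let Q : ℕ → (G → R) → Prop := fun i z => (∀ g, z g ∈ S) ∧
    (∀ g, ‖z g - x g‖ ≤ 4 * (1 - (1 / 2) ^ i) * θ 0) ∧
    ∀ n g h, (g ∈ E.T n ∨ h ∈ E.T n) → ‖z (g * h) - z g * z h‖ ≤ (1 / 2) ^ i * θ n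
  have hstep : ∀ i z, Q i z → ∃ z', Q (i + 1) z' ∧
      ∀ n, ∀ g ∈ E.T n, ‖z' g - z g‖ ≤ 2 * ((1 / 2) ^ i * θ n) := by
    rintro i z ⟨hzS, hzx, hz⟩
    have hp : (0 : ℝ) < (1 / 2) ^ i := by positivity
    have hp1 : ((1 : ℝ) / 2) ^ i ≤ 1 := pow_le_one₀ (by norm_num) (by norm_num)
    have hza : ∀ g, ‖z g - a g‖ ≤ 1 / 2 := fun g => by
      have : z g - a g = (z g - x g) + (x g - a g) := by abel
      rw [this]
      refine (norm_add_le _ _).trans ?_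
      have h1 := hzx g
      have h2 := hx g
      nlinarith
    have hu := fun g => isUnit_and_norm_le_of_norm_sub_le (ha g) (ha' g) (hn g) (hn' g) (hza g)
    choose hz2 y hzy hyz hy2 using hu
    obtain ⟨z', hz'm, hz'd, hz'⟩ := exists_newton_step hzy hyz hz2 hy2
      (hθ.mul_left ((1 / 2) ^ i)) hz
    refine ⟨z', ⟨fun g => ?_, fun g => ?_, fun n g h' hgh => (hz' n g h' hgh).trans ?_⟩, hz'd⟩
    · exact (hz'm g).mem (S := Subalgebra.toSubmodule S) hS fun k =>
        S.mul_mem (hSinv _ (hzS k) _ (hzy k) (hyz k)) (hzS _)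
    · have : z' g - x g = (z' g - z g) + (z g - x g) := by abel
      rw [this]
      refine (norm_add_le _ _).trans ?_
      have h1 := hz'd 0 g (E.tail_zero g)
      have h2 := hzx g
      rw [pow_succ]
      linarith
    · have h0 : 0 ≤ θ n := by
        rcases hgh with hg | hg
        exacts [hθnn n ⟨_, hg⟩, hθnn n ⟨_, hg⟩]
      rw [pow_succ]
      -- Here `θ 0 ≤ 1/16` turns the quadratic gain into halving of the defect.
      have : 8 * ((1 / 2) ^ i * θ 0) ≤ 1 / 2 := by nlinarith
      calc 8 * ((1 / 2) ^ i * θ 0) * ((1 / 2) ^ i * θ n)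
          ≤ 1 / 2 * ((1 / 2) ^ i * θ n) := by gcongr
        _ = _ := by ring
  have h0 : Q 0 x := ⟨hxS, fun g => by simp, fun n g h' hgh => by simpa using h n g h' hgh⟩
  let z : ∀ i, {z // Q i z} := fun i => Nat.rec ⟨x, h0⟩
    (fun i z => ⟨(hstep i z.1 z.2).choose, (hstep i z.1 z.2).choose_spec.1⟩) i
  have hzs : ∀ i n, ∀ g ∈ E.T n, ‖(z (i + 1)).1 g - (z i).1 g‖ ≤ 2 * ((1 / 2) ^ i * θ n) :=
    fun i => (hstep i (z i).1 (z i).2).choose_spec.2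
  have hz0 : (z 0).1 = x := rfl
  have hd : ∀ g, ∀ n, g ∈ E.T n → ∀ i,
      dist ((z i).1 g) ((z (i + 1)).1 g) ≤ (2 * θ n) * (1 / 2) ^ i := fun g n hg i => by
    rw [dist_comm, dist_eq_norm]
    exact (hzs i n g hg).trans (le_of_eq (by ring))
  have hlim : ∀ g, ∃ m, Tendsto (fun i => (z i).1 g) atTop (𝓝 m) := fun g =>
    cauchySeq_tendsto_of_complete
      (cauchySeq_of_le_geometric (1 / 2) (2 * θ 0) (by norm_num) (hd g 0 (E.tail_zero g)))
  choose ψ hψ using hlim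
  have hψx : ∀ n, ∀ g ∈ E.T n, ‖ψ g - x g‖ ≤ 4 * θ n := fun n g hg => by
    have := dist_le_of_le_geometric_of_tendsto₀ (1 / 2) (2 * θ n) (by norm_num) (hd g n hg) (hψ g)
    rw [hz0, dist_comm, dist_eq_norm] at this
    exact this.trans (le_of_eq (by ring))
  refine ⟨ψ, fun g h' => ?_, hψx, fun g => ?_, fun g =>
    hS.mem_of_tendsto (hψ g) (Eventually.of_forall fun i => (z i).2.1 g)⟩
  · have t1 : Tendsto (fun i => ‖(z i).1 (g * h') - (z i).1 g * (z i).1 h'‖) atTop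
        (𝓝 ‖ψ (g * h') - ψ g * ψ h'‖) := ((hψ (g * h')).sub ((hψ g).mul (hψ h'))).norm
    have t2 : Tendsto (fun i : ℕ => ((1 : ℝ) / 2) ^ i * θ 0) atTop (𝓝 (0 * θ 0)) :=
      (tendsto_pow_atTop_nhds_zero_of_lt_one (by norm_num) (by norm_num)).mul_const _
    have := le_of_tendsto_of_tendsto' t1 t2 fun i => (z i).2.2.2 0 g h' (Or.inl (E.tail_zero g))
    rw [zero_mul, norm_le_zero_iff, sub_eq_zero] at this
    exact this
  · have : ψ g - a g = (ψ g - x g) + (x g - a g) := by abel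
    rw [this]
    refine (norm_add_le _ _).trans ?_
    have h1 := hψx 0 g (E.tail_zero g)
    have h2 := hx g
    linarith

end GroupExhaustion

/-! ### Homomorphisms into the graph of the generator -/

namespace OneParameterAutomorphismGroup

variable {A : Type*} [CStarAlgebra A] (α : OneParameterAutomorphismGroup A)

/-- The graph of the generator, as a subalgebra of the algebra `A ⊕ A` with the product
`(x, y) (x', y') = (x x', x y' + y x')`. -/
noncomputable def generatorGraph : Subalgebra ℝ (TrivSqZeroExt A A) where
  carrier := {p | α.HasGen p.fst p.snd}
  mul_mem' {p q} hp hq := by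
    have := HasGen.mul hp hq
    simpa [TrivSqZeroExt.snd_mul] using this
  add_mem' hp hq := HasGen.add hp hq
  algebraMap_mem' r := by
    have := (α.hasGen_one).smul (r : ℂ)
    simp only [smul_zero] at this
    rw [Set.mem_ofPred_eq, TrivSqZeroExt.algebraMap_eq_inl', TrivSqZeroExt.fst_inl,
      TrivSqZeroExt.snd_inl, Algebra.algebraMap_eq_smul_one]
    exact this

theorem mem_generatorGraph {p : TrivSqZeroExt A A} :
    p ∈ α.generatorGraph ↔ α.HasGen p.fst p.snd := Iff.rfl

theorem isClosed_generatorGraph : IsClosed (α.generatorGraph : Set (TrivSqZeroExt A A)) := by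
  refine IsSeqClosed.isClosed fun p q hp hq => ?_
  exact HasGen.of_tendsto hp ((TrivSqZeroExt.continuous_fst.tendsto q).comp hq)
    ((TrivSqZeroExt.continuous_snd.tendsto q).comp hq)

theorem inverse_mem_generatorGraph (z : TrivSqZeroExt A A) (hz : z ∈ α.generatorGraph)
    (z' : TrivSqZeroExt A A) (h : z * z' = 1) (h' : z' * z = 1) : z' ∈ α.generatorGraph := by
  have h1 : z.fst * z'.fst = 1 := by simpa using congrArg TrivSqZeroExt.fst h
  have h1' : z'.fst * z.fst = 1 := by simpa using congrArg TrivSqZeroExt.fst h'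
  have h2 : z'.fst * z.snd + z'.snd * z.fst = 0 := by
    have := congrArg TrivSqZeroExt.snd h'
    simpa [TrivSqZeroExt.snd_mul] using this
  have h3 : z'.snd = -(z'.fst * z.snd * z'.fst) := by
    have := congrArg (fun x => x * z'.fst) h2
    simp only [add_mul, zero_mul, mul_assoc, h1, mul_one] at this
    rw [eq_neg_of_add_eq_zero_right this, mul_assoc]
  rw [mem_generatorGraph, h3]
  exact HasGen.inverse hz h1 h1'

/-- Each finite average stays in the graph by linearity, and the graph is closed. -/
theorem HasGen.of_hasMean {G : Type*} [CommGroup G] {E : GroupExhaustion G} {f f' : G → A} {m m' : A}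
    (h : ∀ k, α.HasGen (f k) (f' k)) (hm : E.HasMean f m) (hm' : E.HasMean f' m') :
    α.HasGen m m' := by
  refine HasGen.of_tendsto (fun n => ?_) hm hm'
  have := (HasGen.sum Finset.univ fun (k : E.H n) _ => h k).smul
    (((Fintype.card (E.H n) : ℝ)⁻¹ : ℝ) : ℂ)
  exact this

theorem integral_orbit_mul (x c : A) :
    ∫ t in (0 : ℝ)..1, α.toFun t x * c = α.orbitAverage x * c :=
  ((ContinuousLinearMap.mul ℝ A).flip c).intervalIntegral_comp_comm
    (α.orbit_intervalIntegrable x 0 1)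

theorem integral_mul_orbit (x c : A) :
    ∫ t in (0 : ℝ)..1, c * α.toFun t x = c * α.orbitAverage x :=
  (ContinuousLinearMap.mul ℝ A c).intervalIntegral_comp_comm (α.orbit_intervalIntegrable x 0 1)

section

variable {G : Type*} [CommGroup G] {E : GroupExhaustion G} (ι : G →* unitary A) {σ : ℕ → ℝ}

/-- If `α_t`, `0 ≤ t ≤ 1`, moves the unitaries `ι g` little, then `ι` is close to a multiplicative
map with values in the domain of the generator. -/
theorem exists_hom_generatorDomain (hσ : Summable σ) (hσ0 : σ 0 ≤ 1 / 200)
    (h : ∀ n, ∀ g ∈ E.T n, ∀ t ∈ Set.Icc (0 : ℝ) 1, ‖α.toFun t (ι g) - ι g‖ ≤ σ n) :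
    ∃ ψ ψ' : G → A, (∀ g, α.HasGen (ψ g) (ψ' g)) ∧ (∀ g h, ψ (g * h) = ψ g * ψ h) ∧
      (∀ n, ∀ g ∈ E.T n, ‖ψ g - ι g‖ ≤ 25 * σ n ∧ ‖ψ' g‖ ≤ 25 * σ n) ∧
      (∀ g, ‖ψ g‖ ≤ 2 ∧ ‖ψ' g‖ ≤ 1 / 2) ∧ ψ 1 = 1 := by
  have hun : ∀ g, ‖(ι g : A)‖ ≤ 1 := fun g => norm_le_one_of_mem_unitary (ι g).2
  -- The orbit average lies in the domain with derivative `α_1(ι g) - ι g`, so `x` takes values in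
  -- the graph; working in the dual numbers lets one iteration treat an element and its derivative
  -- together.
  set x : G → TrivSqZeroExt A A := fun g =>
    TrivSqZeroExt.inl (α.orbitAverage (ι g)) + TrivSqZeroExt.inr (α.toFun 1 (ι g) - ι g) with hx
  have hx1 : ∀ g, (x g).fst = α.orbitAverage (ι g) := fun g => by simp [hx]
  have hx2 : ∀ g, (x g).snd = α.toFun 1 (ι g) - ι g := fun g => by simp [hx]
  have hnorm : ∀ p : TrivSqZeroExt A A, ‖p‖ = ‖p.fst‖ + ‖p.snd‖ := fun p => TrivSqZeroExt.norm_def p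
  have h1 : ∀ n, ∀ g ∈ E.T n, ‖α.toFun 1 (ι g) - ι g‖ ≤ σ n := fun n g hg =>
    h n g hg 1 ⟨zero_le_one, le_rfl⟩
  have hΘ : ∀ n, ∀ g ∈ E.T n, ‖α.orbitAverage (ι g) - ι g‖ ≤ σ n := fun n g hg =>
    α.norm_orbitAverage_sub_le _ (h n g hg)
  have hΘ1 : ∀ g, ‖α.orbitAverage (ι g)‖ ≤ 1 := fun g => (α.norm_orbitAverage_le _).trans (hun g)
  have key : ∀ n g k, g ∈ E.T n → ‖x (k * g) - x k * x g‖ ≤ 6 * σ n := by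
    intro n g k hg
    rw [hnorm]
    have e2 : (x (k * g) - x k * x g).snd =
        α.toFun 1 (ι k) * (α.toFun 1 (ι g) - ι g - (α.orbitAverage (ι g) - ι g)) +
        ι k * (α.orbitAverage (ι g) - ι g) - α.orbitAverage (ι k) * (α.toFun 1 (ι g) - ι g) := by
      rw [TrivSqZeroExt.snd_sub, TrivSqZeroExt.snd_mul, hx2, hx1, hx2, hx1, hx2, map_mul,
        Submonoid.coe_mul, map_mul, smul_eq_mul, MulOpposite.smul_eq_mul_unop,
        MulOpposite.unop_op]
      noncomm_ring
    have n2 : ‖(x (k * g) - x k * x g).snd‖ ≤ 4 * σ n := by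
      rw [e2]
      have a1 : ‖α.toFun 1 (ι k) * (α.toFun 1 (ι g) - ι g - (α.orbitAverage (ι g) - ι g))‖ ≤
          1 * (σ n + σ n) := by
        refine (norm_mul_le _ _).trans (mul_le_mul ?_ ((norm_sub_le _ _).trans
          (add_le_add (h1 n g hg) (hΘ n g hg))) (norm_nonneg _) zero_le_one)
        rw [norm_toFun]; exact hun k
      have a2 : ‖(ι k : A) * (α.orbitAverage (ι g) - ι g)‖ ≤ 1 * σ n :=
        (norm_mul_le _ _).trans (mul_le_mul (hun k) (hΘ n g hg) (norm_nonneg _) zero_le_one)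
      have a3 : ‖α.orbitAverage (ι k) * (α.toFun 1 (ι g) - ι g)‖ ≤ 1 * σ n :=
        (norm_mul_le _ _).trans (mul_le_mul (hΘ1 k) (h1 n g hg) (norm_nonneg _) zero_le_one)
      refine (norm_sub_le _ _).trans ?_
      have := norm_add_le (α.toFun 1 (ι k) *
        (α.toFun 1 (ι g) - ι g - (α.orbitAverage (ι g) - ι g)))
        ((ι k : A) * (α.orbitAverage (ι g) - ι g))
      linarith
    have n1 : ‖(x (k * g) - x k * x g).fst‖ ≤ 2 * σ n := by
      -- The average of a product minus the product of the averages; only the oscillation of the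
      -- tail element `g` remains.
      have e1 : (x (k * g) - x k * x g).fst =
          ∫ t in (0 : ℝ)..1, α.toFun t (ι k) * (α.toFun t (ι g) - α.orbitAverage (ι g)) := by
        rw [TrivSqZeroExt.fst_sub, TrivSqZeroExt.fst_mul, hx1, hx1, hx1]
        have i1 : IntervalIntegrable (fun t => α.toFun t (ι k) * α.toFun t (ι g))
            MeasureTheory.volume 0 1 :=
          ((α.continuous_orbit _).mul (α.continuous_orbit _)).intervalIntegrable _ _
        have i2 : IntervalIntegrable (fun t => α.toFun t (ι k) * α.orbitAverage (ι g))
            MeasureTheory.volume 0 1 :=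
          ((α.continuous_orbit _).mul continuous_const).intervalIntegrable _ _
        simp only [mul_sub]
        rw [intervalIntegral.integral_sub i1 i2, α.integral_orbit_mul]
        congr 1
        rw [orbitAverage]
        simp only [map_mul, Submonoid.coe_mul]
      rw [e1]
      have := intervalIntegral.norm_integral_le_of_norm_le_const (a := (0 : ℝ)) (b := 1)
        (f := fun t => α.toFun t (ι k) * (α.toFun t (ι g) - α.orbitAverage (ι g)))
        (C := 1 * (σ n + σ n)) (fun t ht => ?_)
      · simpa [two_mul] using this
      · rw [Set.uIoc_of_le zero_le_one] at ht
        refine (norm_mul_le _ _).trans (mul_le_mul ?_ ?_ (norm_nonneg _) zero_le_one)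
        · rw [norm_toFun]; exact hun k
        · have e : α.toFun t (ι g) - α.orbitAverage (ι g) =
            (α.toFun t (ι g) - ι g) - (α.orbitAverage (ι g) - ι g) := by abel
          rw [e]
          exact (norm_sub_le _ _).trans (add_le_add (h n g hg t ⟨ht.1.le, ht.2⟩) (hΘ n g hg))
    linarith
  have key' : ∀ n g k, g ∈ E.T n → ‖x (g * k) - x g * x k‖ ≤ 6 * σ n := by
    intro n g k hg
    rw [hnorm]
    have e2 : (x (g * k) - x g * x k).snd =
        (α.toFun 1 (ι g) - ι g - (α.orbitAverage (ι g) - ι g)) * α.toFun 1 (ι k) +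
        (α.orbitAverage (ι g) - ι g) * ι k - (α.toFun 1 (ι g) - ι g) * α.orbitAverage (ι k) := by
      rw [TrivSqZeroExt.snd_sub, TrivSqZeroExt.snd_mul, hx2, hx1, hx2, hx1, hx2, map_mul,
        Submonoid.coe_mul, map_mul, smul_eq_mul, MulOpposite.smul_eq_mul_unop,
        MulOpposite.unop_op]
      noncomm_ring
    have n2 : ‖(x (g * k) - x g * x k).snd‖ ≤ 4 * σ n := by
      rw [e2]
      have a1 : ‖(α.toFun 1 (ι g) - ι g - (α.orbitAverage (ι g) - ι g)) * α.toFun 1 (ι k)‖ ≤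
          (σ n + σ n) * 1 := by
        refine (norm_mul_le _ _).trans (mul_le_mul ((norm_sub_le _ _).trans
          (add_le_add (h1 n g hg) (hΘ n g hg))) ?_ (norm_nonneg _) ?_)
        · rw [norm_toFun]; exact hun k
        · exact add_nonneg ((norm_nonneg _).trans (h1 n g hg)) ((norm_nonneg _).trans (h1 n g hg))
      have a2 : ‖(α.orbitAverage (ι g) - ι g) * (ι k : A)‖ ≤ σ n * 1 :=
        (norm_mul_le _ _).trans (mul_le_mul (hΘ n g hg) (hun k) (norm_nonneg _)
          ((norm_nonneg _).trans (h1 n g hg)))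
      have a3 : ‖(α.toFun 1 (ι g) - ι g) * α.orbitAverage (ι k)‖ ≤ σ n * 1 :=
        (norm_mul_le _ _).trans (mul_le_mul (h1 n g hg) (hΘ1 k) (norm_nonneg _)
          ((norm_nonneg _).trans (h1 n g hg)))
      refine (norm_sub_le _ _).trans ?_
      have := norm_add_le ((α.toFun 1 (ι g) - ι g - (α.orbitAverage (ι g) - ι g)) *
        α.toFun 1 (ι k)) ((α.orbitAverage (ι g) - ι g) * (ι k : A))
      linarith
    have n1 : ‖(x (g * k) - x g * x k).fst‖ ≤ 2 * σ n := by
      have e1 : (x (g * k) - x g * x k).fst =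
          ∫ t in (0 : ℝ)..1, (α.toFun t (ι g) - α.orbitAverage (ι g)) * α.toFun t (ι k) := by
        rw [TrivSqZeroExt.fst_sub, TrivSqZeroExt.fst_mul, hx1, hx1, hx1]
        have i1 : IntervalIntegrable (fun t => α.toFun t (ι g) * α.toFun t (ι k))
            MeasureTheory.volume 0 1 :=
          ((α.continuous_orbit _).mul (α.continuous_orbit _)).intervalIntegrable _ _
        have i2 : IntervalIntegrable (fun t => α.orbitAverage (ι g) * α.toFun t (ι k))
            MeasureTheory.volume 0 1 :=
          (continuous_const.mul (α.continuous_orbit _)).intervalIntegrable _ _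
        simp only [sub_mul]
        rw [intervalIntegral.integral_sub i1 i2, α.integral_mul_orbit]
        congr 1
        rw [orbitAverage]
        simp only [map_mul, Submonoid.coe_mul]
      rw [e1]
      have := intervalIntegral.norm_integral_le_of_norm_le_const (a := (0 : ℝ)) (b := 1)
        (f := fun t => (α.toFun t (ι g) - α.orbitAverage (ι g)) * α.toFun t (ι k))
        (C := (σ n + σ n) * 1) (fun t ht => ?_)
      · simpa [two_mul] using this
      · rw [Set.uIoc_of_le zero_le_one] at ht
        refine (norm_mul_le _ _).trans (mul_le_mul ?_ ?_ (norm_nonneg _) ?_)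
        · have e : α.toFun t (ι g) - α.orbitAverage (ι g) =
            (α.toFun t (ι g) - ι g) - (α.orbitAverage (ι g) - ι g) := by abel
          rw [e]
          exact (norm_sub_le _ _).trans (add_le_add (h n g hg t ⟨ht.1.le, ht.2⟩) (hΘ n g hg))
        · rw [norm_toFun]; exact hun k
        · exact add_nonneg ((norm_nonneg _).trans (h1 n g hg)) ((norm_nonneg _).trans (h1 n g hg))
    linarith
  have hab : ∀ g, (ι g : A) * star (ι g : A) = 1 := fun g => (Unitary.mem_iff.1 (ι g).2).2
  have hba : ∀ g, star (ι g : A) * (ι g : A) = 1 := fun g => (Unitary.mem_iff.1 (ι g).2).1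
  obtain ⟨ψ, hψm, hψx, hψa, hψS⟩ := GroupExhaustion.exists_hom_near (E := E)
    (a := fun g => TrivSqZeroExt.inl (ι g : A)) (a' := fun g => TrivSqZeroExt.inl (star (ι g : A)))
    (x := x) (θ := fun n => 6 * σ n) (S := α.generatorGraph)
    (fun g => by rw [← TrivSqZeroExt.inl_mul, hab]; rfl)
    (fun g => by rw [← TrivSqZeroExt.inl_mul, hba]; rfl)
    (fun g => by rw [hnorm]; simpa using hun g) (fun g => by rw [hnorm]; simpa using hun g)
    (fun g => by
      rw [hnorm, TrivSqZeroExt.fst_sub, TrivSqZeroExt.snd_sub, hx1, hx2, TrivSqZeroExt.fst_inl,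
        TrivSqZeroExt.snd_inl, sub_zero]
      have := hΘ 0 g (E.tail_zero g)
      have := h1 0 g (E.tail_zero g)
      linarith) (hσ.mul_left 6) (by linarith)
    (fun n g k hgk => hgk.elim (key' n g k) (key n k g))
    α.isClosed_generatorGraph α.inverse_mem_generatorGraph
    (fun g => by rw [mem_generatorGraph, hx1, hx2]; exact α.hasGen_orbitAverage _)
  have hψ2 : ∀ g, ‖(ψ g).fst - ι g‖ ≤ 1 / 2 ∧ ‖(ψ g).snd‖ ≤ 1 / 2 := fun g => by
    have := hψa g
    rw [hnorm, TrivSqZeroExt.fst_sub, TrivSqZeroExt.snd_sub, TrivSqZeroExt.fst_inl,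
      TrivSqZeroExt.snd_inl, sub_zero] at this
    have := norm_nonneg ((ψ g).fst - ι g)
    have := norm_nonneg (ψ g).snd
    constructor <;> linarith
  have hmul : ∀ g k, (ψ (g * k)).fst = (ψ g).fst * (ψ k).fst := fun g k => by
    rw [hψm, TrivSqZeroExt.fst_mul]
  refine ⟨fun g => (ψ g).fst, fun g => (ψ g).snd, hψS, hmul, fun n g hg => ?_, fun g =>
    ⟨?_, (hψ2 g).2⟩, ?_⟩
  · have := hψx n g hg
    rw [hnorm, TrivSqZeroExt.fst_sub, TrivSqZeroExt.snd_sub, hx1, hx2] at this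
    have t1 := hΘ n g hg
    have t2 := h1 n g hg
    have t3 := norm_nonneg ((ψ g).fst - α.orbitAverage (ι g))
    have t4 := norm_nonneg ((ψ g).snd - (α.toFun 1 (ι g) - ι g))
    constructor
    · have e : (ψ g).fst - ι g = ((ψ g).fst - α.orbitAverage (ι g)) +
        (α.orbitAverage (ι g) - ι g) := by abel
      rw [e]
      exact (norm_add_le _ _).trans (by linarith)
    · have e : (ψ g).snd = ((ψ g).snd - (α.toFun 1 (ι g) - ι g)) + (α.toFun 1 (ι g) - ι g) := by
        abel
      beta_reduce
      rw [e]
      exact (norm_add_le _ _).trans (by linarith)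
  · have e : (ψ g).fst = ((ψ g).fst - ι g) + ι g := by abel
    beta_reduce
    rw [e]
    exact (norm_add_le _ _).trans (by linarith [(hψ2 g).1, hun g])
  -- The element `ψ 1` is an idempotent close to a unitary, hence invertible, hence `1`.
  · obtain ⟨_, y, hy, hy', _⟩ := isUnit_and_norm_le_of_norm_sub_le (hab 1) (hba 1) (hun 1)
      (by rw [norm_star]; exact hun 1) (hψ2 1).1
    have := hmul 1 1
    rw [mul_one] at this
    calc (ψ 1).fst = (ψ 1).fst * ((ψ 1).fst * y) := by rw [hy, mul_one]
      _ = (ψ 1).fst * (ψ 1).fst * y := by rw [mul_assoc]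
      _ = 1 := by rw [← this, hy]

end

end OneParameterAutomorphismGroup

/-! ### Unitarization and inner implementation -/

theorem exists_sqrt_near_one {A : Type*} [CStarAlgebra A] {r : A} (hr : IsSelfAdjoint r)
    (h : ‖r - 1‖ ≤ 1 / 2) :
    ∃ s : A, IsSelfAdjoint s ∧ s * s = r ∧ ‖s - 1‖ ≤ 1 / 2 := by
  refine ⟨cfc Real.sqrt r, cfc_predicate _ _, ?_, ?_⟩
  · rw [← cfc_mul _ _ r]
    nth_rewrite 2 [← cfc_id' ℝ r]
    refine cfc_congr fun x hx => Real.mul_self_sqrt ?_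
    have := abs_le.1 (spectrum_near_one h hx)
    linarith
  · have e : cfc Real.sqrt r - 1 = cfc (fun x => √x - 1) r := by
      rw [cfc_sub _ _ r, cfc_const_one ℝ r]
    rw [e]
    refine norm_cfc_le (by norm_num) fun x hx => ?_
    have h1 := spectrum_near_one h hx
    have h2 := abs_le.1 h1
    have h3 : x - 1 = (√x - 1) * (√x + 1) := by
      have := Real.mul_self_sqrt (show 0 ≤ x by linarith)
      linear_combination -this
    have h4 := Real.sqrt_nonneg x
    rw [h3, abs_mul, abs_of_nonneg (show 0 ≤ √x + 1 by linarith)] at h1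
    rw [Real.norm_eq_abs]
    nlinarith [abs_nonneg (√x - 1)]

theorem isUnit_of_norm_sub_one_lt {R : Type*} [NormedRing R] [CompleteSpace R] {x : R}
    (h : ‖x - 1‖ < 1) : IsUnit x := by
  rw [norm_sub_rev] at h
  simpa using (Units.oneSub (1 - x) h).isUnit

namespace OneParameterAutomorphismGroup

variable {A : Type*} [CStarAlgebra A] (α : OneParameterAutomorphismGroup A)
variable {G : Type*} [CommGroup G] {E : GroupExhaustion G} (ι : G →* unitary A) {σ : ℕ → ℝ}

/-- Unitarization: if `ψ` is a multiplicative map that is similar to `ι` and has an inner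
derivation, and `R` satisfies `ψ R ψ⋆ = R`, then `ι` is unitarily conjugate to a unitary
representation with an inner derivation. -/
theorem exists_unitary_conj_of_similar {ψ ψ' : G → A} {S h R R' : A}
    (hψ : ∀ g, α.HasGen (ψ g) (ψ' g)) (hmul : ∀ g k, ψ (g * k) = ψ g * ψ k) (hone : ψ 1 = 1)
    (hS : IsUnit S) (hSψ : ∀ g, ψ g * S = S * ι g) (hh : ∀ g, ψ' g = h * ψ g - ψ g * h)
    (hR : α.HasGen R R') (hRs : IsSelfAdjoint R) (hR1 : ‖R - 1‖ ≤ 1 / 2)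
    (hRψ : ∀ g, ψ g * R * star (ψ g) = R) :
    ∃ W ∈ unitary A, ∃ k : A, star k = -k ∧ ∀ g,
      α.HasGen (W * ι g * star W) (k * (W * ι g * star W) - W * ι g * star W * k) := by
  obtain ⟨ρ, hρs, hρρ, hρ1⟩ := exists_sqrt_near_one hRs hR1
  obtain ⟨ρ', hρ'⟩ := exists_sylvester hρ1 R'
  have hρg : α.HasGen ρ ρ' := hR.of_mul_self hρ1 hρρ hρ'
  have hρu : IsUnit ρ := isUnit_of_norm_sub_one_lt (hρ1.trans_lt (by norm_num))
  set i := Ring.inverse ρ with hi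
  have hρi : ρ * i = 1 := Ring.mul_inverse_cancel _ hρu
  have hiρ : i * ρ = 1 := Ring.inverse_mul_cancel _ hρu
  have his : star i = i := by rw [hi, ← Ring.inverse_star, hρs.star_eq]
  -- With `ρ² = R` and `ψ R ψ⋆ = R`, conjugation by `ρ` makes `ψ` unitary.
  set U : G → A := fun g => i * ψ g * ρ with hU
  have hUmul : ∀ g k, U (g * k) = U g * U k := fun g k => by
    simp only [hU, hmul]
    calc i * (ψ g * ψ k) * ρ = i * ψ g * 1 * ψ k * ρ := by noncomm_ring
      _ = _ := by rw [← hρi]; noncomm_ring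
  have hUone : U 1 = 1 := by simp only [hU, hone, mul_one, hiρ]
  have hUstar : ∀ g, U g * star (U g) = 1 := fun g => by
    simp only [hU, star_mul, his, hρs.star_eq]
    calc i * ψ g * ρ * (ρ * (star (ψ g) * i)) = i * (ψ g * (ρ * ρ) * star (ψ g)) * i := by
          noncomm_ring
      _ = 1 := by rw [hρρ, hRψ, ← hρρ, ← mul_assoc, hiρ, one_mul, hρi]
  have hUinv : ∀ g, U g * U g⁻¹ = 1 ∧ U g⁻¹ * U g = 1 := fun g => by
    rw [← hUmul, ← hUmul, mul_inv_cancel, inv_mul_cancel, hUone]; exact ⟨rfl, rfl⟩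
  have hUs : ∀ g, star (U g) = U g⁻¹ := fun g => by
    calc star (U g) = U g⁻¹ * U g * star (U g) := by rw [(hUinv g).2, one_mul]
      _ = U g⁻¹ := by rw [mul_assoc, hUstar, mul_one]
  -- `V` intertwines the two unitary representations `ι` and `U`, so `V⋆V` commutes with `ι` and the
  -- unitary part of `V` intertwines as well.
  set V := i * S with hV
  have hVu : IsUnit V := (hρu.ringInverse).mul hS
  have hVι : ∀ g, V * ι g = U g * V := fun g => by
    simp only [hV, hU]
    rw [mul_assoc, ← hSψ]
    calc i * (ψ g * S) = i * ψ g * 1 * S := by noncomm_ring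
      _ = _ := by rw [← hρi]; noncomm_ring
  have hι : ∀ g, star (ι g : A) = ι g⁻¹ := fun g => by
    rw [map_inv]; rfl
  have hcomm : ∀ g, Commute (star V * V) (ι g : A) := fun g => by
    have h1 : (ι g : A) * star V = star V * U g := by
      have := congrArg star (hVι g⁻¹)
      rwa [star_mul V, star_mul (U _) V, hUs, inv_inv, hι, inv_inv] at this
    rw [commute_iff_eq, mul_assoc, hVι, ← mul_assoc, ← h1, mul_assoc]
  have hcomm' : ∀ g, Commute (Ring.inverse (absValue V)) (ι g : A) := fun g => by
    have h1 : Commute (absValue V) (ι g : A) := (hcomm g).cfc_real _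
    have h2 := isUnit_absValue hVu
    have e := Ring.inverse_mul_cancel _ h2
    have e' := Ring.mul_inverse_cancel _ h2
    rw [commute_iff_eq]
    calc Ring.inverse (absValue V) * ι g =
        Ring.inverse (absValue V) * (ι g * absValue V) * Ring.inverse (absValue V) := by
          rw [mul_assoc, mul_assoc, e', mul_one]
      _ = _ := by rw [← h1.eq, ← mul_assoc, e, one_mul]
  set W := unitaryPart V with hW
  have hWmem : W ∈ unitary A := unitaryPart_mem hVu
  have hWι : ∀ g, W * ι g = U g * W := fun g => by
    rw [hW, unitaryPart, mul_assoc, (hcomm' g).eq, ← mul_assoc, hVι, mul_assoc]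
  have hWU : ∀ g, W * ι g * star W = U g := fun g => by
    rw [hWι, mul_assoc, (Unitary.mem_iff.1 hWmem).2, mul_one]
  -- The implementing element for `ρ⁻¹ ψ ρ`: the conjugate of `h`, corrected by the logarithmic
  -- derivative of `ρ`.
  set h' := i * h * ρ - i * ρ' with hh'
  have hUg : ∀ g, α.HasGen (U g) (h' * U g - U g * h') := fun g => by
    have h1 := ((hρg.inverse hρi hiρ).mul (hψ g)).mul hρg
    refine (congrArg (fun z => α.HasGen (U g) z) ?_).mp h1
    rw [hh g]
    have e1 : h' * U g = i * h * (ρ * i) * ψ g * ρ - i * ρ' * i * ψ g * ρ := by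
      rw [hh']; simp only [hU]; noncomm_ring
    have e2 : U g * h' = i * ψ g * (ρ * i) * h * ρ - i * ψ g * (ρ * i) * ρ' := by
      rw [hh']; simp only [hU]; noncomm_ring
    rw [e1, e2, hρi]; noncomm_ring
  -- Because `U g⋆ = U g⁻¹`, the element `-h'⋆` implements the same derivation, and so does the
  -- average of the two, which is skew-adjoint.
  refine ⟨W, hWmem, (1 / 2 : ℂ) • (h' - star h'), ?_, fun g => ?_⟩
  · rw [star_smul, star_sub, star_star, ← smul_neg, neg_sub]
    simp
  · rw [hWU]
    have h1 : α.HasGen (U g) (-(star h' * U g - U g * star h')) := by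
      have := (hUg g⁻¹).star
      rw [hUs, inv_inv, star_sub, star_mul h', star_mul (U _) h', hUs, inv_inv] at this
      rwa [neg_sub]
    have h2 := (hUg g).unique h1
    refine (congrArg (fun z => α.HasGen (U g) z) ?_).mp (hUg g)
    rw [smul_mul_assoc, mul_smul_comm, ← smul_sub]
    have e : (h' - star h') * U g - U g * (h' - star h') =
        (h' * U g - U g * h') + (-(star h' * U g - U g * star h')) := by
      rw [sub_mul, mul_sub (U g)]; abel
    rw [e, ← h2, ← two_smul ℂ, smul_smul]
    norm_num

/-- If `α_t`, `0 ≤ t ≤ 1`, moves the unitaries `ι g` little, then `ι` is unitarily conjugate to a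
representation on which the generator is inner. -/
theorem exists_unitary_conj_hasGen (hσ : Summable σ) (hσ0 : σ 0 ≤ 1 / 200)
    (h : ∀ n, ∀ g ∈ E.T n, ∀ t ∈ Set.Icc (0 : ℝ) 1, ‖α.toFun t (ι g) - ι g‖ ≤ σ n) :
    ∃ W ∈ unitary A, ∃ k : A, star k = -k ∧ ∀ g,
      α.HasGen (W * ι g * star W) (k * (W * ι g * star W) - W * ι g * star W * k) := by
  obtain ⟨ψ, ψ', hψ, hmul, hT, hb, hone⟩ := α.exists_hom_generatorDomain ι hσ hσ0 h
  have hι : ∀ g, ((ι g⁻¹ : unitary A) : A) = star (ι g : A) := fun g => by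
    rw [map_inv]; rfl
  have hun : ∀ g, ‖(ι g : A)‖ ≤ 1 := fun g => norm_le_one_of_mem_unitary (ι g).2
  have huι : ∀ g, (ι g : A) * star (ι g : A) = 1 := fun g => (Unitary.mem_iff.1 (ι g).2).2
  have huι' : ∀ g, star (ι g : A) * (ι g : A) = 1 := fun g => (Unitary.mem_iff.1 (ι g).2).1
  have hinv : ∀ g, ψ g * ψ g⁻¹ = 1 := fun g => by rw [← hmul, mul_inv_cancel, hone]
  have hinv' : ∀ g, ψ g⁻¹ * ψ g = 1 := fun g => by rw [← hmul, inv_mul_cancel, hone]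
  have hψ1 : ∀ n, ∀ g ∈ E.T n, ‖ψ g - ι g‖ ≤ 25 * σ n := fun n g hg => (hT n g hg).1
  have hψ2 : ∀ n, ∀ g ∈ E.T n, ‖ψ' g‖ ≤ 25 * σ n := fun n g hg => (hT n g hg).2
  have hb1 := fun g => (hb g).1
  have hb2 := fun g => (hb g).2
  have hσn : ∀ n, (∃ g, g ∈ E.T n) → 0 ≤ 25 * σ n := fun n ⟨g, hg⟩ =>
    (norm_nonneg _).trans (hψ1 n g hg)
  -- the intertwiner
  obtain ⟨S, hS⟩ : ∃ S, E.HasMean (fun k => ψ k * star (ι k : A)) S := by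
    refine E.exists_hasMean (hσ.mul_left 50) fun n k k' hk' => ?_
    have e : ψ (k * k') * star (ι (k * k') : A) - ψ k * star (ι k : A) =
        ψ k * ((ψ k' - ι k') * star (ι k' : A)) * star (ι k : A) := by
      rw [hmul, map_mul, Submonoid.coe_mul, star_mul, sub_mul, huι]
      have : star (ι k' : A) * star (ι k : A) = star (ι k : A) * star (ι k' : A) := by
        rw [← hι, ← hι, ← Submonoid.coe_mul, ← Submonoid.coe_mul, ← map_mul, ← map_mul, mul_comm]
      noncomm_ring
    rw [e, ← hι k, CStarRing.norm_mul_mem_unitary _ (ι k⁻¹).2]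
    refine (norm_mul_le _ _).trans ?_
    rw [← hι k', CStarRing.norm_mul_mem_unitary _ (ι k'⁻¹).2]
    calc ‖ψ k‖ * ‖ψ k' - ι k'‖ ≤ 2 * (25 * σ n) :=
          mul_le_mul (hb1 k) (hψ1 n k' hk') (norm_nonneg _) two_pos.le
      _ = 50 * σ n := by ring
  have hS1 : ‖S - 1‖ ≤ 1 / 4 := by
    refine (hS.sub (E.hasMean_const 1)).norm_le fun k => ?_
    have e : ψ k * star (ι k : A) - 1 = (ψ k - ι k) * star (ι k : A) := by rw [sub_mul, huι]
    rw [e, ← hι k, CStarRing.norm_mul_mem_unitary _ (ι k⁻¹).2]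
    exact (hψ1 0 k (E.tail_zero k)).trans (by linarith)
  have hSψ : ∀ g, ψ g * S = S * ι g := fun g => by
    have h1 := ((hS.mul_left g).mul_const (ι g : A))
    have h2 := hS.const_mul (ψ g)
    refine (h1.unique ((congrArg (fun f => E.HasMean f _) (funext fun k => ?_)).mp h2)).symm
    rw [hmul, map_mul, Submonoid.coe_mul, star_mul]
    calc ψ g * (ψ k * star (ι k : A)) = ψ g * (ψ k * star (ι k : A)) * 1 := (mul_one _).symm
      _ = _ := by rw [← huι' g]; noncomm_ring
  have hmul' : ∀ g k, ψ' (g * k) = ψ g * ψ' k + ψ' g * ψ k := fun g k => by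
    have h1 := hψ (g * k)
    rw [hmul] at h1
    exact h1.unique ((hψ g).mul (hψ k))
  -- the implementing element
  obtain ⟨d, hd⟩ : ∃ d, E.HasMean (fun k => ψ' k * ψ k⁻¹) d := by
    refine E.exists_hasMean (hσ.mul_left 200) fun n k k' hk' => ?_
    have e : ψ' (k * k') * ψ (k * k')⁻¹ - ψ' k * ψ k⁻¹ = ψ k * ψ' k' * ψ k'⁻¹ * ψ k⁻¹ := by
      rw [mul_inv_rev, hmul, hmul']
      have : ψ' k * ψ k⁻¹ = ψ' k * (ψ k' * ψ k'⁻¹) * ψ k⁻¹ := by rw [hinv, mul_one]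
      rw [this]; noncomm_ring
    rw [e]
    calc ‖ψ k * ψ' k' * ψ k'⁻¹ * ψ k⁻¹‖ ≤ ‖ψ k‖ * ‖ψ' k'‖ * ‖ψ k'⁻¹‖ * ‖ψ k⁻¹‖ := by
          refine (norm_mul_le _ _).trans ?_
          gcongr
          refine (norm_mul_le _ _).trans ?_
          gcongr
          exact norm_mul_le _ _
      _ ≤ 2 * (25 * σ n) * 2 * 2 := by
          have := hσn n ⟨k', hk'⟩
          gcongr
          exacts [hb1 k, hψ2 n k' hk', hb1 _, hb1 _]
      _ = 200 * σ n := by ring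
  -- Invariance of the mean evaluates it after translation by `g`; the Leibniz rule for `ψ' (g k)`
  -- evaluates it a second way.
  have hdψ : ∀ g, ψ' g = d * ψ g - ψ g * d := by
    intro g
    have h1 := (hd.mul_left g).mul_const (ψ g)
    have h2 := (hd.const_mul (ψ g)).add (E.hasMean_const (ψ' g))
    have h3 := h1.unique ((congrArg (fun f => E.HasMean f _) (funext fun k => ?_)).mp h2)
    · rw [h3]; abel
    · rw [mul_inv_rev, hmul, hmul']
      calc ψ g * (ψ' k * ψ k⁻¹) + ψ' g =
          ψ g * (ψ' k * ψ k⁻¹) * 1 + ψ' g * 1 * 1 := by noncomm_ring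
        _ = ψ g * (ψ' k * ψ k⁻¹) * (ψ g⁻¹ * ψ g) + ψ' g * (ψ k * ψ k⁻¹) * (ψ g⁻¹ * ψ g) := by
          rw [hinv, hinv']
        _ = _ := by noncomm_ring
  have hY : ∀ n, ∀ k ∈ E.T n, ‖ψ k * star (ψ k) - 1‖ ≤ 75 * σ n := by
    intro n k hk
    have e : ψ k * star (ψ k) - 1 = (ψ k - ι k) * star (ψ k) + ι k * star (ψ k - ι k) := by
      rw [star_sub, mul_sub, huι]; noncomm_ring
    rw [e]
    refine (norm_add_le _ _).trans ?_
    rw [CStarRing.norm_mem_unitary_mul _ (ι k).2, norm_star]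
    have : ‖(ψ k - ι k) * star (ψ k)‖ ≤ 25 * σ n * 2 :=
      (norm_mul_le _ _).trans (mul_le_mul (hψ1 n k hk) (by rw [norm_star]; exact hb1 k)
        (norm_nonneg _) (hσn n ⟨k, hk⟩))
    linarith [hψ1 n k hk]
  have h3 : ∀ (a b c : A) (p q r : ℝ), ‖a‖ ≤ p → ‖b‖ ≤ q → ‖c‖ ≤ r →
      ‖a * b * star c‖ ≤ p * q * r := by
    intro a b c p q r ha hb hc
    have hp := (norm_nonneg a).trans ha
    have hq := (norm_nonneg b).trans hb
    refine (norm_mul_le _ _).trans ?_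
    rw [norm_star]
    exact mul_le_mul ((norm_mul_le _ _).trans (mul_le_mul ha hb (norm_nonneg _) hp)) hc
      (norm_nonneg _) (by positivity)
  obtain ⟨R, hR⟩ : ∃ R, E.HasMean (fun k => ψ k * star (ψ k)) R := by
    refine E.exists_hasMean (hσ.mul_left 300) fun n k k' hk' => ?_
    have e : ψ (k * k') * star (ψ (k * k')) - ψ k * star (ψ k) =
        ψ k * (ψ k' * star (ψ k') - 1) * star (ψ k) := by
      rw [hmul, star_mul]; noncomm_ring
    rw [e]
    exact (h3 _ _ _ _ _ _ (hb1 k) (hY n k' hk') (hb1 k)).trans (le_of_eq (by ring))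
  -- The derivatives of `ψ k ψ k⋆` also have a mean, so closedness puts `R` in the domain, as needed
  -- to differentiate its square root.
  obtain ⟨R', hR'⟩ : ∃ R', E.HasMean (fun k => ψ k * star (ψ' k) + ψ' k * star (ψ k)) R' := by
    refine E.exists_hasMean (hσ.mul_left 550) fun n k k' hk' => ?_
    have e : ψ (k * k') * star (ψ' (k * k')) + ψ' (k * k') * star (ψ (k * k')) -
        (ψ k * star (ψ' k) + ψ' k * star (ψ k)) =
        ψ k * (ψ k' * star (ψ k') - 1) * star (ψ' k) +
          ψ' k * (ψ k' * star (ψ k') - 1) * star (ψ k) +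
          ψ k * (ψ k' * star (ψ' k') + ψ' k' * star (ψ k')) * star (ψ k) := by
      rw [hmul, hmul', star_mul, star_add, star_mul, star_mul]; noncomm_ring
    rw [e]
    have hY2 : ‖ψ k' * star (ψ' k') + ψ' k' * star (ψ k')‖ ≤ 100 * σ n := by
      refine (norm_add_le _ _).trans ?_
      have a1 : ‖ψ k' * star (ψ' k')‖ ≤ 2 * (25 * σ n) :=
        (norm_mul_le _ _).trans (mul_le_mul (hb1 k') (by rw [norm_star]; exact hψ2 n k' hk')
          (norm_nonneg _) two_pos.le)
      have a2 : ‖ψ' k' * star (ψ k')‖ ≤ 25 * σ n * 2 :=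
        (norm_mul_le _ _).trans (mul_le_mul (hψ2 n k' hk') (by rw [norm_star]; exact hb1 k')
          (norm_nonneg _) (hσn n ⟨k', hk'⟩))
      linarith
    have a1 := h3 _ _ _ _ _ _ (hb1 k) (hY n k' hk') (hb2 k)
    have a2 := h3 _ _ _ _ _ _ (hb2 k) (hY n k' hk') (hb1 k)
    have a3 := h3 _ _ _ _ _ _ (hb1 k) hY2 (hb1 k)
    refine norm_add₃_le.trans ?_
    linarith
  refine α.exists_unitary_conj_of_similar ι hψ hmul hone
    (isUnit_of_norm_sub_one_lt (hS1.trans_lt (by norm_num))) hSψ hdψ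
    (HasGen.of_hasMean α (fun k => (hψ k).mul (hψ k).star) hR hR') ?_ ?_ ?_
  · have h1 := hR.map (starL' ℝ (A := A) : A →L[ℝ] A)
    refine GroupExhaustion.HasMean.unique h1 ((congrArg (fun f => E.HasMean f _) (funext fun k => ?_)).mp hR)
    simp
  · refine ((hR.sub (E.hasMean_const 1)).norm_le fun k => hY 0 k (E.tail_zero k)).trans ?_
    linarith
  · intro g
    have h1 := (hR.const_mul (ψ g)).mul_const (star (ψ g))
    refine GroupExhaustion.HasMean.unique h1
      ((congrArg (fun f => E.HasMean f _) (funext fun k => ?_)).mp (hR.mul_left g))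
    rw [hmul, star_mul]; noncomm_ring

end OneParameterAutomorphismGroup

/-! ### Masas -/

section Masa

variable {A : Type*} [CStarAlgebra A]

/-- The set `C ∪ {y}` is commutative and closed under adjoints, so its double commutant is
commutative and closed; its intersection with `B` contains `C`, and maximality applies. -/
theorem IsMasaOf.mem_of_isSelfAdjoint {C B : NonUnitalStarSubalgebra ℂ A} (h : IsMasaOf C B)
    (hB : IsClosed (B : Set A)) {y : A} (hy : IsSelfAdjoint y) (hyB : y ∈ B)
    (hc : ∀ x ∈ C, x * y = y * x) : y ∈ C := by
  set S : Set A := insert y (C : Set A) with hS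
  have hSs : ∀ x ∈ S, star x ∈ S := by
    rintro x (rfl | hx)
    · rw [hy.star_eq]; exact Set.mem_insert _ _
    · exact Set.mem_insert_of_mem _ (star_mem hx)
  have hSc : ∀ x ∈ S, ∀ z ∈ S, x * z = z * x := by
    rintro x (rfl | hx) z (rfl | hz)
    · rfl
    · exact (hc z hz).symm
    · exact hc x hx
    · exact h.2.1.2 x hx z hz
  set Z := NonUnitalStarSubalgebra.centralizer ℂ
    (NonUnitalStarSubalgebra.centralizer ℂ S : Set A) with hZ
  have hSS : ∀ x ∈ S, x ∈ NonUnitalStarSubalgebra.centralizer ℂ S := fun x hx =>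
    (NonUnitalStarSubalgebra.mem_centralizer_iff ℂ).2 fun g hg =>
      ⟨hSc g hg x hx, hSc _ (hSs g hg) x hx⟩
  have hZS : ∀ x ∈ Z, x ∈ NonUnitalStarSubalgebra.centralizer ℂ S := fun x hx =>
    (NonUnitalStarSubalgebra.mem_centralizer_iff ℂ).2 fun g hg =>
      (NonUnitalStarSubalgebra.mem_centralizer_iff ℂ).1 hx g (hSS g hg)
  have hSZ : ∀ x ∈ S, x ∈ Z := fun x hx =>
    (NonUnitalStarSubalgebra.mem_centralizer_iff ℂ).2 fun g hg => by
      have h1 := (NonUnitalStarSubalgebra.mem_centralizer_iff ℂ).1 hg x hx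
      have h2 := (NonUnitalStarSubalgebra.mem_centralizer_iff ℂ).1
        (star_mem hg) x hx
      exact ⟨h1.1.symm, h2.1.symm⟩
  have hD := h.2.2 (B ⊓ Z) inf_le_left ⟨?_, fun x hx z hz => ?_⟩ fun x hx =>
    ⟨h.1 hx, hSZ x (Set.mem_insert_of_mem _ hx)⟩
  · rw [← hD]
    exact ⟨hyB, hSZ y (Set.mem_insert _ _)⟩
  · have : IsClosed (Z : Set A) := by
      rw [hZ, NonUnitalStarSubalgebra.coe_centralizer]
      exact Set.isClosed_centralizer _
    exact hB.inter this
  · exact ((NonUnitalStarSubalgebra.mem_centralizer_iff ℂ).1 hz.2 x (hZS x hx.2)).1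

theorem IsMasaOf.mem_of_commute {C B : NonUnitalStarSubalgebra ℂ A} (h : IsMasaOf C B)
    (hB : IsClosed (B : Set A)) {y : A} (hyB : y ∈ B) (hc : ∀ x ∈ C, x * y = y * x) : y ∈ C := by
  have hc' : ∀ x ∈ C, x * star y = star y * x := fun x hx => by
    have := congrArg star (hc _ (star_mem hx))
    simpa using this.symm
  have h1 : y + star y ∈ C := h.mem_of_isSelfAdjoint hB (IsSelfAdjoint.add_star_self y)
    (add_mem hyB (star_mem hyB)) fun x hx => by rw [mul_add, add_mul, hc x hx, hc' x hx]
  have h2 : Complex.I • (y - star y) ∈ C := h.mem_of_isSelfAdjoint hB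
    (by
      rw [IsSelfAdjoint, star_smul, star_sub, star_star, ← neg_sub y, smul_neg]
      simp)
    (SMulMemClass.smul_mem _ (sub_mem hyB (star_mem hyB))) fun x hx => by
      rw [mul_smul_comm, smul_mul_assoc, mul_sub, sub_mul, hc x hx, hc' x hx]
  have e : y = (1 / 2 : ℂ) • (y + star y) + (-(Complex.I / 2)) • (Complex.I • (y - star y)) := by
    have : -(Complex.I / 2) * Complex.I = 1 / 2 := by
      linear_combination (-1 / 2 : ℂ) * Complex.I_mul_I
    rw [smul_smul, this, ← smul_add]
    have : y + star y + (y - star y) = (2 : ℂ) • y := by rw [two_smul]; abel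
    rw [this, smul_smul]; norm_num
  rw [e]
  exact add_mem (SMulMemClass.smul_mem _ h1) (SMulMemClass.smul_mem _ h2)

theorem isClosed_of_finiteDimensional (B : NonUnitalStarSubalgebra ℂ A) [FiniteDimensional ℂ B] :
    IsClosed (B : Set A) :=
  Submodule.closed_of_finiteDimensional B.toSubmodule

theorem one_mem_of_isMasaOf_top {C : NonUnitalStarSubalgebra ℂ A} (h : IsMasaOf C ⊤) :
    (1 : A) ∈ C :=
  h.mem_of_commute isClosed_univ trivial fun x _ => by rw [mul_one, one_mul]

/-- A finite-dimensional subalgebra with an element close to `1` contains `1`. -/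
theorem one_mem_of_norm_sub_lt {B : NonUnitalStarSubalgebra ℂ A} [FiniteDimensional ℂ B] {x : A}
    (hx : x ∈ B) (h : ‖x - 1‖ < 1) : (1 : A) ∈ B := by
  have hu := isUnit_of_norm_sub_one_lt h
  let L : B →ₗ[ℂ] B := LinearMap.mulLeft ℂ (⟨x, hx⟩ : B)
  have hL : Function.Injective L := fun a b hab => by
    have : x * (a : A) = x * b := congrArg Subtype.val hab
    exact Subtype.ext (hu.mul_left_cancel this)
  obtain ⟨e, he⟩ := LinearMap.surjective_of_injective hL ⟨x, hx⟩
  have h1 : x * (e : A) = x * 1 := by rw [mul_one]; exact congrArg Subtype.val he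
  rw [← hu.mul_left_cancel h1]
  exact e.2

end Masa

/-! ### Self-adjoint unitaries of finite-dimensional algebras -/

section Symmetries

variable {A : Type*} [CStarAlgebra A]

/-- For `e = vw - 1` one has `e² = -2e` with `e` self-adjoint, so the C⋆-identity forces `‖e‖ = 2`
unless `e = 0`. -/
theorem norm_sub_of_commuting_symmetries {v w : A} (hv : star v = v) (hw : star w = w)
    (hvv : v * v = 1) (hww : w * w = 1) (hvw : v * w = w * v) (hne : v ≠ w) : ‖v - w‖ = 2 := by
  set e := v * w - 1 with he
  have hes : star e = e := by rw [he, star_sub, star_mul, hv, hw, star_one, hvw]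
  have h1 : (v * w) * (v * w) = 1 := by
    calc (v * w) * (v * w) = v * (w * v) * w := by noncomm_ring
      _ = (v * v) * (w * w) := by rw [← hvw]; noncomm_ring
      _ = 1 := by rw [hvv, hww, mul_one]
  have hee : e * e = (-2 : ℝ) • e := by
    have : e * e = (v * w) * (v * w) - (v * w + v * w) + 1 := by rw [he]; noncomm_ring
    rw [this, h1, he, neg_smul, two_smul]; abel
  have he0 : e ≠ 0 := by
    intro h0
    apply hne
    have : v * w = 1 := by rw [← sub_eq_zero]; exact h0
    calc v = v * (w * w) := by rw [hww, mul_one]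
      _ = w := by rw [← mul_assoc, this, one_mul]
  have hn : ‖e‖ * ‖e‖ = 2 * ‖e‖ := by
    have := CStarRing.norm_star_mul_self (x := e)
    rw [hes, hee, norm_smul] at this
    rw [← this]; norm_num
  have hne' := norm_ne_zero_iff.2 he0
  have h2 : ‖e‖ = 2 := mul_right_cancel₀ hne' hn
  have hwu : w ∈ unitary A := by rw [Unitary.mem_iff, hw]; exact ⟨hww, hww⟩
  have : e = (v - w) * w := by rw [he, sub_mul, hww]
  rw [← h2, this, CStarRing.norm_mul_mem_unitary _ hwu]

/-- Distinct members are at distance `2` inside a compact ball. -/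
theorem finite_symmetries {B : NonUnitalStarSubalgebra ℂ A} [FiniteDimensional ℂ B]
    {S : Set A} (hSB : S ⊆ B) (hs : ∀ v ∈ S, star v = v ∧ v * v = 1)
    (hc : ∀ v ∈ S, ∀ w ∈ S, v * w = w * v) : S.Finite := by
  by_contra hinf
  let V : Submodule ℂ A := B.toSubmodule
  have : FiniteDimensional ℂ V := ‹FiniteDimensional ℂ B›
  have : ProperSpace V := FiniteDimensional.proper ℂ V
  have hK : IsCompact ((Subtype.val : V → A) '' Metric.closedBall 0 1) :=
    (isCompact_closedBall _ _).image continuous_subtype_val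
  have hSK : S ⊆ (Subtype.val : V → A) '' Metric.closedBall 0 1 := fun v hv => by
    refine ⟨⟨v, hSB hv⟩, ?_, rfl⟩
    rw [mem_closedBall_zero_iff]
    refine norm_le_one_of_mem_unitary (u := v) ?_
    rw [Unitary.mem_iff, (hs v hv).1]
    exact ⟨(hs v hv).2, (hs v hv).2⟩
  obtain ⟨x, -, hx⟩ := Set.Infinite.exists_accPt_of_subset_isCompact hinf hK hSK
  rw [accPt_iff_nhds] at hx
  obtain ⟨y, ⟨hy, hyS⟩, hyx⟩ := hx _ (Metric.ball_mem_nhds x one_pos)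
  obtain ⟨z, ⟨hz, hzS⟩, hzx⟩ := hx _ (Metric.ball_mem_nhds x
    (lt_min one_pos (dist_pos.2 hyx)))
  rw [Metric.mem_ball] at hy hz
  have hyz : y ≠ z := by
    rintro rfl
    exact lt_irrefl _ (hz.trans_le (min_le_right _ _))
  have h1 := norm_sub_of_commuting_symmetries (hs y hyS).1 (hs z hzS).1 (hs y hyS).2
    (hs z hzS).2 (hc y hyS z hzS) hyz
  rw [← dist_eq_norm] at h1
  have h2 := dist_triangle_right y z x
  have h3 := hz.trans_le (min_le_left _ _)
  linarith

/-- A projection `p` is a combination of `1` and the symmetry `1 - 2p`, and a self-adjoint element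
is a combination of its spectral projections. -/
theorem span_symmetries_eq_top (B : Type*) [CStarAlgebra B] [FiniteDimensional ℂ B] :
    Submodule.span ℂ {v : B | star v = v ∧ v * v = 1} = ⊤ := by
  set M := Submodule.span ℂ {v : B | star v = v ∧ v * v = 1} with hM
  have h1 : (1 : B) ∈ M := Submodule.subset_span ⟨star_one B, one_mul 1⟩
  have hP : ∀ (h : B) (T : Set ℝ), spectralProj h T ∈ M := fun h T => by
    have h2 : (1 : B) - (2 : ℂ) • spectralProj h T ∈ M := by
      refine Submodule.subset_span ⟨?_, ?_⟩
      · rw [star_sub, star_one, star_smul, (isSelfAdjoint_spectralProj h T).star_eq]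
        simp
      · have := spectralProj_mul_spectralProj h T T
        rw [Set.inter_self] at this
        have e : (1 - (2 : ℂ) • spectralProj h T) * (1 - (2 : ℂ) • spectralProj h T) =
            1 + (4 : ℂ) • (spectralProj h T * spectralProj h T - spectralProj h T) := by
          simp only [sub_mul, mul_sub, smul_mul_assoc, mul_smul_comm, one_mul, mul_one]
          module
        rw [e, this, sub_self, smul_zero, add_zero]
    have : spectralProj h T = (1 / 2 : ℂ) • ((1 : B) - (1 - (2 : ℂ) • spectralProj h T)) := by
      rw [sub_sub_cancel, smul_smul]; norm_num
    rw [this]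
    exact M.smul_mem _ (M.sub_mem h1 h2)
  have hsa : ∀ h : B, IsSelfAdjoint h → h ∈ M := fun h hh => by
    set σ := (finite_spectrum_real h).toFinset with hσ
    have : h = ∑ c ∈ σ, (c : ℂ) • spectralProj h {c} := by
      have e1 : h = cfc (∑ c ∈ σ, fun x : ℝ => c * ({c} : Set ℝ).indicator (1 : ℝ → ℝ) x) h := by
        nth_rewrite 1 [← cfc_id' ℝ h]
        refine cfc_congr fun x hx => ?_
        rw [Finset.sum_apply]
        have hxσ : x ∈ σ := by simpa [hσ] using hx
        rw [Finset.sum_eq_single x]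
        · simp
        · intro c _ hc
          simp [Set.indicator, hc.symm]
        · exact fun h' => absurd hxσ h'
      nth_rewrite 1 [e1]
      rw [cfc_sum (f := fun (c : ℝ) (x : ℝ) => c * ({c} : Set ℝ).indicator (1 : ℝ → ℝ) x)
        (hf := fun c _ => continuousOn_spectrum_real h _)]
      refine Finset.sum_congr rfl fun c _ => ?_
      rw [cfc_const_mul _ _ h (continuousOn_spectrum_real h _)]
      rfl
    rw [this]
    exact M.sum_mem fun c _ => M.smul_mem _ (hP h _)
  rw [eq_top_iff]
  rintro x -
  rw [← realPart_add_I_smul_imaginaryPart x]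
  exact M.add_mem (hsa _ (realPart x).2) (M.smul_mem _ (hsa _ (imaginaryPart x).2))

theorem mem_span_symmetries {B : NonUnitalStarSubalgebra ℂ A} [FiniteDimensional ℂ B]
    (h1 : (1 : A) ∈ B) {x : A} (hx : x ∈ B) :
    x ∈ Submodule.span ℂ {v : A | v ∈ B ∧ star v = v ∧ v * v = 1} := by
  let B' : StarSubalgebra ℂ A := B.toStarSubalgebra h1
  have hcl : IsClosed (B' : Set A) := isClosed_of_finiteDimensional B
  let _ : CStarAlgebra B' := StarSubalgebra.cstarAlgebra B'
  have : FiniteDimensional ℂ B' := ‹FiniteDimensional ℂ B›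
  have hmem : (⟨x, hx⟩ : B') ∈ Submodule.span ℂ {v : B' | star v = v ∧ v * v = 1} := by
    rw [span_symmetries_eq_top]; trivial
  have := Submodule.mem_map_of_mem (f := B'.subtype.toLinearMap) hmem
  rw [Submodule.map_span] at this
  refine Submodule.span_mono ?_ this
  rintro _ ⟨v, ⟨hv1, hv2⟩, rfl⟩
  exact ⟨v.2, congrArg Subtype.val hv1, congrArg Subtype.val hv2⟩

end Symmetries

/-! ### Exhaustions from generating sets -/

/-- The subgroup generated by an increasing union of finite groups is exhausted by them. -/
theorem exists_groupExhaustion {G : Type*} [CommGroup G] {e : ℕ → Set G} {n : ℕ → ℕ}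
    (hn : StrictMono n) {T : ℕ → Subgroup G} (hT : ∀ j l, n j ≤ l → e l ⊆ T j)
    (hfin : ∀ j, Finite (Subgroup.closure {g | ∃ l, n 0 ≤ l ∧ l < n j ∧ g ∈ e l})) :
    ∃ E : GroupExhaustion (Subgroup.closure {g | ∃ l, n 0 ≤ l ∧ g ∈ e l}),
      ∀ j, ∀ g ∈ E.T j, (g : G) ∈ T j := by
  set H : ℕ → Subgroup G := fun j => Subgroup.closure {g | ∃ l, n 0 ≤ l ∧ l < n j ∧ g ∈ e l}
  set K := Subgroup.closure {g | ∃ l, n 0 ≤ l ∧ g ∈ e l} with hK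
  have hHmono : Monotone H := fun i j hij => Subgroup.closure_mono
    fun g ⟨l, h1, h2, h3⟩ => ⟨l, h1, h2.trans_le (hn.monotone hij), h3⟩
  have hHK : ∀ j, H j ≤ K := fun j => Subgroup.closure_mono fun g ⟨l, h1, _, h3⟩ => ⟨l, h1, h3⟩
  refine ⟨⟨fun j => (H j).subgroupOf K, fun j => {g | (g : G) ∈ T j}, fun j => ?_,
    fun i j hij g hg => hHmono hij hg, fun g => ?_, fun g => ?_, fun j g hg => ?_⟩,
    fun j g hg => hg⟩
  · have := hfin j
    exact Finite.of_injective (fun g : (H j).subgroupOf K => (⟨g.1.1, g.2⟩ : H j))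
      fun a b hab => Subtype.ext (Subtype.ext (congrArg (fun z : H j => (z : G)) hab))
  · have : ∀ x ∈ K, ∃ j, x ∈ H j := by
      intro x hx
      induction hx using Subgroup.closure_induction with
      | mem x hx =>
        obtain ⟨l, h1, h2⟩ := hx
        exact ⟨l + 1, Subgroup.subset_closure ⟨l, h1, (Nat.lt_succ_self l).trans_le (hn.id_le _),
          h2⟩⟩
      | one => exact ⟨0, one_mem _⟩
      | mul x y _ _ hx hy =>
        obtain ⟨i, hi⟩ := hx
        obtain ⟨j, hj⟩ := hy
        exact ⟨max i j, mul_mem (hHmono (le_max_left _ _) hi) (hHmono (le_max_right _ _) hj)⟩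
      | inv x _ hx =>
        obtain ⟨i, hi⟩ := hx
        exact ⟨i, inv_mem hi⟩
    exact this g g.2
  · have : K ≤ T 0 := (Subgroup.closure_le _).2 fun g ⟨l, h1, h2⟩ => hT 0 l h1 h2
    exact this g.2
  · have h1 : H (j + 1) ≤ H j ⊔ (K ⊓ T j) := by
      refine (Subgroup.closure_le _).2 fun g ⟨l, h1, h2, h3⟩ => ?_
      rcases lt_or_ge l (n j) with hl | hl
      · exact Subgroup.mem_sup_left (Subgroup.subset_closure ⟨l, h1, hl, h3⟩)
      · exact Subgroup.mem_sup_right ⟨Subgroup.subset_closure ⟨l, h1, h3⟩, hT j l hl h3⟩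
    obtain ⟨y, hy, z, hz, hyz⟩ := Subgroup.mem_sup.1 (h1 hg)
    exact ⟨⟨y, hHK j hy⟩, hy, ⟨z, hz.1⟩, hz.2, Subtype.ext hyz.symm⟩

/-! ### Inner perturbation on the relative masas -/

section RelativeMasa

variable {A : Type*} [CStarAlgebra A]

/-- The algebra `C ∩ F_{l+1} ∩ F_l'`. -/
noncomputable def relativeMasa (C : NonUnitalStarSubalgebra ℂ A) (F : ℕ → NonUnitalStarSubalgebra ℂ A) (l : ℕ) :
    NonUnitalStarSubalgebra ℂ A :=
  C ⊓ (F (l + 1) ⊓ NonUnitalStarSubalgebra.centralizer ℂ (F l : Set A))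

/-- The group of self-adjoint unitaries of a commutative subalgebra containing the unit. -/
noncomputable def symmetryGroup (C : NonUnitalStarSubalgebra ℂ A) (h1 : (1 : A) ∈ C)
    (hC : ∀ x ∈ C, ∀ y ∈ C, x * y = y * x) : Subgroup (unitary A) where
  carrier := {u | (u : A) ∈ C ∧ star (u : A) = u}
  one_mem' := ⟨h1, star_one A⟩
  mul_mem' := fun {a b} ha hb => ⟨mul_mem ha.1 hb.1, by
    change star ((a : A) * b) = a * b
    rw [star_mul, ha.2, hb.2, hC _ hb.1 _ ha.1]⟩
  inv_mem' := fun {a} ha => by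
    change star (a : A) ∈ C ∧ star (star (a : A)) = star (a : A)
    rw [ha.2]
    exact ha

theorem eventually_one_mem {F : ℕ → NonUnitalStarSubalgebra ℂ A} (hF : Monotone F)
    [∀ n, FiniteDimensional ℂ (F n)] (hd : Dense (⋃ n, (F n : Set A))) :
    ∃ N, ∀ n ≥ N, (1 : A) ∈ F n := by
  obtain ⟨x, hx, hx1⟩ := Metric.dense_iff.1 hd 1 1 one_pos
  obtain ⟨N, hN⟩ := Set.mem_iUnion.1 hx1
  exact ⟨N, fun n hn => hF hn (one_mem_of_norm_sub_lt hN (by rwa [← dist_eq_norm]))⟩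

/-- The symmetries of the relative masas generate a commutative group exhausted by finite subgroups,
each of its stages lying in some `F n`. Innerness on the symmetries extends to the masas, which they
span. -/
theorem OneParameterAutomorphismGroup.exists_unitary_conj_hasGen_relativeMasa
    (α : OneParameterAutomorphismGroup A) (hA : IsSimpleCStarAlgebra A)
    {C : NonUnitalStarSubalgebra ℂ A} (hC : IsMasaOf C ⊤) (hCD : (C : Set A) ⊆ α.generatorDomain)
    {F : ℕ → NonUnitalStarSubalgebra ℂ A} (hF : Monotone F) [∀ n, FiniteDimensional ℂ (F n)]
    (hd : Dense (⋃ n, (F n : Set A))) :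
    ∃ W ∈ unitary A, ∃ k : A, star k = -k ∧ ∃ m, (1 : A) ∈ F m ∧
      ∀ l ≥ m, ∀ c ∈ relativeMasa C F l,
        α.HasGen (W * c * star W) (k * (W * c * star W) - W * c * star W * k) := by
  have hcomm := hC.2.1.2
  have h1C := one_mem_of_isMasaOf_top hC
  obtain ⟨N, hN⟩ := eventually_one_mem hF hd
  set σ : ℕ → ℝ := fun j => 1 / 200 * (1 / 2) ^ j with hσ
  have hσ0 : ∀ j, 0 < σ j := fun j => by positivity
  -- Passing to a sparse subsequence of levels makes the displacements summable: beyond level `n j`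
  -- they are at most `2⁻ʲ / 200`, without any rate for the original tower.
  obtain ⟨n, hn, hnP⟩ := Filter.extraction_forall_of_eventually' (P := fun j k => N ≤ k ∧
      ∀ v ∈ tailSymmetries C (F k), ∀ t ∈ Set.Icc (0 : ℝ) 1, ‖α.toFun t v - v‖ ≤ σ j)
    fun j => by
      obtain ⟨m, hm⟩ := α.exists_forall_norm_sub_le hA hC.2.1.1 hcomm hCD hF hd (hσ0 j)
      exact ⟨max N m, fun k hk => ⟨(le_max_left _ _).trans hk, fun v hv =>
        hm v (tailSymmetries_anti (hF ((le_max_right _ _).trans hk)) hv)⟩⟩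
  let G := symmetryGroup C h1C hcomm
  let _ : CommGroup G := { (inferInstance : Group G) with
    mul_comm := fun a b => Subtype.ext (Subtype.ext (hcomm _ a.2.1 _ b.2.1)) }
  have hGG : ∀ g : G, ((g : unitary A) : A) * g = 1 := fun g => by
    have := (Unitary.mem_iff.1 (g : unitary A).2).1
    rwa [g.2.2] at this
  let e : ℕ → Set G := fun l => {g | ((g : unitary A) : A) ∈ relativeMasa C F l}
  let T : ℕ → Subgroup G := fun j =>
    { carrier := {g | ∀ x ∈ F (n j), x * ((g : unitary A) : A) = ((g : unitary A) : A) * x}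
      one_mem' := fun x _ => by
        change x * 1 = 1 * x
        rw [mul_one, one_mul]
      mul_mem' := fun {a b} ha hb x hx => by
        change x * (((a : unitary A) : A) * ((b : unitary A) : A)) =
          ((a : unitary A) : A) * ((b : unitary A) : A) * x
        rw [← mul_assoc, ha x hx, mul_assoc, hb x hx, mul_assoc]
      inv_mem' := fun {a} ha x hx => by
        change x * star ((a : unitary A) : A) = star ((a : unitary A) : A) * x
        rw [a.2.2]
        exact ha x hx }
  have hT : ∀ j l, n j ≤ l → e l ⊆ T j := fun j l hl g hg x hx =>
    ((NonUnitalStarSubalgebra.mem_centralizer_iff ℂ).1 hg.2.2 x (hF hl hx)).1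
  have hfin : ∀ j, Finite (Subgroup.closure {g : G | ∃ l, n 0 ≤ l ∧ l < n j ∧ g ∈ e l}) := by
    intro j
    have hmem : ∀ g ∈ Subgroup.closure {g : G | ∃ l, n 0 ≤ l ∧ l < n j ∧ g ∈ e l},
        ((g : unitary A) : A) ∈ F (n j) := by
      intro g hg
      induction hg using Subgroup.closure_induction with
      | mem x hx =>
        obtain ⟨l, -, hl, h⟩ := hx
        exact hF (Nat.succ_le_of_lt hl) h.2.1
      | one => exact hN _ (hnP j).1
      | mul x y _ _ hx hy => exact mul_mem hx hy
      | inv x _ hx => exact star_mem hx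
    have hS := finite_symmetries (B := F (n j))
      (S := {v | v ∈ C ∧ v ∈ F (n j) ∧ star v = v ∧ v * v = 1}) (fun v hv => hv.2.1)
      (fun v hv => hv.2.2) (fun v hv w hw => hcomm v hv.1 w hw.1)
    have := hS.to_subtype
    exact Finite.of_injective (fun g : Subgroup.closure {g : G | ∃ l, n 0 ≤ l ∧ l < n j ∧ g ∈ e l} =>
      (⟨((g : G) : unitary A), (g : G).2.1, hmem g g.2, (g : G).2.2, hGG g⟩ :
        {v | v ∈ C ∧ v ∈ F (n j) ∧ star v = v ∧ v * v = 1}))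
      fun a b hab => Subtype.ext (Subtype.ext (Subtype.ext (Subtype.mk.inj hab)))
  obtain ⟨E, hE⟩ := exists_groupExhaustion hn hT hfin
  obtain ⟨W, hW, k, hk, hgen⟩ := α.exists_unitary_conj_hasGen (E := E) (σ := σ)
    (G.subtype.comp (Subgroup.subtype _))
    ((summable_geometric_of_lt_one (by norm_num) (by norm_num)).mul_left _)
    (by simp [hσ]) fun j g hg t ht =>
      (hnP j).2 _ ⟨(g : G).2.1, (g : G).2.2, hGG g, hE j g hg⟩ t ht
  refine ⟨W, hW, k, hk, n 0, hN _ (hnP 0).1, fun l hl c hc => ?_⟩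
  have hl1 : (1 : A) ∈ relativeMasa C F l := ⟨h1C, hN _ ((hnP 0).1.trans (hl.trans l.le_succ)),
    (NonUnitalStarSubalgebra.mem_centralizer_iff ℂ).2 fun x _ => by simp⟩
  have : FiniteDimensional ℂ (relativeMasa C F l) :=
    Submodule.finiteDimensional_of_le (S₁ := (relativeMasa C F l).toSubmodule) (S₂ := (F (l + 1)).toSubmodule) 
      fun x (hx : x ∈ relativeMasa C F l) => hx.2.1
  have hspan := mem_span_symmetries hl1 hc
  clear hc
  induction hspan using Submodule.span_induction with
  | mem v hv =>
    have hvu : v ∈ unitary A := by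
      rw [Unitary.mem_iff, hv.2.1]
      exact ⟨hv.2.2, hv.2.2⟩
    exact hgen ⟨⟨⟨v, hvu⟩, hv.1.1, hv.2.1⟩, Subgroup.subset_closure ⟨l, hl, hv.1⟩⟩
  | zero => simpa using α.hasGen_zero
  | add x y _ _ hx hy =>
    convert hx.add hy using 1
    · noncomm_ring
    · noncomm_ring
  | smul a x _ hx =>
    convert hx.smul a using 1
    · simp
    · simp [smul_sub]

end RelativeMasa

/-! ### Matrix units -/

section MatrixUnits

/-- The Jacobson radical is nilpotent. For `x` in it, `x⋆x` is a self-adjoint nilpotent, so the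
C⋆-identity gives `x = 0`. -/
theorem isSemisimpleRing_of_finiteDimensional (B : Type*) [CStarAlgebra B]
    [FiniteDimensional ℂ B] : IsSemisimpleRing B := by
  have : IsArtinianRing B := IsArtinianRing.of_finite ℂ B
  rw [IsArtinianRing.isSemisimpleRing_iff_jacobson, eq_bot_iff]
  intro x hx
  obtain ⟨n, hn⟩ := IsSemiprimaryRing.isNilpotent (R := B)
  have h1 : star x * x ∈ Ring.jacobson B := Ideal.mul_mem_left _ _ hx
  have h2 : (star x * x) ^ n = 0 := by
    have h : (star x * x) ^ n ∈ Ring.jacobson B ^ n := Ideal.pow_mem_pow h1 n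
    rw [hn] at h
    exact h
  have h3 : (star x * x) ^ (2 ^ n) = 0 := by
    rw [← Nat.sub_add_cancel (Nat.lt_two_pow_self (n := n)).le, pow_add, h2, mul_zero]
  have h4 := (IsSelfAdjoint.star_mul_self x).nnnorm_pow_two_pow n
  rw [h3, nnnorm_zero] at h4
  have h5 : ‖star x * x‖₊ = 0 := pow_eq_zero_iff (pow_ne_zero n two_ne_zero) |>.1 h4.symm
  exact CStarRing.star_mul_self_eq_zero_iff x |>.1 (nnnorm_eq_zero.1 h5)

/-- Matrix units of a finite-dimensional subalgebra. The blocks are the fibres of `r`, which sends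
each index to a distinguished index of its block. -/
structure IsMatrixUnits {A : Type*} [CStarAlgebra A] (F : StarSubalgebra ℂ A) {ι : Type*}
    [Fintype ι] (r : ι → ι) (e : ι → ι → A) : Prop where
  mem : ∀ i j, e i j ∈ F
  rep : ∀ i, r (r i) = r i
  eq_zero : ∀ {i j}, r i ≠ r j → e i j = 0
  mul : ∀ {i j l}, r i = r j → e i j * e j l = e i l
  mul_ne : ∀ {i j p l}, j ≠ p → e i j * e p l = 0
  sum : ∑ i, e i i = 1
  span : ∀ x ∈ F, x ∈ Submodule.span ℂ (Set.range fun p : ι × ι => e p.1 p.2)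

/-- The Wedderburn isomorphism is only algebraic, so adjoints of the matrix units are not
controlled. The coefficient formulas and the implementation argument use only multiplication and
linear span. -/
theorem exists_isMatrixUnits {A : Type*} [CStarAlgebra A] (F : StarSubalgebra ℂ A)
    [FiniteDimensional ℂ F] :
    ∃ (ι : Type) (_ : Fintype ι) (r : ι → ι) (e : ι → ι → A), IsMatrixUnits F r e := by
  have hcl : IsClosed (F : Set A) := Submodule.closed_of_finiteDimensional F.toSubalgebra.toSubmodule
  let _ : CStarAlgebra F := StarSubalgebra.cstarAlgebra F
  have := isSemisimpleRing_of_finiteDimensional F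
  obtain ⟨n, d, hd, ⟨φ⟩⟩ := IsSemisimpleRing.exists_algEquiv_pi_matrix_of_isAlgClosed ℂ F
  let E : (Σ k : Fin n, Fin (d k)) → (Σ k : Fin n, Fin (d k)) → Π k, Matrix (Fin (d k)) (Fin (d k)) ℂ := fun i j k =>
    Matrix.of fun a b => if i = ⟨k, a⟩ ∧ j = ⟨k, b⟩ then 1 else 0
  let r : (Σ k : Fin n, Fin (d k)) → (Σ k : Fin n, Fin (d k)) := fun i => ⟨i.1, 0⟩
  have hr : ∀ i j, r i = r j ↔ i.1 = j.1 := by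
    rintro ⟨k, a⟩ ⟨l, b⟩
    simp only [r]
    constructor
    · intro h
      exact congrArg Sigma.fst h
    · rintro h
      subst h
      rfl
  have hEmul : ∀ i j p l, E i j * E p l = if j = p ∧ i.1 = j.1 then E i l else 0 := by
    intro i j p l
    ext k a b
    rw [Pi.mul_apply, Matrix.mul_apply]
    by_cases h : j = p ∧ i.1 = j.1
    · obtain ⟨rfl, h2⟩ := h
      obtain ⟨i1, i2⟩ := i
      obtain ⟨j1, j2⟩ := j
      dsimp only at h2
      subst h2
      simp only [E, Matrix.of_apply, and_self, if_true]
      by_cases hk : i1 = k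
      · subst hk
        simp only [Sigma.mk.injEq, heq_eq_eq, true_and]
        rw [Finset.sum_eq_single j2]
        · by_cases h1 : i2 = a <;> by_cases h3 : l = ⟨i1, b⟩ <;> simp [h1, h3]
        · intro c _ hc
          rw [if_neg fun h => hc h.2.symm, zero_mul]
        · simp
      · simp [hk]
    · rw [if_neg h, Pi.zero_apply, Matrix.zero_apply]
      refine Finset.sum_eq_zero fun c _ => ?_
      simp only [E, Matrix.of_apply]
      by_cases h1 : i = ⟨k, a⟩ ∧ j = ⟨k, c⟩
      · have : p ≠ ⟨k, c⟩ := fun hp => h ⟨h1.2.trans hp.symm, by rw [h1.1, h1.2]⟩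
        rw [if_neg (c := p = _ ∧ _) fun hh => this hh.1, mul_zero]
      · rw [if_neg h1, zero_mul]
  have hE0 : ∀ i j : (Σ k : Fin n, Fin (d k)), i.1 ≠ j.1 → E i j = 0 := by
    intro i j h
    ext k a b
    simp only [E, Matrix.of_apply, Pi.zero_apply, Matrix.zero_apply]
    exact if_neg fun hh => h (by rw [hh.1, hh.2])
  refine ⟨(Σ k : Fin n, Fin (d k)), inferInstance, r, fun i j => (φ.symm (E i j) : F), fun i j => (φ.symm (E i j)).2,
    fun i => rfl, fun {i j} h => ?_, fun {i j l} h => ?_, fun {i j p l} h => ?_, ?_,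
    fun x hx => ?_⟩
  · rw [hE0 i j fun h' => h ((hr i j).2 h'), map_zero]; rfl
  · rw [← MulMemClass.coe_mul, ← map_mul, hEmul, if_pos ⟨rfl, (hr i j).1 h⟩]
  · rw [← MulMemClass.coe_mul, ← map_mul, hEmul, if_neg fun h' => h h'.1, map_zero]; rfl
  · have : ∑ i, E i i = 1 := by
      ext k a b
      rw [Finset.sum_apply, Matrix.sum_apply, Fintype.sum_sigma, Finset.sum_eq_single k]
      · rw [Finset.sum_eq_single a]
        · simp [E, Matrix.one_apply]
        · intro c _ hc
          simp [E, hc]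
        · simp
      · intro l _ hl
        refine Finset.sum_eq_zero fun c _ => ?_
        simp [E, hl]
      · simp
    rw [← AddSubmonoidClass.coe_finsetSum, ← map_sum, this, map_one]; rfl
  · have : φ ⟨x, hx⟩ = ∑ k, ∑ a, ∑ b, (φ ⟨x, hx⟩ k a b) • E ⟨k, a⟩ ⟨k, b⟩ := by
      ext k a b
      simp only [Finset.sum_apply, Matrix.sum_apply, Pi.smul_apply, Matrix.smul_apply]
      rw [Finset.sum_eq_single k, Finset.sum_eq_single a, Finset.sum_eq_single b]
      · simp [E]
      · intro c _ hc
        simp [E, hc]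
      · simp
      · intro c _ hc
        simp [E, hc]
      · simp
      · intro l _ hl
        refine Finset.sum_eq_zero fun c _ => Finset.sum_eq_zero fun c' _ => ?_
        simp [E, hl]
      · simp
    have h2 := congrArg (fun z => (φ.symm z : A)) this
    simp only [AlgEquiv.symm_apply_apply, map_sum, map_smul, AddSubmonoidClass.coe_finsetSum] at h2
    rw [h2]
    refine Submodule.sum_mem _ fun k _ => Submodule.sum_mem _ fun a _ =>
      Submodule.sum_mem _ fun b _ => ?_
    exact Submodule.smul_mem _ _ (Submodule.subset_span ⟨(⟨k, a⟩, ⟨k, b⟩), rfl⟩)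

namespace IsMatrixUnits

variable {A : Type*} [CStarAlgebra A] {F : StarSubalgebra ℂ A} {ι : Type*} [Fintype ι]
  {r : ι → ι} {e : ι → ι → A}

theorem mul' (h : IsMatrixUnits F r e) {i j l : ι} (hj : r j = r l) :
    e i j * e j l = e i l := by
  by_cases hi : r i = r j
  · exact h.mul hi
  · rw [h.eq_zero hi, h.eq_zero fun h' => hi (h'.trans hj.symm), zero_mul]

theorem commute_of_forall (h : IsMatrixUnits F r e) {y : A}
    (hy : ∀ i j, e i j * y = y * e i j) {x : A} (hx : x ∈ F) : x * y = y * x := by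
  have := h.span x hx
  clear hx
  induction this using Submodule.span_induction with
  | mem x hx => obtain ⟨p, rfl⟩ := hx; exact hy _ _
  | zero => simp
  | add a b _ _ ha hb => rw [add_mul, mul_add, ha, hb]
  | smul c a _ ha => rw [smul_mul_assoc, mul_smul_comm, ha]

end IsMatrixUnits

/-- The coefficient of `e i j` in an element that commutes with the centre of `F`. -/
noncomputable def matrixCoeff {A : Type*} [CStarAlgebra A] {ι : Type*} [Fintype ι]
    (e : ι → ι → A) (i j : ι) : A →L[ℂ] A :=
  ∑ p, (ContinuousLinearMap.mul ℂ A (e p i)).comp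
    ((ContinuousLinearMap.mul ℂ A).flip (e j p))

theorem matrixCoeff_apply {A : Type*} [CStarAlgebra A] {ι : Type*} [Fintype ι]
    (e : ι → ι → A) (i j : ι) (x : A) : matrixCoeff e i j x = ∑ p, e p i * (x * e j p) := by
  simp [matrixCoeff]

namespace IsMatrixUnits

variable {A : Type*} [CStarAlgebra A] {F : StarSubalgebra ℂ A} {ι : Type*} [Fintype ι]
  {r : ι → ι} {e : ι → ι → A}

theorem mul_matrixCoeff (h : IsMatrixUnits F r e) (i j : ι) (x : A) {f : A} (hf : f ∈ F) :
    f * matrixCoeff e i j x = matrixCoeff e i j x * f := by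
  refine h.commute_of_forall (fun a b => ?_) hf
  rw [matrixCoeff_apply, Finset.mul_sum, Finset.sum_mul, Finset.sum_eq_single b,
    Finset.sum_eq_single a]
  · by_cases hab : r a = r b
    · rw [← mul_assoc, h.mul hab, mul_assoc, mul_assoc, h.mul' hab]
    · rw [h.eq_zero hab, zero_mul, mul_zero]
  · intro p _ hp
    rw [mul_assoc, mul_assoc, h.mul_ne hp, mul_zero, mul_zero]
  · simp
  · intro p _ hp
    rw [← mul_assoc, h.mul_ne hp.symm, zero_mul]
  · simp

theorem matrixCoeff_mul (h : IsMatrixUnits F r e) (i j : ι) (x : A) {c : A}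
    (hc : ∀ f ∈ F, f * c = c * f) : matrixCoeff e i j (x * c) = matrixCoeff e i j x * c := by
  simp only [matrixCoeff_apply, Finset.sum_mul, mul_assoc, hc _ (h.mem _ _)]

/-- An element commuting with the centre of `F` is a combination of the matrix units with
coefficients in the commutant of `F`. -/
theorem sum_mul_matrixCoeff (h : IsMatrixUnits F r e) {x : A}
    (hx : ∀ z ∈ F, (∀ f ∈ F, f * z = z * f) → z * x = x * z) :
    ∑ p : ι × ι, e p.1 p.2 * matrixCoeff e p.1 p.2 x = x := by
  classical
  -- `z i` is the central projection of the block of `i`. Commuting with all of these kills the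
  -- corners of `x` between different blocks.
  let z : ι → A := fun i => ∑ j, if r j = r i then e j j else 0
  have hz : ∀ i a b, z i * e a b = if r a = r i then e a b else 0 := fun i a b => by
    rw [Finset.sum_mul, Finset.sum_eq_single a]
    · by_cases hi : r a = r i
      · rw [if_pos hi, if_pos hi, h.mul rfl]
      · rw [if_neg hi, if_neg hi, zero_mul]
    · intro j _ hj
      split_ifs
      · exact h.mul_ne hj
      · exact zero_mul _
    · simp
  have hz' : ∀ i a b, e a b * z i = if r b = r i then e a b else 0 := fun i a b => by
    rw [Finset.mul_sum, Finset.sum_eq_single b]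
    · by_cases hi : r b = r i
      · rw [if_pos hi, if_pos hi, h.mul' rfl]
      · rw [if_neg hi, if_neg hi, mul_zero]
    · intro j _ hj
      split_ifs
      · exact h.mul_ne hj.symm
      · exact mul_zero _
    · simp
  have hzx : ∀ i, z i * x = x * z i := fun i => by
    refine hx _ (sum_mem fun j _ => ?_) fun f hf => h.commute_of_forall (fun a b => ?_) hf
    · split_ifs
      · exact h.mem _ _
      · exact zero_mem _
    · rw [hz, hz']
      by_cases hab : r a = r b
      · rw [hab]
      · rw [h.eq_zero hab, ite_self, ite_self]
  have h0 : ∀ i j, r i ≠ r j → e i i * x * e j j = 0 := fun i j hij => by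
    have h1 := hz' i i i
    rw [if_pos rfl] at h1
    have h2 := hz i j j
    rw [if_neg hij.symm] at h2
    rw [← h1, mul_assoc (e i i), hzx, mul_assoc, mul_assoc, h2, mul_zero, mul_zero]
  have h1 : ∀ i j, e i j * matrixCoeff e i j x = e i i * x * e j j := fun i j => by
    rw [matrixCoeff_apply, Finset.mul_sum, Finset.sum_eq_single j]
    · by_cases hij : r i = r j
      · rw [← mul_assoc, h.mul hij, mul_assoc]
      · rw [h0 i j hij, h.eq_zero hij, zero_mul]
    · intro p _ hp
      rw [← mul_assoc, h.mul_ne hp.symm, zero_mul]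
    · simp
  rw [Fintype.sum_prod_type]
  simp only [h1]
  simp only [← Finset.mul_sum, ← Finset.sum_mul, h.sum, one_mul, mul_one]

end IsMatrixUnits

end MatrixUnits

/-! ### Towers of relative masas and averages over their symmetries -/

section MasaTower

variable {A : Type*} [CStarAlgebra A]

/-- The graph of a closed densely defined `*`-derivation. -/
structure IsClosedStarDerivation (R : A → A → Prop) : Prop where
  zero : R 0 0
  add : ∀ {x x' y y'}, R x x' → R y y' → R (x + y) (x' + y')
  smul : ∀ (c : ℂ) {x x'}, R x x' → R (c • x) (c • x')
  mul : ∀ {x x' y y'}, R x x' → R y y' → R (x * y) (x' * y + x * y')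
  star : ∀ {x x'}, R x x' → R (star x) (star x')
  unique : ∀ {x y z}, R x y → R x z → y = z
  closed : ∀ {u v : ℕ → A} {x y}, (∀ n, R (u n) (v n)) → Tendsto u atTop (𝓝 x) →
    Tendsto v atTop (𝓝 y) → R x y
  dense : Dense {x | ∃ y, R x y}

namespace IsClosedStarDerivation

variable {R : A → A → Prop}

theorem sum (hR : IsClosedStarDerivation R) {ι : Type*} (s : Finset ι) {f g : ι → A}
    (h : ∀ i ∈ s, R (f i) (g i)) : R (∑ i ∈ s, f i) (∑ i ∈ s, g i) := by
  classical
  induction s using Finset.induction_on with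
  | empty => simpa using hR.zero
  | insert a s ha ih =>
    rw [Finset.sum_insert ha, Finset.sum_insert ha]
    exact hR.add (h a (Finset.mem_insert_self _ _))
      (ih fun i hi => h i (Finset.mem_insert_of_mem hi))

theorem mul_left (hR : IsClosedStarDerivation R) {c x y : A} (hc : R c 0) (hx : R x y) :
    R (c * x) (c * y) := by
  simpa using hR.mul hc hx

theorem mul_right (hR : IsClosedStarDerivation R) {c x y : A} (hc : R c 0) (hx : R x y) :
    R (x * c) (y * c) := by
  simpa using hR.mul hx hc

end IsClosedStarDerivation

/-- Finite-dimensional algebras `F n` with dense union and masas `D n` of `F (n + 1) ∩ (F n)'`. -/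
structure IsMasaTower (F D : ℕ → StarSubalgebra ℂ A) : Prop where
  mono : Monotone F
  finiteDimensional : ∀ n, FiniteDimensional ℂ (F n)
  dense : Dense (⋃ n, (F n : Set A))
  le : ∀ l, D l ≤ F (l + 1)
  comm : ∀ l, ∀ x ∈ F l, ∀ c ∈ D l, x * c = c * x
  comm_self : ∀ l, ∀ c ∈ D l, ∀ d ∈ D l, c * d = d * c
  mem_of_comm : ∀ l, ∀ y ∈ F (l + 1), (∀ x ∈ F l, x * y = y * x) →
    (∀ c ∈ D l, c * y = y * c) → y ∈ D l

/-- Averaging over the symmetries of a commutative finite-dimensional algebra. -/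
theorem exists_symmetry_average (D : StarSubalgebra ℂ A) [FiniteDimensional ℂ D]
    (hD : ∀ c ∈ D, ∀ d ∈ D, c * d = d * c) :
    ∃ (P : A →ₗ[ℂ] A) (S : Finset A) (a : ℂ), (∀ v ∈ S, v ∈ D) ∧
      (∀ x, P x = a • ∑ v ∈ S, v * x * v) ∧ (∀ x, ‖P x‖ ≤ ‖x‖) ∧
      (∀ x, ∀ c ∈ D, c * P x = P x * c) ∧ (∀ x, (∀ c ∈ D, c * x = x * c) → P x = x) := by
  have hfin : {v : A | v ∈ D ∧ star v = v ∧ v * v = 1}.Finite :=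
    finite_symmetries (B := D.toNonUnitalStarSubalgebra) (fun v hv => hv.1) (fun v hv => hv.2)
      fun v hv w hw => hD v hv.1 w hw.1
  set S := hfin.toFinset with hS
  have hmem : ∀ v, v ∈ S ↔ v ∈ D ∧ star v = v ∧ v * v = 1 := fun v => by simp [hS]
  have h1 : (1 : A) ∈ S := (hmem 1).2 ⟨one_mem _, star_one A, one_mul 1⟩
  have hcard : (S.card : ℂ) ≠ 0 := Nat.cast_ne_zero.2 (Finset.card_ne_zero_of_mem h1)
  set P : A →ₗ[ℂ] A := (S.card : ℂ)⁻¹ •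
    ∑ v ∈ S, (LinearMap.mulLeft ℂ v).comp (LinearMap.mulRight ℂ v) with hP
  have hPx : ∀ x, P x = (S.card : ℂ)⁻¹ • ∑ v ∈ S, v * x * v := fun x => by
    simp [hP, mul_assoc]
  refine ⟨P, S, _, fun v hv => ((hmem v).1 hv).1, hPx, fun x => ?_, fun x => ?_, fun x hx => ?_⟩
  · have hv : ∀ v ∈ S, ‖v * x * v‖ ≤ ‖x‖ := fun v hv => by
      obtain ⟨-, h2, h3⟩ := (hmem v).1 hv
      have hu : v ∈ unitary A := by rw [Unitary.mem_iff, h2]; exact ⟨h3, h3⟩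
      rw [CStarRing.norm_mul_mem_unitary _ hu, CStarRing.norm_mem_unitary_mul _ hu]
    rw [hPx, norm_smul, norm_inv, Complex.norm_natCast]
    have hc : (0 : ℝ) < S.card := by exact_mod_cast Finset.card_pos.2 ⟨1, h1⟩
    rw [inv_mul_le_iff₀ hc]
    refine (norm_sum_le _ _).trans ((Finset.sum_le_sum hv).trans ?_)
    rw [Finset.sum_const, nsmul_eq_mul]
  · have hw : ∀ w ∈ S, w * P x = P x * w := fun w hw => by
      obtain ⟨hw1, hw2, hw3⟩ := (hmem w).1 hw
      rw [hPx, mul_smul_comm, smul_mul_assoc, Finset.mul_sum, Finset.sum_mul]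
      congr 1
      have hwS : ∀ v ∈ S, w * v ∈ S := fun v hv => by
        obtain ⟨hv1, hv2, hv3⟩ := (hmem v).1 hv
        refine (hmem _).2 ⟨mul_mem hw1 hv1, ?_, ?_⟩
        · rw [star_mul, hv2, hw2, hD v hv1 w hw1]
        · calc w * v * (w * v) = w * (v * w) * v := by noncomm_ring
            _ = (w * w) * (v * v) := by rw [hD v hv1 w hw1]; noncomm_ring
            _ = 1 := by rw [hw3, hv3, one_mul]
      refine Finset.sum_bij' (fun v _ => w * v) (fun v _ => w * v) hwS hwS
        (fun v _ => by rw [← mul_assoc, hw3, one_mul]) (fun v _ => by rw [← mul_assoc, hw3, one_mul])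
        fun v hv => ?_
      have := hD v ((hmem v).1 hv).1 w hw1
      calc w * (v * x * v) = w * v * x * (v * (w * w)) := by rw [hw3]; noncomm_ring
        _ = w * v * x * (v * w * w) := by noncomm_ring
        _ = w * v * x * (w * v) * w := by rw [this]; noncomm_ring
    intro c hc
    have hspan := mem_span_symmetries (B := D.toNonUnitalStarSubalgebra) (one_mem D) hc
    clear hc
    induction hspan using Submodule.span_induction with
    | mem v hv => exact hw v ((hmem v).2 hv)
    | zero => simp
    | add a b _ _ ha hb => rw [add_mul, mul_add, ha, hb]
    | smul c a _ ha => rw [smul_mul_assoc, mul_smul_comm, ha]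
  · rw [hPx, Finset.sum_congr rfl (g := fun _ => x), Finset.sum_const, ← Nat.cast_smul_eq_nsmul ℂ,
      smul_smul, inv_mul_cancel₀ hcard, one_smul]
    intro v hv
    obtain ⟨hv1, -, hv3⟩ := (hmem v).1 hv
    rw [hx v hv1, mul_assoc, hv3, mul_one]

namespace IsMasaTower

variable {F D : ℕ → StarSubalgebra ℂ A}

theorem le_of_lt (h : IsMasaTower F D) {l m : ℕ} (hl : l < m) : D l ≤ F m :=
  (h.le l).trans (h.mono hl)

theorem comm_masa (h : IsMasaTower F D) {l m : ℕ} {c d : A} (hc : c ∈ D l) (hd : d ∈ D m) :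
    c * d = d * c := by
  rcases lt_trichotomy l m with hlm | rfl | hlm
  · exact h.comm m c (h.le_of_lt hlm hc) d hd
  · exact h.comm_self l c hc d hd
  · exact (h.comm l d (h.le_of_lt hlm hd) c hc).symm

theorem finiteDimensional_masa (h : IsMasaTower F D) (l : ℕ) : FiniteDimensional ℂ (D l) := by
  have := h.finiteDimensional (l + 1)
  exact Submodule.finiteDimensional_of_le (S₁ := (D l).toSubalgebra.toSubmodule)
    (S₂ := (F (l + 1)).toSubalgebra.toSubmodule) (h.le l)

/-- An element of `F (l + 1)` commuting with `D l` is a combination of products of elements of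
`F l` and `D l`. -/
theorem exists_eq_sum (h : IsMasaTower F D) {l : ℕ} {x : A} (hx : x ∈ F (l + 1))
    (hc : ∀ c ∈ D l, c * x = x * c) :
    ∃ (ι : Type) (_ : Fintype ι) (f d : ι → A), (∀ i, f i ∈ F l) ∧ (∀ i, d i ∈ D l) ∧
      x = ∑ i, f i * d i := by
  have := h.finiteDimensional l
  obtain ⟨ι, _, r, e, he⟩ := exists_isMatrixUnits (F l)
  refine ⟨ι × ι, inferInstance, fun p => e p.1 p.2, fun p => matrixCoeff e p.1 p.2 x,
    fun p => he.mem _ _, fun p => ?_, (he.sum_mul_matrixCoeff fun z hz hz' => ?_).symm⟩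
  -- The coefficients lie in `F (l + 1)` and commute with both `F l` and `D l`, so maximality of `D
  -- l` applies.
  · have hle := h.mono l.le_succ
    refine h.mem_of_comm l _ ?_ (fun f hf => he.mul_matrixCoeff _ _ _ hf) fun c hcD => ?_
    · beta_reduce
      rw [matrixCoeff_apply]
      exact sum_mem fun q _ => mul_mem (hle (he.mem _ _)) (mul_mem hx (hle (he.mem _ _)))
    · beta_reduce
      rw [matrixCoeff_apply, Finset.mul_sum, Finset.sum_mul]
      refine Finset.sum_congr rfl fun q _ => ?_
      rw [← mul_assoc, ← h.comm l _ (he.mem _ _) c hcD, mul_assoc, mul_assoc, ← mul_assoc c,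
        hc c hcD, mul_assoc x, ← h.comm l _ (he.mem _ _) c hcD, mul_assoc]
  -- The centre of `F l` lies in `D l` by maximality, hence commutes with `x`.
  · exact hc z (h.mem_of_comm l z (h.mono l.le_succ hz) hz' fun c hcD => (h.comm l z hz c hcD).symm)

/-- Successive averages over the symmetries of `D 0, …, D (m - 1)`. -/
theorem exists_averages (h : IsMasaTower F D) :
    ∃ Q : ℕ → A →ₗ[ℂ] A, (∀ m x, ‖Q m x‖ ≤ ‖x‖) ∧
      (∀ m, ∀ x ∈ F m, Q m x ∈ F m) ∧
      (∀ m x, (∀ l, ∀ c ∈ D l, c * x = x * c) → Q m x = x) ∧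
      (∀ p : A → Prop, (∀ x ∈ F 0, p x) → (∀ x y, p x → p y → p (x + y)) →
        (∀ l x, p x → ∀ c ∈ D l, p (x * c)) → ∀ m, ∀ x ∈ F m, p (Q m x)) ∧
      (∀ k, ∀ x ∈ F k, ∀ m ≥ k, Q m x = Q k x) ∧
      (∀ R : A → A → Prop, IsClosedStarDerivation R → (∀ l, ∀ c ∈ D l, R c 0) →
        ∀ m x y, R x y → R (Q m x) (Q m y)) := by
  have := h.finiteDimensional_masa
  choose P S a hS hP hnorm hcomm hfix using fun l =>
    exists_symmetry_average (D l) (h.comm_self l)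
  -- The average over the top masa is applied before the lower ones. It turns an element of `F (m +
  -- 1)` into a sum of products `f d` with `f ∈ F m` and `d ∈ D m`; the lower averages then act on
  -- `f` alone, which permits induction.
  set Q : ℕ → A →ₗ[ℂ] A := fun m => Nat.rec LinearMap.id (fun k q => q.comp (P k)) m with hQ
  have hQ0 : ∀ x, Q 0 x = x := fun x => rfl
  have hQs : ∀ m x, Q (m + 1) x = Q m (P m x) := fun m x => rfl
  have hPmem : ∀ {l m}, l < m → ∀ x ∈ F m, P l x ∈ F m := fun {l m} hl x hx => by
    rw [hP]
    refine SMulMemClass.smul_mem _ (sum_mem fun v hv => ?_)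
    have := h.le_of_lt hl (hS l v hv)
    exact mul_mem (mul_mem this hx) this
  have hQmem : ∀ k m, m ≤ k → ∀ x ∈ F k, Q m x ∈ F k := by
    intro k m
    induction m with
    | zero => intro _ x hx; exact hx
    | succ m ih =>
      intro hm x hx
      rw [hQs]
      exact ih (by omega) _ (hPmem (by omega) x hx)
  have hQmul : ∀ m x l, m ≤ l → ∀ c ∈ D l, Q m (x * c) = Q m x * c := by
    intro m
    induction m with
    | zero => intros; rfl
    | succ m ih =>
      intro x l hl c hc
      have : P m (x * c) = P m x * c := by
        rw [hP, hP, smul_mul_assoc, Finset.sum_mul]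
        congr 1
        refine Finset.sum_congr rfl fun v hv => ?_
        have := h.comm_masa (hS m v hv) hc
        rw [mul_assoc, mul_assoc x, ← this, ← mul_assoc, ← mul_assoc]
      rw [hQs, hQs, this, ih _ l (by omega) c hc]
  refine ⟨Q, fun m => ?_, fun m x hx => hQmem m m le_rfl x hx, fun m => ?_, fun p h0 hadd hmul m => ?_,
    fun k x hx m hm => ?_, fun R hR hRD m => ?_⟩
  · induction m with
    | zero => intro x; exact le_rfl
    | succ m ih => intro x; exact (ih _).trans (hnorm m x)
  · induction m with
    | zero => intro x _; rfl
    | succ m ih => intro x hx; rw [hQs, hfix m x (hx m), ih x hx]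
  · induction m with
    | zero => exact h0
    | succ m ih =>
      intro x hx
      obtain ⟨ι, _, f, d, hf, hd, hxs⟩ :=
        h.exists_eq_sum (hPmem m.lt_succ_self x hx) (hcomm m x)
      rw [hQs, hxs, map_sum]
      refine Finset.sum_induction _ p hadd (h0 0 (zero_mem _)) fun i _ => ?_
      rw [hQmul m _ m le_rfl _ (hd i)]
      exact hmul m _ (ih _ (hf i)) _ (hd i)
  · induction m, hm using Nat.le_induction with
    | base => rfl
    | succ m hm ih =>
      rw [hQs, hfix m x fun c hc => (h.comm m x (h.mono hm hx) c hc).symm, ih]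
  · induction m with
    | zero => intro x y hxy; exact hxy
    | succ m ih =>
      intro x y hxy
      refine ih _ _ ?_
      rw [hP, hP]
      exact hR.smul _ (hR.sum _ fun v hv =>
        hR.mul_right (hRD m v (hS m v hv)) (hR.mul_left (hRD m v (hS m v hv)) hxy))

end IsMasaTower

end MasaTower

/-! ### Derivations vanishing on the masas are inner on their commutant -/

section Implementation

variable {A : Type*} [CStarAlgebra A]

/-- The commutant of the masas of a tower. -/
noncomputable def masaCommutant (D : ℕ → StarSubalgebra ℂ A) : StarSubalgebra ℂ A :=
  StarSubalgebra.centralizer ℂ (⋃ l, (D l : Set A))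

theorem mem_masaCommutant {D : ℕ → StarSubalgebra ℂ A} {x : A} :
    x ∈ masaCommutant D ↔ ∀ l, ∀ c ∈ D l, c * x = x * c := by
  rw [masaCommutant, StarSubalgebra.mem_centralizer_iff]
  constructor
  · intro h l c hc
    exact (h c (Set.mem_iUnion.2 ⟨l, hc⟩)).1
  · intro h c hc
    obtain ⟨l, hl⟩ := Set.mem_iUnion.1 hc
    exact ⟨h l c hl, h l _ (star_mem hl)⟩

theorem isClosed_masaCommutant (D : ℕ → StarSubalgebra ℂ A) :
    IsClosed (masaCommutant D : Set A) := by
  have : (masaCommutant D : Set A) = ⋂ l, ⋂ c ∈ D l, {x | c * x = x * c} := by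
    ext x
    simp [mem_masaCommutant]
  rw [this]
  exact isClosed_iInter fun l => isClosed_iInter fun c => isClosed_iInter fun _ =>
    isClosed_eq (continuous_const_mul c) (continuous_mul_const c)

namespace IsMasaTower

variable {F D : ℕ → StarSubalgebra ℂ A}

theorem le_masaCommutant (h : IsMasaTower F D) : F 0 ≤ masaCommutant D := fun x hx =>
  mem_masaCommutant.2 fun l c hc => (h.comm l x (h.mono (Nat.zero_le l) hx) c hc).symm

/-- Induction principle for closed properties on the commutant of the masas. -/
theorem masaCommutant_induction (h : IsMasaTower F D) {p : A → Prop} (h0 : ∀ x ∈ F 0, p x)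
    (hadd : ∀ x y, p x → p y → p (x + y)) (hmul : ∀ l x, p x → ∀ c ∈ D l, p (x * c))
    (hlim : ∀ (u : ℕ → A) x, (∀ n, p (u n)) → Tendsto u atTop (𝓝 x) → p x) :
    ∀ x ∈ masaCommutant D, p x := by
  obtain ⟨Q, hnorm, -, hfix, hind, -, -⟩ := h.exists_averages
  intro x hx
  -- An approximant `y ∈ F m` of `x` is replaced by `Q m y`: the inductive property holds for it,
  -- and it is no further from `x`, since `Q m` is contractive and fixes `x`.
  have : ∀ n : ℕ, ∃ y, p y ∧ ‖y - x‖ ≤ 1 / ((n : ℝ) + 1) := fun n => by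
    obtain ⟨y, hy, hyF⟩ := Metric.dense_iff.1 h.dense x (1 / ((n : ℝ) + 1)) (by positivity)
    obtain ⟨m, hm⟩ := Set.mem_iUnion.1 hyF
    refine ⟨Q m y, hind p h0 hadd hmul m y hm, ?_⟩
    rw [← hfix m x (mem_masaCommutant.1 hx), ← map_sub]
    refine (hnorm m _).trans ?_
    rw [← dist_eq_norm]
    exact hy.le
  choose u hu hux using this
  refine hlim u x hu ?_
  rw [tendsto_iff_norm_sub_tendsto_zero]
  exact squeeze_zero (fun n => norm_nonneg _) hux tendsto_one_div_add_atTop_nhds_zero_nat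

theorem exists_mem_near (h : IsMasaTower F D) {x : A} (hx : x ∈ masaCommutant D) {ε : ℝ}
    (hε : 0 < ε) : ∃ m, ∃ y ∈ F m, y ∈ masaCommutant D ∧ ‖x - y‖ < ε := by
  obtain ⟨Q, hnorm, hQF, hfix, hind, -, -⟩ := h.exists_averages
  obtain ⟨y, hy, hyF⟩ := Metric.dense_iff.1 h.dense x ε hε
  obtain ⟨m, hm⟩ := Set.mem_iUnion.1 hyF
  refine ⟨m, Q m y, hQF m y hm, ?_, ?_⟩
  · refine hind (· ∈ masaCommutant D) (fun x hx => h.le_masaCommutant hx) (fun _ _ => add_mem)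
      (fun l x hx c hc => mul_mem hx ?_) m y hm
    exact mem_masaCommutant.2 fun k d hd => h.comm_masa hd hc
  · rw [← hfix m x (mem_masaCommutant.1 hx), ← map_sub]
    refine (hnorm m _).trans_lt ?_
    rwa [← dist_eq_norm, dist_comm]

/-- The averages stabilise on every `F k` and are contractive, so they converge pointwise, with
limits in the commutant. Closedness carries the derivation through the limit. As `F 0` is fixed,
approximations of its elements do not deteriorate. -/
theorem exists_mem_masaCommutant (h : IsMasaTower F D) {R : A → A → Prop}
    (hR : IsClosedStarDerivation R) (hRD : ∀ l, ∀ c ∈ D l, R c 0) {x y : A} (hxy : R x y) :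
    ∃ x' ∈ masaCommutant D, ∃ y' ∈ masaCommutant D, R x' y' ∧ ∀ e ∈ F 0, ‖x' - e‖ ≤ ‖x - e‖ := by
  obtain ⟨Q, hnorm, hQF, hfix, hind, hstab, hQR⟩ := h.exists_averages
  have key : ∀ x, ∃ x' ∈ masaCommutant D, Tendsto (fun m => Q m x) atTop (𝓝 x') := by
    intro x
    have happ : ∀ ε > 0, ∃ k, ∃ z ∈ masaCommutant D, ∀ m ≥ k, ‖Q m x - z‖ < ε := fun ε hε => by
      obtain ⟨y, hy, hyF⟩ := Metric.dense_iff.1 h.dense x ε hε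
      obtain ⟨k, hk⟩ := Set.mem_iUnion.1 hyF
      refine ⟨k, Q k y, ?_, fun m hm => ?_⟩
      · refine hind (· ∈ masaCommutant D) (fun x hx => h.le_masaCommutant hx) (fun _ _ => add_mem)
          (fun l x hx c hc => mul_mem hx ?_) k y hk
        exact mem_masaCommutant.2 fun k d hd => h.comm_masa hd hc
      · rw [← hstab k y hk m hm, ← map_sub]
        refine (hnorm m _).trans_lt ?_
        rwa [← dist_eq_norm, dist_comm]
    have hcau : CauchySeq fun m => Q m x := by
      rw [Metric.cauchySeq_iff']
      intro ε hε
      obtain ⟨k, z, -, hz⟩ := happ (ε / 2) (half_pos hε)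
      refine ⟨k, fun m hm => ?_⟩
      have h1 := hz m hm
      have h2 := hz k le_rfl
      rw [← dist_eq_norm] at h1 h2
      exact (dist_triangle_right _ _ z).trans_lt (by linarith)
    obtain ⟨x', hx'⟩ := cauchySeq_tendsto_of_complete hcau
    refine ⟨x', ?_, hx'⟩
    rw [← SetLike.mem_coe, ← (isClosed_masaCommutant D).closure_eq, Metric.mem_closure_iff]
    intro ε hε
    obtain ⟨k, z, hzM, hz⟩ := happ (ε / 2) (half_pos hε)
    refine ⟨z, hzM, ?_⟩
    have h1 : Tendsto (fun m => ‖Q m x - z‖) atTop (𝓝 ‖x' - z‖) :=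
      (hx'.sub tendsto_const_nhds).norm
    have h2 : ‖x' - z‖ ≤ ε / 2 := le_of_tendsto h1
      (eventually_atTop.2 ⟨k, fun m hm => (hz m hm).le⟩)
    rw [dist_eq_norm]
    linarith
  obtain ⟨x', hx', hxl⟩ := key x
  obtain ⟨y', hy', hyl⟩ := key y
  refine ⟨x', hx', y', hy', hR.closed (fun m => hQR R hR hRD m x y hxy) hxl hyl, fun e he => ?_⟩
  refine le_of_tendsto (hxl.sub_const e).norm (Eventually.of_forall fun m => ?_)
  have : Q m e = e := hfix m e (mem_masaCommutant.1 (h.le_masaCommutant he))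
  nth_rewrite 1 [← this]
  rw [← map_sub]
  exact hnorm m _

/-- For `x ∈ F 0` the coefficient is central in `F 0`, hence lies in `D 0`. Coefficients are linear
over the masas, so for the whole commutant they stay in the kernel of the derivation. -/
theorem hasDerivation_matrixCoeff (h : IsMasaTower F D) {R : A → A → Prop}
    (hR : IsClosedStarDerivation R) (hRD : ∀ l, ∀ c ∈ D l, R c 0)
    {ι : Type*} [Fintype ι] {r : ι → ι} {e : ι → ι → A} (he : IsMatrixUnits (F 0) r e)
    (i j : ι) : ∀ x ∈ masaCommutant D, R (matrixCoeff e i j x) 0 := by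
  refine h.masaCommutant_induction (fun x hx => hRD 0 _ (h.mem_of_comm 0 _ ?_ (fun f hf =>
    he.mul_matrixCoeff _ _ _ hf) fun c hc => ?_)) (fun x y hx hy => ?_) (fun l x hx c hc => ?_)
    fun u x hu hx => ?_
  · refine h.mono zero_le_one ?_
    rw [matrixCoeff_apply]
    exact sum_mem fun p _ => mul_mem (he.mem _ _) (mul_mem hx (he.mem _ _))
  · refine (h.comm 0 _ ?_ c hc).symm
    rw [matrixCoeff_apply]
    exact sum_mem fun p _ => mul_mem (he.mem _ _) (mul_mem hx (he.mem _ _))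
  · rw [map_add]
    simpa using hR.add hx hy
  · rw [he.matrixCoeff_mul i j x fun f hf => h.comm l f (h.mono (Nat.zero_le l) hf) c hc]
    simpa using hR.mul_right (hRD l c hc) hx
  · exact hR.closed hu ((matrixCoeff e i j).continuous.continuousAt.tendsto.comp hx)
      tendsto_const_nhds

/-- The matrix units of `F 0` lie in the domain of the derivation. -/
theorem exists_hasDerivation_matrixUnits (h : IsMasaTower F D) {R : A → A → Prop}
    (hR : IsClosedStarDerivation R) (hRD : ∀ l, ∀ c ∈ D l, R c 0)
    {ι : Type*} [Fintype ι] {r : ι → ι} {e : ι → ι → A} (he : IsMatrixUnits (F 0) r e) :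
    ∃ d : ι → ι → A, (∀ i j, d i j ∈ masaCommutant D) ∧ ∀ i j, R (e i j) (d i j) := by
  set M := masaCommutant D with hM
  have heM : ∀ i j, e i j ∈ M := fun i j => h.le_masaCommutant (he.mem i j)
  set K : ℝ := ∑ p : ι × ι, ‖matrixCoeff e p.1 p.2‖ with hK
  have hK0 : 0 ≤ K := Finset.sum_nonneg fun _ _ => norm_nonneg _
  have hx : ∀ p : ι × ι, ∃ x ∈ M, ∃ y ∈ M, R x y ∧ ‖x - e p.1 p.2‖ ≤ 1 / (2 * (K + 1)) := fun p => by
    obtain ⟨x, hx, y, hxy⟩ := Metric.dense_iff.1 hR.dense (e p.1 p.2) (1 / (2 * (K + 1)))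
      (by positivity)
    obtain ⟨x', hx', y', hy', hR', hn⟩ := h.exists_mem_masaCommutant hR hRD hxy
    refine ⟨x', hx', y', hy', hR', (hn _ (he.mem _ _)).trans ?_⟩
    rw [← dist_eq_norm]
    exact (Metric.mem_ball.1 hx).le
  choose x hxM y hyM hxy hxe using hx
  set T : ι × ι → ι × ι → A := fun p q => matrixCoeff e q.1 q.2 (e p.1 p.2 - x p) with hT
  have hTR : ∀ p q, R (T p q) 0 := fun p q =>
    h.hasDerivation_matrixCoeff hR hRD he _ _ _ (sub_mem (heM _ _) (hxM p))
  have hTM : ∀ p q, T p q ∈ M := fun p q => by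
    simp only [hT]
    rw [matrixCoeff_apply]
    exact sum_mem fun s _ => mul_mem (heM _ _) (mul_mem (sub_mem (heM _ _) (hxM p)) (heM _ _))
  -- Expanding the error `e - x` in matrix units gives `e p = x p + ∑ e q * T p q` with small `T` in
  -- the kernel. This fixed-point equation and its formal derivative `d p = y p + ∑ d q * T p q` are
  -- contractions with the same coefficients; iterating both from `0` keeps the pairs in the closed
  -- graph.
  set f : (ι × ι → A) → (ι × ι → A) → ι × ι → A := fun w z p => w p + ∑ q, z q * T p q with hf
  have hTn : ∀ p, ∑ q, ‖T p q‖ ≤ 1 / 2 := fun p => by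
    have : ∀ q ∈ Finset.univ, ‖T p q‖ ≤ ‖matrixCoeff e q.1 q.2‖ * (1 / (2 * (K + 1))) :=
      fun q _ => ((matrixCoeff e q.1 q.2).le_opNorm _).trans (by
        rw [norm_sub_rev]
        gcongr
        exact hxe p)
    refine (Finset.sum_le_sum this).trans ?_
    rw [← Finset.sum_mul, ← hK, mul_one_div, div_le_div_iff₀ (by positivity) two_pos]
    linarith
  have hcon : ∀ w, ContractingWith (1 / 2) (f w) := fun w => by
    refine ⟨by norm_num, LipschitzWith.of_dist_le_mul fun z z' => ?_⟩
    rw [dist_pi_le_iff (by positivity)]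
    intro p
    rw [dist_eq_norm]
    have : f w z p - f w z' p = ∑ q, (z q - z' q) * T p q := by
      simp only [hf, sub_mul, Finset.sum_sub_distrib]; abel
    rw [this]
    refine (norm_sum_le _ _).trans ?_
    calc ∑ q, ‖(z q - z' q) * T p q‖ ≤ ∑ q, dist z z' * ‖T p q‖ := by
          refine Finset.sum_le_sum fun q _ => (norm_mul_le _ _).trans ?_
          gcongr
          rw [← dist_eq_norm]
          exact dist_le_pi_dist z z' q
      _ = dist z z' * ∑ q, ‖T p q‖ := by rw [Finset.mul_sum]
      _ ≤ dist z z' * (1 / 2) := by gcongr; exact hTn p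
      _ = _ := by rw [mul_comm]; norm_num
  have hfe : Function.IsFixedPt (f x) fun p => e p.1 p.2 := by
    funext p
    have := he.sum_mul_matrixCoeff (x := e p.1 p.2 - x p) fun z hz hz' =>
      mem_masaCommutant.1 (sub_mem (heM _ _) (hxM p)) 0 z
        (h.mem_of_comm 0 z (h.mono zero_le_one hz) hz' fun c hc => (h.comm 0 z hz c hc).symm)
    simp only [hf, hT]
    rw [this]
    abel
  have hu : ∀ p, Tendsto (fun n => ((f x)^[n] 0) p) atTop (𝓝 (e p.1 p.2)) := fun p => by
    have := (hcon x).tendsto_iterate_fixedPoint 0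
    rw [← (hcon x).fixedPoint_unique hfe] at this
    exact (tendsto_pi_nhds.1 this) p
  set d := ContractingWith.fixedPoint (f y) (hcon y) with hd
  have hv : ∀ p, Tendsto (fun n => ((f y)^[n] 0) p) atTop (𝓝 (d p)) := fun p =>
    (tendsto_pi_nhds.1 ((hcon y).tendsto_iterate_fixedPoint 0)) p
  have huv : ∀ n p, R (((f x)^[n] 0) p) (((f y)^[n] 0) p) ∧ ((f y)^[n] 0) p ∈ M := by
    intro n
    induction n with
    | zero => exact fun p => ⟨hR.zero, zero_mem _⟩
    | succ n ih =>
      intro p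
      rw [Function.iterate_succ_apply', Function.iterate_succ_apply']
      exact ⟨hR.add (hxy p) (hR.sum _ fun q _ => hR.mul_right (hTR p q) (ih q).1),
        add_mem (hyM p) (sum_mem fun q _ => mul_mem (ih q).2 (hTM p q))⟩
  refine ⟨fun i j => d (i, j), fun i j => ?_, fun i j =>
    hR.closed (fun n => (huv n (i, j)).1) (hu (i, j)) (hv (i, j))⟩
  exact (isClosed_masaCommutant D).mem_of_tendsto (hv (i, j))
    (Eventually.of_forall fun n => (huv n (i, j)).2)

/-- A derivation that vanishes on the masas is inner on their commutant. -/
theorem exists_implements (h : IsMasaTower F D) {R : A → A → Prop}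
    (hR : IsClosedStarDerivation R) (hRD : ∀ l, ∀ c ∈ D l, R c 0) :
    ∃ g ∈ masaCommutant D, star g = -g ∧ ∀ x ∈ masaCommutant D, R x (g * x - x * g) := by
  classical
  have := h.finiteDimensional 0
  obtain ⟨ι, _, r, e, he⟩ := exists_isMatrixUnits (F 0)
  obtain ⟨d, hdM, hd⟩ := h.exists_hasDerivation_matrixUnits hR hRD he
  -- The standard implementing element: differentiating the products `e a b * e i (r i)` and summing
  -- with `∑ e i i = 1` gives `[g', e a b] = d a b`.
  set g' := ∑ i, d i (r i) * e (r i) i with hg'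
  have hg'M : g' ∈ masaCommutant D := sum_mem fun i _ =>
    mul_mem (hdM _ _) (h.le_masaCommutant (he.mem _ _))
  have hcomm : ∀ a b, g' * e a b - e a b * g' = d a b := fun a b => by
    by_cases hab : r a = r b
    · have h1 : g' * e a b = d a (r a) * e (r a) b := by
        rw [hg', Finset.sum_mul, Finset.sum_eq_single a]
        · rw [mul_assoc, he.mul (he.rep a)]
        · intro i _ hi
          rw [mul_assoc, he.mul_ne hi, mul_zero]
        · simp
      have h2 : ∀ i, e a b * (d i (r i) * e (r i) i) =
          (if i = b then d a (r a) * e (r a) b else 0) - d a b * e i i := fun i => by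
        have h3 := hR.mul (hd a b) (hd i (r i))
        have h5 : e i (r i) * e (r i) i = e i i := he.mul (he.rep i).symm
        split_ifs with hi
        · subst hi
          rw [he.mul hab, ← hab] at h3
          have h4 := hR.unique h3 (hd a (r a))
          rw [hab] at h4
          rw [← h5, hab, ← h4]
          noncomm_ring
        · rw [he.mul_ne fun h => hi h.symm] at h3
          have h4 := hR.unique h3 hR.zero
          rw [← mul_assoc, eq_neg_of_add_eq_zero_right h4, ← h5]
          noncomm_ring
      rw [h1, hg', Finset.mul_sum, Finset.sum_congr rfl fun i _ => h2 i, Finset.sum_sub_distrib,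
        Finset.sum_ite_eq' , if_pos (Finset.mem_univ b), ← Finset.mul_sum, he.sum, mul_one,
        sub_sub_cancel]
    · have h1 := hd a b
      rw [he.eq_zero hab] at h1 ⊢
      rw [hR.unique h1 hR.zero, mul_zero, zero_mul, sub_zero]
  have hF' : ∀ x ∈ F 0, R x (g' * x - x * g') := by
    intro x hx
    have := he.span x hx
    clear hx
    induction this using Submodule.span_induction with
    | mem x hx =>
      obtain ⟨p, rfl⟩ := hx
      rw [hcomm]
      exact hd _ _
    | zero => simpa using hR.zero
    | add x y _ _ hx hy =>
      convert hR.add hx hy using 1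
      noncomm_ring
    | smul c x _ hx =>
      convert hR.smul c hx using 1
      rw [mul_smul_comm, smul_mul_assoc, smul_sub]
  set g := (1 / 2 : ℂ) • (g' - star g') with hg
  have hgM : g ∈ masaCommutant D := SMulMemClass.smul_mem _ (sub_mem hg'M (star_mem hg'M))
  refine ⟨g, hgM, ?_, h.masaCommutant_induction (fun x hx => ?_) (fun x y hx hy => ?_)
    (fun l x hx c hc => ?_) fun u x hu hx => ?_⟩
  · rw [hg, star_smul, star_sub, star_star, ← smul_neg, neg_sub]
    simp
  · have h1 := hF' x hx
    have h2 := hR.star (hF' _ (star_mem hx))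
    rw [star_star] at h2
    convert hR.smul (1 / 2) (hR.add h1 h2) using 1
    · rw [← two_smul ℂ, smul_smul]; norm_num
    · rw [hg, smul_mul_assoc, mul_smul_comm, ← smul_sub]
      congr 1
      rw [star_sub, star_mul, star_mul, star_star]
      noncomm_ring
  · convert hR.add hx hy using 1
    noncomm_ring
  · convert hR.mul_right (hRD l c hc) hx using 1
    rw [sub_mul, mul_assoc x, mul_assoc x, ← mem_masaCommutant.1 hgM l c hc, mul_assoc]
  · refine hR.closed hu hx ?_
    exact (hx.const_mul g).sub (hx.mul_const g)

end IsMasaTower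

end Implementation

/-! ### Near-innerness of the generator -/

section LocalStructure

variable {A : Type*} [CStarAlgebra A]

/-- The image of a tower under an automorphism, described through its inverse. -/
theorem IsMasaTower.comap {F D : ℕ → StarSubalgebra ℂ A} (h : IsMasaTower F D)
    (φ : A ≃⋆ₐ[ℂ] A) :
    IsMasaTower (fun n => (F n).comap (φ : A →⋆ₐ[ℂ] A)) (fun n => (D n).comap (φ : A →⋆ₐ[ℂ] A)) where
  mono i j hij x hx := h.mono hij hx
  finiteDimensional n := by
    have := h.finiteDimensional n
    let L : (F n).comap (φ : A →⋆ₐ[ℂ] A) →ₗ[ℂ] F n :=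
      { toFun := fun x => ⟨φ x, x.2⟩
        map_add' := fun x y => Subtype.ext (map_add φ (x : A) y)
        map_smul' := fun c x => Subtype.ext (map_smul φ c (x : A)) }
    exact FiniteDimensional.of_injective L fun x y hxy =>
      Subtype.ext (φ.injective (congrArg Subtype.val hxy))
  dense := by
    refine Metric.dense_iff.2 fun x ε hε => ?_
    obtain ⟨y, hy, hyF⟩ := Metric.dense_iff.1 h.dense (φ x) ε hε
    obtain ⟨n, hn⟩ := Set.mem_iUnion.1 hyF
    refine ⟨φ.symm y, ?_, Set.mem_iUnion.2 ⟨n, ?_⟩⟩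
    · rw [Metric.mem_ball, dist_eq_norm] at hy ⊢
      rw [← StarAlgEquiv.norm_map φ, map_sub, φ.apply_symm_apply]
      exact hy
    · change φ (φ.symm y) ∈ F n
      rwa [φ.apply_symm_apply]
  le l x hx := h.le l hx
  comm l x hx c hc := φ.injective (by
    rw [map_mul, map_mul]
    exact h.comm l _ hx _ hc)
  comm_self l c hc d hd := φ.injective (by
    rw [map_mul, map_mul]
    exact h.comm_self l _ hc _ hd)
  mem_of_comm l y hy hyF hyD := by
    refine h.mem_of_comm l (φ y) hy (fun x hx => ?_) fun c hc => ?_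
    · have := congrArg φ (hyF (φ.symm x) (by change φ (φ.symm x) ∈ F l; rwa [φ.apply_symm_apply]))
      rwa [map_mul, map_mul, φ.apply_symm_apply] at this
    · have := congrArg φ (hyD (φ.symm c) (by change φ (φ.symm c) ∈ D l; rwa [φ.apply_symm_apply]))
      rwa [map_mul, map_mul, φ.apply_symm_apply] at this

/-- The shift by `q` serves twice: it brings the unit of `A` into the algebras, and it allows the
tower to start above any prescribed finite-dimensional stage. -/
theorem isMasaTower_relativeMasa {C : NonUnitalStarSubalgebra ℂ A} (hC : IsMasaOf C ⊤)
    {F : ℕ → NonUnitalStarSubalgebra ℂ A} (hF : Monotone F) [∀ n, FiniteDimensional ℂ (F n)]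
    (hd : Dense (⋃ n, (F n : Set A)))
    (hm : ∀ n, IsMasaOf (relativeMasa C F n)
      (F (n + 1) ⊓ NonUnitalStarSubalgebra.centralizer ℂ (F n : Set A)))
    (q : ℕ) (hF1 : ∀ n, (1 : A) ∈ F (q + n)) (hD1 : ∀ n, (1 : A) ∈ relativeMasa C F (q + n)) :
    IsMasaTower (fun n => (F (q + n)).toStarSubalgebra (hF1 n))
      (fun n => (relativeMasa C F (q + n)).toStarSubalgebra (hD1 n)) where
  mono i j hij x hx := hF (Nat.add_le_add_left hij q) hx
  finiteDimensional n := (inferInstance : FiniteDimensional ℂ (F (q + n)))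
  dense := hd.mono fun x hx => by
    obtain ⟨n, hn⟩ := Set.mem_iUnion.1 hx
    exact Set.mem_iUnion.2 ⟨n, hF (Nat.le_add_left n q) hn⟩
  le l x hx := hx.2.1
  comm l x hx c hc := ((NonUnitalStarSubalgebra.mem_centralizer_iff ℂ).1 hc.2.2 x hx).1
  comm_self l c hc d hd := hC.2.1.2 c hc.1 d hd.1
  mem_of_comm l y hy hyF hyD := by
    have : FiniteDimensional ℂ (F (q + l + 1) ⊓
        NonUnitalStarSubalgebra.centralizer ℂ (F (q + l) : Set A) :
          NonUnitalStarSubalgebra ℂ A) :=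
      Submodule.finiteDimensional_of_le (S₁ := (F (q + l + 1) ⊓
        NonUnitalStarSubalgebra.centralizer ℂ (F (q + l) : Set A) :
          NonUnitalStarSubalgebra ℂ A).toSubmodule) (S₂ := (F (q + l + 1)).toSubmodule)
        fun x (hx : x ∈ F (q + l + 1) ⊓ _) => hx.1
    refine (hm (q + l)).mem_of_commute (isClosed_of_finiteDimensional _) ⟨hy, ?_⟩ hyD
    refine (NonUnitalStarSubalgebra.mem_centralizer_iff ℂ).2 fun x hx => ⟨hyF x hx, ?_⟩
    exact hyF _ (star_mem hx)

/-- An element close to a skew-adjoint one has skew-adjoint part at least as close. -/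
theorem norm_sub_skew_le {a z : A} (ha : star a = -a) {ε : ℝ} (h : ‖a - z‖ < ε) :
    ‖a - (1 / 2 : ℂ) • (z - star z)‖ < ε := by
  have e : a - (1 / 2 : ℂ) • (z - star z) = (1 / 2 : ℂ) • ((a - z) - star (a - z)) := by
    rw [star_sub, ha]
    module
  rw [e, norm_smul]
  have h1 := norm_sub_le (a - z) (star (a - z))
  rw [norm_star] at h1
  have h2 : ‖(1 / 2 : ℂ)‖ = 1 / 2 := by norm_num
  rw [h2]
  linarith

theorem star_skewPart (z : A) :
    star ((1 / 2 : ℂ) • (z - star z)) = -((1 / 2 : ℂ) • (z - star z)) := by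
  rw [star_smul, star_sub, star_star, ← smul_neg, neg_sub]
  simp

theorem norm_commutator_le (a x : A) : ‖a * x - x * a‖ ≤ 2 * ‖a‖ * ‖x‖ := by
  have h1 := norm_sub_le (a * x) (x * a)
  have h2 := norm_mul_le a x
  have h3 := norm_mul_le x a
  linarith

namespace OneParameterAutomorphismGroup

variable (α : OneParameterAutomorphismGroup A)

/-- An inner perturbation of the generator is a closed derivation. -/
theorem isClosedStarDerivation_perturbation {κ : A} (hκ : star κ = -κ) :
    IsClosedStarDerivation fun x y => α.HasGen x (y + (κ * x - x * κ)) where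
  zero := by simpa using hasGen_zero
  add hx hy := by
    convert hx.add hy using 1
    noncomm_ring
  smul c x x' hx := by
    convert hx.smul c using 1
    rw [mul_smul_comm, smul_mul_assoc, smul_add, smul_sub]
  mul hx hy := by
    convert hx.mul hy using 1
    noncomm_ring
  star hx := by
    convert hx.star using 1
    rw [star_add, star_sub, star_mul, star_mul, hκ]
    noncomm_ring
  unique hx hy := add_right_cancel (hx.unique hy)
  closed h hu hv := HasGen.of_tendsto h hu
    (hv.add ((hu.const_mul κ).sub (hu.mul_const κ)))
  dense := Metric.dense_iff.2 fun x ε hε => by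
    obtain ⟨y, z, hyz, hy⟩ := α.dense_generatorDomain x hε
    refine ⟨y, ?_, z - (κ * y - y * κ), by simpa using hyz⟩
    rwa [Metric.mem_ball, dist_comm, dist_eq_norm]

/-- The generator is nearly inner on arbitrarily large finite-dimensional subalgebras. -/
theorem exists_nearly_inner (hA : IsSimpleCStarAlgebra A) {C : NonUnitalStarSubalgebra ℂ A}
    (hC : IsCanonicalAFMasa C) (hCD : (C : Set A) ⊆ α.generatorDomain) (u : A) {η : ℝ}
    (hη : 0 < η) :
    ∃ B : StarSubalgebra ℂ A, FiniteDimensional ℂ B ∧ ∃ g ∈ B, star g = -g ∧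
      ∃ b ∈ B, ‖u - b‖ < η ∧
        ∀ x ∈ B, ∃ y, α.HasGen x y ∧ ‖y - (g * x - x * g)‖ ≤ 4 * η * ‖x‖ := by
  obtain ⟨hC, -, F, -, hF, hfd, hd, hm⟩ := hC
  obtain ⟨W, hW, k, hk, m, hm1, hgen⟩ :=
    α.exists_unitary_conj_hasGen_relativeMasa hA hC hCD hF hd
  obtain ⟨hW1, hW2⟩ := Unitary.mem_iff.1 hW
  have h1C := one_mem_of_isMasaOf_top hC
  have hF1 : ∀ n ≥ m, (1 : A) ∈ F n := fun n hn => hF hn hm1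
  have hD1 : ∀ n ≥ m, (1 : A) ∈ relativeMasa C F n := fun n hn =>
    ⟨h1C, hF1 _ (hn.trans n.le_succ),
      (NonUnitalStarSubalgebra.mem_centralizer_iff ℂ).2 fun x _ => by simp⟩
  set φ : A ≃⋆ₐ[ℂ] A := Unitary.conjStarAlgAut ℂ A (star ⟨W, hW⟩) with hφ
  have hφx : ∀ x, φ x = star W * x * W := fun x => by
    rw [hφ, Unitary.conjStarAlgAut_apply, Unitary.coe_star, star_star]
  have hφW : ∀ x, W * φ x * star W = x := fun x => by
    rw [hφx]
    calc W * (star W * x * W) * star W = (W * star W) * x * (W * star W) := by noncomm_ring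
      _ = x := by rw [hW2, one_mul, mul_one]
  have h0 := fun q hq => isMasaTower_relativeMasa hC hF hd hm q (fun n => hF1 _ (le_add_right hq))
    (fun n => hD1 _ (le_add_right hq))
  have htower := fun q hq => (h0 q hq).comap φ
  obtain ⟨z, hz, hzF⟩ := Metric.dense_iff.1 (htower m le_rfl).dense k η hη
  obtain ⟨b, hb, hbF⟩ := Metric.dense_iff.1 (htower m le_rfl).dense u η hη
  obtain ⟨n₁, hn₁⟩ := Set.mem_iUnion.1 hzF
  obtain ⟨n₂, hn₂⟩ := Set.mem_iUnion.1 hbF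
  -- The tower is restarted where its initial algebra contains approximants of both `k` and `u`.
  set q := m + max n₁ n₂ with hq
  have hmq : m ≤ q := Nat.le_add_right _ _
  have hT := htower q hmq
  set F' := fun n => ((F (q + n)).toStarSubalgebra (hF1 _ (le_add_right hmq))).comap
    (φ : A →⋆ₐ[ℂ] A) with hF'
  set D' := fun n => ((relativeMasa C F (q + n)).toStarSubalgebra
    (hD1 _ (le_add_right hmq))).comap (φ : A →⋆ₐ[ℂ] A) with hD'
  have hzq : z ∈ F' 0 := hF (Nat.add_le_add_left (le_max_left n₁ n₂) m) hn₁
  have hbq : b ∈ F' 0 := hF (Nat.add_le_add_left (le_max_right n₁ n₂) m) hn₂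
  set k' := (1 / 2 : ℂ) • (z - star z) with hk'
  have hk'F : k' ∈ F' 0 := SMulMemClass.smul_mem _ (sub_mem hzq (star_mem hzq))
  have hkk' : ‖k - k'‖ < η := norm_sub_skew_le hk (by rwa [← dist_eq_norm, dist_comm])
  have hκ : star (k - k') = -(k - k') := by rw [star_sub, hk, star_skewPart]; abel
  -- The derivation is `δ_α - ad (k - k')`. As `k'` lies in the initial algebra it commutes with the
  -- masas, where `δ_α = ad k`; so the small perturbation `k - k'` already makes the derivation
  -- vanish on them.
  have hR := α.isClosedStarDerivation_perturbation hκ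
  obtain ⟨g, hgM, hg, hgR⟩ := hT.exists_implements hR fun l c hc => by
    have h1 := hgen (q + l) (le_add_right hmq) (φ c) hc
    rw [hφW] at h1
    have h2 : k' * c = c * k' := hT.comm l k' (hT.mono (Nat.zero_le l) hk'F) c hc
    convert h1 using 1
    rw [sub_mul, mul_sub, h2]
    abel
  obtain ⟨p, z', hz'F, hz'M, hz'⟩ := hT.exists_mem_near hgM hη
  have hfdB : FiniteDimensional ℂ (F' p ⊓ masaCommutant D' : StarSubalgebra ℂ A) := by
    have := hT.finiteDimensional p
    exact Submodule.finiteDimensional_of_le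
      (S₁ := (F' p ⊓ masaCommutant D' : StarSubalgebra ℂ A).toSubalgebra.toSubmodule)
      (S₂ := (F' p).toSubalgebra.toSubmodule) fun x (hx : x ∈ F' p ⊓ masaCommutant D') => hx.1
  have hz'B : z' ∈ F' p ⊓ masaCommutant D' := ⟨hz'F, hz'M⟩
  refine ⟨F' p ⊓ masaCommutant D', hfdB, (1 / 2 : ℂ) • (z' - star z'),
    SMulMemClass.smul_mem _ (sub_mem hz'B (star_mem hz'B)), star_skewPart z', b,
    ⟨hT.mono (Nat.zero_le p) hbq, hT.le_masaCommutant hbq⟩,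
    by rwa [← dist_eq_norm, dist_comm], fun x hx => ⟨_, hgR x hx.2, ?_⟩⟩
  have hgg := norm_sub_skew_le hg hz'
  set g' := (1 / 2 : ℂ) • (z' - star z')
  have e : g * x - x * g + ((k - k') * x - x * (k - k')) - (g' * x - x * g') =
      ((g - g') * x - x * (g - g')) + ((k - k') * x - x * (k - k')) := by noncomm_ring
  rw [e]
  refine (norm_add_le _ _).trans ?_
  have h1 := norm_commutator_le (g - g') x
  have h2 := norm_commutator_le (k - k') x
  have h3 : ‖g - g'‖ * ‖x‖ ≤ η * ‖x‖ := by gcongr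
  have h4 : ‖k - k'‖ * ‖x‖ ≤ η * ‖x‖ := by gcongr
  linarith

end OneParameterAutomorphismGroup

end LocalStructure

/-! ### Inner one-parameter groups and small commutators -/

section InnerGroup

variable {A : Type*} [CStarAlgebra A]

theorem exp_smul_mem_unitary {g : A} (hg : star g = -g) (t : ℝ) :
    NormedSpace.exp (t • g) ∈ unitary A := by
  let _ : NormedAlgebra ℚ A := NormedAlgebra.restrictScalars ℚ ℂ A
  refine NormedSpace.exp_mem_unitary_of_mem_skewAdjoint (skewAdjoint.mem_iff.2 ?_)
  rw [star_smul, hg, smul_neg, star_trivial]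

theorem continuous_exp_smul (g : A) : Continuous fun t : ℝ => NormedSpace.exp (t • g) :=
  continuous_iff_continuousAt.2 fun t => (hasDerivAt_exp_smul_const g t).continuousAt

namespace OneParameterAutomorphismGroup

/-- The one-parameter group implemented by the exponentials of a skew-adjoint element. -/
noncomputable def innerGroup (g : A) (hg : star g = -g) : OneParameterAutomorphismGroup A where
  toFun t := Unitary.conjStarAlgAut ℂ A ⟨NormedSpace.exp (t • g), exp_smul_mem_unitary hg t⟩
  map_zero x := by
    rw [Unitary.conjStarAlgAut_apply]
    simp [NormedSpace.exp_zero]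
  map_add s t x := by
    let _ : NormedAlgebra ℚ A := NormedAlgebra.restrictScalars ℚ ℂ A
    have h : Commute (s • g) (t • g) := ((Commute.refl g).smul_left s).smul_right t
    simp only [Unitary.conjStarAlgAut_apply, add_smul,
      NormedSpace.exp_add_of_commute h, star_mul]
    noncomm_ring
  continuous_orbit x := by
    simp only [Unitary.conjStarAlgAut_apply]
    have := continuous_exp_smul g
    fun_prop

theorem hasGen_innerGroup {g : A} (hg : star g = -g) (x : A) :
    (innerGroup g hg).HasGen x (g * x - x * g) := by
  have h := hasDerivAt_exp_smul_const g (0 : ℝ)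
  have h1 := (h.mul_const x).mul h.star
  simp only [zero_smul, NormedSpace.exp_zero, one_mul, star_one, mul_one, hg] at h1
  rw [sub_eq_add_neg, ← mul_neg]
  exact h1

theorem HasGen.orbit {α : OneParameterAutomorphismGroup A} {x y : A} (h : α.HasGen x y) (t : ℝ) :
    α.HasGen (α.toFun t x) (α.toFun t y) := by
  have h1 : HasDerivAt (fun s => α.clm t (α.toFun s x)) (α.clm t y) 0 :=
    (α.clm t).hasFDerivAt.comp_hasDerivAt (0 : ℝ) h
  simp only [clm_apply] at h1
  simpa only [HasGen, α.toFun_comm] using h1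

/-- Averaging over the orbit makes two iterated commutators small. -/
theorem exists_near_with_small_commutators {g : A} (hg : star g = -g) {b : A} {c : ℝ}
    (h : ∀ t ∈ Set.Icc (0 : ℝ) 1, ‖(innerGroup g hg).toFun t b - b‖ ≤ c) :
    ∃ y, ‖y - b‖ ≤ 2 * c ∧ ‖g * y - y * g‖ ≤ 2 * c ∧
      ‖g * (g * y - y * g) - (g * y - y * g) * g‖ ≤ 2 * c := by
  set β := innerGroup g hg
  have hc : 0 ≤ c := (norm_nonneg _).trans (h 1 ⟨zero_le_one, le_rfl⟩)
  set y₁ := β.orbitAverage b with hy₁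
  set y := β.orbitAverage y₁ with hy
  -- An orbit average has commutator `β_1(x) - x` with `g`, small whatever the norm of `g`.
  -- Averaging a second time makes the iterated commutator equal to `(β_1 - 1)² b`.
  have hgen : ∀ x, g * β.orbitAverage x - β.orbitAverage x * g = β.toFun 1 x - x := fun x =>
    (hasGen_innerGroup hg _).unique (β.hasGen_orbitAverage x)
  have h1 : ‖y₁ - b‖ ≤ c := β.norm_orbitAverage_sub_le b h
  have h2 : ‖y - y₁‖ ≤ c := by
    have := β.norm_orbitAverage_le (y₁ - b)
    rw [orbitAverage_sub, ← hy, ← hy₁] at this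
    exact this.trans h1
  have h3 : ∀ t ∈ Set.Icc (0 : ℝ) 1, ‖β.toFun t y₁ - y₁‖ ≤ c := fun t ht => by
    refine (HasGen.norm_orbit_sub_le (β.hasGen_orbitAverage b) t).trans ?_
    rw [abs_of_nonneg ht.1]
    have h5 := h 1 ⟨zero_le_one, le_rfl⟩
    nlinarith [ht.1, ht.2, norm_nonneg (β.toFun 1 b - b)]
  refine ⟨y, ?_, ?_, ?_⟩
  · have := norm_add_le (y - y₁) (y₁ - b)
    rw [sub_add_sub_cancel] at this
    linarith
  · rw [hy, hgen]
    linarith [h3 1 ⟨zero_le_one, le_rfl⟩]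
  · rw [hy, hgen]
    have e : g * (β.toFun 1 y₁ - y₁) - (β.toFun 1 y₁ - y₁) * g =
        β.toFun 1 (β.toFun 1 b - b) - (β.toFun 1 b - b) := by
      have h4 : β.HasGen (β.toFun 1 y₁ - y₁) (β.toFun 1 (β.toFun 1 b - b) - (β.toFun 1 b - b)) :=
        HasGen.sub (HasGen.orbit (β.hasGen_orbitAverage b) 1) (β.hasGen_orbitAverage b)
      exact (hasGen_innerGroup hg _).unique h4
    rw [e]
    refine (norm_sub_le _ _).trans ?_
    rw [norm_toFun]
    linarith [h 1 ⟨zero_le_one, le_rfl⟩]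

variable (α : OneParameterAutomorphismGroup A)

theorem tendsto_toFun {ι : Type*} {l : Filter ι} {w : ι → A} {s : ι → ℝ} {c : A} {s₀ : ℝ}
    (hw : Tendsto w l (𝓝 c)) (hs : Tendsto s l (𝓝 s₀)) :
    Tendsto (fun i => α.toFun (s i) (w i)) l (𝓝 (α.toFun s₀ c)) := by
  rw [tendsto_iff_norm_sub_tendsto_zero] at hw ⊢
  have h1 := tendsto_iff_norm_sub_tendsto_zero.1
    (((α.continuous_orbit c).tendsto s₀).comp hs)
  refine squeeze_zero (fun i => norm_nonneg _) (fun i => ?_) (by simpa using hw.add h1)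
  have := norm_add_le (α.toFun (s i) (w i - c)) (α.toFun (s i) c - α.toFun s₀ c)
  rw [norm_toFun, map_sub, sub_add_sub_cancel] at this
  exact this

/-- A product rule for an action that is only strongly continuous: isometry of the automorphisms
gives the joint continuity needed for the difference quotients of `c`. -/
theorem hasDerivAt_toFun_comp {c : ℝ → A} {c' y : A} {s : ℝ} (hc : HasDerivAt c c' s)
    (hy : α.HasGen (c s) y) :
    HasDerivAt (fun t => α.toFun t (c t)) (α.toFun s (y + c')) s := by
  have h1 : HasDerivAt (fun t => α.toFun t (c t - c s)) (α.toFun s c') s := by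
    rw [hasDerivAt_iff_tendsto_slope]
    have h2 : Tendsto (fun t => α.toFun t (slope c s t)) (𝓝[≠] s) (𝓝 (α.toFun s c')) :=
      α.tendsto_toFun (hasDerivAt_iff_tendsto_slope.1 hc) (tendsto_id.mono_left nhdsWithin_le_nhds)
    refine h2.congr fun t => ?_
    rw [slope_def_module, slope_def_module, sub_self, _root_.map_zero, sub_zero, ← α.clm_apply,
      map_smul, α.clm_apply]
  have h3 := (hy.hasDerivAt s).add h1
  rw [_root_.map_add]
  refine h3.congr_of_eventuallyEq (Eventually.of_forall fun t => ?_)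
  simp

/-- Comparison of a one-parameter group with one on a subalgebra. -/
theorem norm_toFun_sub_le {B : Type*} [CStarAlgebra B] (β : OneParameterAutomorphismGroup B)
    (ι : B →L[ℝ] A) {G : B → B} (hG : ∀ x, β.HasGen x (G x)) {c : ℝ}
    (hc : 0 ≤ c) (h : ∀ x, ∃ y, α.HasGen (ι x) y ∧ ‖y - ι (G x)‖ ≤ c * ‖x‖) (b : B) {t : ℝ}
    (ht : t ∈ Set.Icc (0 : ℝ) 1) : ‖α.toFun t (ι b) - ι (β.toFun t b)‖ ≤ c * ‖b‖ := by
  choose Y hY hYn using h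
  -- Duhamel interpolation: the curve runs from the group on `B` at `s = 0` to `α_t` at `s = t`, and
  -- its derivative is an isometric image of the discrepancy of the generators.
  have hder : ∀ s, HasDerivAt (fun s => α.toFun s (ι (β.toFun (t - s) b)))
      (α.toFun s (Y (β.toFun (t - s) b) - ι (G (β.toFun (t - s) b)))) s := fun s => by
    have h1 : HasDerivAt (fun s => β.toFun (t - s) b) (-(G (β.toFun (t - s) b))) s := by
      have h2 := ((hG (β.toFun (t - s) b)).hasDerivAt 0)
      rw [β.map_zero] at h2
      have h3 : HasDerivAt (fun r => β.toFun r (β.toFun (t - s) b)) (G (β.toFun (t - s) b))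
          (s - s) := by rwa [sub_self]
      have h4 := HasDerivAt.scomp s (h := fun r => s - r) (h' := -1) h3
        ((hasDerivAt_id s).const_sub s)
      rw [neg_one_smul] at h4
      refine h4.congr_of_eventuallyEq (Eventually.of_forall fun r => ?_)
      simp only [Function.comp]
      rw [← β.map_add]
      congr 2
      ring
    have h5 := ι.hasFDerivAt.comp_hasDerivAt s h1
    have h6 := α.hasDerivAt_toFun_comp h5 (hY (β.toFun (t - s) b))
    rwa [_root_.map_neg, ← sub_eq_add_neg] at h6
  have := norm_image_sub_le_of_norm_deriv_le_segment' (a := 0) (b := t) (C := c * ‖b‖)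
    (fun s _ => (hder s).hasDerivWithinAt) (fun s _ => by
      rw [norm_toFun]
      have := hYn (β.toFun (t - s) b)
      rwa [β.norm_toFun] at this) t ⟨ht.1, le_rfl⟩
  simp only [sub_self, β.map_zero, α.map_zero, sub_zero] at this
  refine this.trans ?_
  have := mul_nonneg hc (norm_nonneg b)
  nlinarith [ht.1, ht.2]

end OneParameterAutomorphismGroup

/-- Commutators with the unitary part are controlled by those with the element. -/
theorem norm_commutators_unitaryPart_le {g y : A} (hg : star g = -g) (hy : IsUnit y)
    (hy1 : ‖star y * y - 1‖ ≤ 1 / 2) (hy2 : ‖y‖ ≤ 2) {ν : ℝ} (hν : ν ≤ 1)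
    (h1 : ‖g * y - y * g‖ ≤ ν) (h2 : ‖g * (g * y - y * g) - (g * y - y * g) * g‖ ≤ ν) :
    ‖g * unitaryPart y - unitaryPart y * g‖ ≤ 850 * ν ∧
      ‖g * (g * unitaryPart y - unitaryPart y * g) -
        (g * unitaryPart y - unitaryPart y * g) * g‖ ≤ 850 * ν := by
  have hν0 : 0 ≤ ν := (norm_nonneg _).trans h1
  set d : A → A := fun x => g * x - x * g with hd
  have dmul : ∀ x z, d (x * z) = d x * z + x * d z := fun x z => by
    simp only [hd]; noncomm_ring
  have dadd : ∀ x z, d (x + z) = d x + d z := fun x z => by simp only [hd]; noncomm_ring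
  have dneg : ∀ x, d (-x) = -d x := fun x => by simp only [hd]; noncomm_ring
  have dstar : ∀ x, d (star x) = star (d x) := fun x => by
    simp only [hd]; rw [star_sub, star_mul, star_mul, hg]; noncomm_ring
  have nm : ∀ {x z : A} {p q : ℝ}, ‖x‖ ≤ p → ‖z‖ ≤ q → ‖x * z‖ ≤ p * q := fun {x z p q} hx hz =>
    (norm_mul_le _ _).trans (mul_le_mul hx hz (norm_nonneg _) ((norm_nonneg _).trans hx))
  change ‖d y‖ ≤ ν at h1
  change ‖d (d y)‖ ≤ ν at h2
  change ‖d (unitaryPart y)‖ ≤ _ ∧ ‖d (d (unitaryPart y))‖ ≤ _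
  have hys : ‖star y‖ ≤ 2 := by rwa [norm_star]
  have h1s : ‖star (d y)‖ ≤ ν := by rwa [norm_star]
  have h2s : ‖star (d (d y))‖ ≤ ν := by rwa [norm_star]
  have hνν : ν * ν ≤ ν := by nlinarith
  set s := absValue y with hs
  have hsu := isUnit_absValue hy
  have hs1 : ‖s - 1‖ ≤ 1 / 2 := norm_absValue_sub_one_le hy1
  have hss : s * s = star y * y := absValue_mul_self y
  -- The `*`-derivation `d = ad g` is applied once and twice to `s * s = star y * y`. Each time a
  -- Sylvester equation bounds the new derivative of `s` independently of `‖g‖`; quadratic terms are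
  -- absorbed by `ν ≤ 1`.
  have a1 : s * d s + d s * s = star (d y) * y + star y * d y := by
    have := congrArg d hss
    rw [dmul, dmul, dstar] at this
    rw [← this]; abel
  have ns1 : ‖d s‖ ≤ 4 * ν := by
    refine (norm_le_of_sylvester hs1 hs1 a1).trans ((norm_add_le _ _).trans ?_)
    linarith [nm h1s hy2, nm hys h1]
  have a2 : s * d (d s) + d (d s) * s = star (d (d y)) * y + star (d y) * d y +
      (star (d y) * d y + star y * d (d y)) - (d s * d s + d s * d s) := by
    have := congrArg d a1
    simp only [dadd, dmul, dstar] at this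
    rw [← this]; abel
  have ns2 : ‖d (d s)‖ ≤ 38 * ν := by
    refine (norm_le_of_sylvester hs1 hs1 a2).trans ((norm_sub_le _ _).trans ?_)
    have e1 := norm_add_le (star (d (d y)) * y + star (d y) * d y)
      (star (d y) * d y + star y * d (d y))
    have e2 := norm_add_le (star (d (d y)) * y) (star (d y) * d y)
    have e3 := norm_add_le (star (d y) * d y) (star y * d (d y))
    have e4 := norm_add_le (d s * d s) (d s * d s)
    have e5 := nm ns1 ns1
    linarith [nm h2s hy2, nm h1s h1, nm hys h2]
  set i := Ring.inverse s with hi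
  have his : i * s = 1 := Ring.inverse_mul_cancel _ hsu
  have hsi : s * i = 1 := Ring.mul_inverse_cancel _ hsu
  have ni : ‖i‖ ≤ 2 := by
    have e : i = i * (1 - s) + 1 := by rw [mul_sub, his]; abel_nf; simp
    rcases subsingleton_or_nontrivial A with _ | _
    · rw [Subsingleton.elim i 0, norm_zero]; norm_num
    have h3 : ‖i‖ ≤ ‖i‖ * (1 / 2) + 1 := by
      nth_rewrite 1 [e]
      refine (norm_add_le _ _).trans ?_
      rw [CStarRing.norm_one]
      rw [norm_sub_rev] at hs1
      gcongr
      exact nm le_rfl hs1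
    linarith
  have di : d i = -(i * d s * i) := by
    have h3 := congrArg d his
    rw [dmul] at h3
    have h4 : d 1 = 0 := by simp [hd]
    rw [h4] at h3
    calc d i = d i * (s * i) := by rw [hsi, mul_one]
      _ = (d i * s + i * d s) * i - i * d s * i := by noncomm_ring
      _ = _ := by rw [h3]; simp
  have ndi : ‖d i‖ ≤ 16 * ν := by
    rw [di, norm_neg]
    have := nm (nm ni ns1) ni
    linarith
  have nddi : ‖d (d i)‖ ≤ 408 * ν := by
    have e : d (d i) = -((d i * d s + i * d (d s)) * i + i * d s * d i) := by
      nth_rewrite 1 [di]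
      rw [dneg, dmul, dmul]
    rw [e, norm_neg]
    have e1 := norm_add_le ((d i * d s + i * d (d s)) * i) (i * d s * d i)
    have e2 := norm_add_le (d i * d s) (i * d (d s))
    have e3 := nm ndi ns1
    have e4 := nm ni ns2
    have e5 := nm (e2.trans (add_le_add e3 e4)) ni
    have e6 := nm (nm ni ns1) ndi
    nlinarith
  have hv : unitaryPart y = y * i := rfl
  rw [hv, dmul]
  constructor
  · have e1 := norm_add_le (d y * i) (y * d i)
    linarith [nm h1 ni, nm hy2 ndi]
  · rw [dadd, dmul, dmul]
    have e1 := norm_add_le (d (d y) * i + d y * d i) (d y * d i + y * d (d i))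
    have e2 := norm_add_le (d (d y) * i) (d y * d i)
    have e3 := norm_add_le (d y * d i) (y * d (d i))
    have e4 := nm h1 ndi
    linarith [nm h2 ni, nm hy2 nddi]

end InnerGroup

/-! ### Assembling the homotopy -/

namespace OneParameterAutomorphismGroup

variable {A : Type*} [CStarAlgebra A] (α : OneParameterAutomorphismGroup A)

/-- The graph of the generator over the unitaries on which it has norm less than `ε`. -/
def unitaryGraph (ε : ℝ) : Set (A × A) :=
  {z | z.1 ∈ unitary A ∧ α.HasGen z.1 z.2 ∧ ‖z.2‖ < ε}

variable {α}

/-- The segment from `v` to `u` consists of invertible, nearly unitary elements of the domain, and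
unitary parts leave its endpoints unchanged. -/
theorem joinedIn_unitaryGraph_of_near {u u' v v' : A} (hu : u ∈ unitary A) (hv : v ∈ unitary A)
    (huu : α.HasGen u u') (hvv : α.HasGen v v') (huv : ‖u - v‖ ≤ 1 / 8) {c ε : ℝ} (hu' : ‖u'‖ ≤ c)
    (hv' : ‖v'‖ ≤ c) (hc : 20 * c < ε) :
    JoinedIn (α.unitaryGraph ε) (v, v') (u, u') := by
  obtain ⟨hu1, hu2⟩ := Unitary.mem_iff.1 hu
  obtain ⟨hv1, hv2⟩ := Unitary.mem_iff.1 hv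
  have nv := norm_le_one_of_mem_unitary hv
  have nu := norm_le_one_of_mem_unitary hu
  set Y : unitInterval → A := fun t => v + (t : ℝ) • (u - v) with hY
  set Z : unitInterval → A := fun t => v' + (t : ℝ) • (u' - v') with hZ
  have hYv : ∀ t, ‖Y t - v‖ ≤ 1 / 8 := fun t => by
    simp only [hY, add_sub_cancel_left]
    rw [norm_smul, Real.norm_eq_abs, abs_of_nonneg t.2.1]
    nlinarith [t.2.1, t.2.2, norm_nonneg (u - v)]
  have hYconv : ∀ (t : unitInterval) (x y : A) (r : ℝ), ‖x‖ ≤ r → ‖y‖ ≤ r →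
      ‖x + (t : ℝ) • (y - x)‖ ≤ r := fun t x y r hx hy => by
    have e : x + (t : ℝ) • (y - x) = (1 - (t : ℝ)) • x + (t : ℝ) • y := by module
    rw [e]
    refine (norm_add_le _ _).trans ?_
    rw [norm_smul, norm_smul, Real.norm_eq_abs, Real.norm_eq_abs, abs_of_nonneg t.2.1,
      abs_of_nonneg (sub_nonneg.2 t.2.2)]
    nlinarith [t.2.1, t.2.2]
  have hYn : ∀ t, ‖Y t‖ ≤ 1 := fun t => hYconv t v u 1 nv nu
  have hYZ : ∀ t, α.HasGen (Y t) (Z t) := fun t => by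
    have := hvv.add ((huu.sub hvv).smul ((t : ℝ) : ℂ))
    simpa only [Complex.coe_smul] using this
  have hYu : ∀ t, IsUnit (Y t) := fun t => by
    obtain ⟨-, y, h1, h2, -⟩ := isUnit_and_norm_le_of_norm_sub_le (a := v) (a' := star v) hv2 hv1 nv
      (by rwa [norm_star]) ((hYv t).trans (by norm_num))
    exact ⟨⟨Y t, y, h1, h2⟩, rfl⟩
  have hYY : ∀ t, ‖star (Y t) * Y t - 1‖ ≤ 1 / 2 := fun t => by
    have e : star (Y t) * Y t - 1 = star (Y t) * (Y t - v) + star (Y t - v) * v := by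
      rw [← hv1, star_sub]; noncomm_ring
    rw [e]
    have h1 := norm_add_le (star (Y t) * (Y t - v)) (star (Y t - v) * v)
    have h2 := norm_mul_le (star (Y t)) (Y t - v)
    have h3 := norm_mul_le (star (Y t - v)) v
    rw [norm_star] at h2 h3
    nlinarith [hYv t, hYn t, norm_nonneg (Y t - v), norm_nonneg (Y t)]
  obtain ⟨w, hw, hwg, hw1, hwu⟩ := exists_unitary_path (α := α) (Y := Y) (Z := Z) (c := c)
    (by fun_prop) (by fun_prop) hYZ hYu hYY
    (fun t => (hYn t).trans one_le_two) (fun t => hYconv t v' u' c hv' hu')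
  have hY0 : Y 0 = v := by simp [hY]
  have hY1 : Y 1 = u := by simp [hY]
  have hw0 : w 0 = v := by rw [hw1 0 (by rw [hY0, hv1]), hY0]
  have hw1 : w 1 = u := by rw [hw1 1 (by rw [hY1, hu1]), hY1]
  refine ⟨⟨⟨fun t => (w t, α.generator (w t)), by fun_prop⟩, ?_, ?_⟩, fun t => ?_⟩
  · simp [hw0, hvv.generator_eq]
  · simp [hw1, huu.generator_eq]
  · exact ⟨(hwu t).1, hasGen_generator (hwu t).2.1, (hwu t).2.2.trans_lt hc⟩

/-- The path has two pieces: from `1` to a unitary `v ∈ B` inside `B`, by the finite-dimensional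
deformation with `h = ig`, and from `v` to the nearby `u` by polar decomposition of a segment. -/
theorem joinedIn_unitaryGraph_of_nearly_inner {u u' : A} (hu : u ∈ unitary A)
    (huu : α.HasGen u u') {B : StarSubalgebra ℂ A} [FiniteDimensional ℂ B] {g b : A} (hgB : g ∈ B)
    (hg : star g = -g) (hb : b ∈ B) {κ ε τ ν : ℝ} (hκ : 0 < κ) (hub : ‖u - b‖ < κ / 40)
    (hB : ∀ x ∈ B, ∃ y, α.HasGen x y ∧ ‖y - (g * x - x * g)‖ ≤ 4 * (κ / 40) * ‖x‖)
    (hu' : ‖u'‖ < κ / 2) (hκ1 : κ ≤ 1 / 1000) (hκε : κ ≤ ε / 40000) (hτ : 0 < τ)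
    (hκν : 1700 * κ ≤ ν) (hε : 6 / τ + 15 * ν + 6 * (τ * ν) < ε / 2) :
    JoinedIn (α.unitaryGraph ε) (1, 0) (u, u') := by
  have hcl : IsClosed (B : Set A) := Submodule.closed_of_finiteDimensional B.toSubalgebra.toSubmodule
  let _ : CStarAlgebra B := StarSubalgebra.cstarAlgebra B
  have hν : 0 < ν := by linarith
  have nu := norm_le_one_of_mem_unitary hu
  obtain ⟨hu1, hu2⟩ := Unitary.mem_iff.1 hu
  let g₀ : B := ⟨g, hgB⟩
  let b₀ : B := ⟨b, hb⟩
  have hg₀ : star g₀ = -g₀ := Subtype.ext hg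
  have hnb : ‖b‖ ≤ 2 := by
    have := norm_sub_le u (u - b)
    rw [sub_sub_cancel] at this
    linarith
  let L : B →L[ℝ] A := LinearMap.mkContinuous
    { toFun := fun x => (x : A)
      map_add' := fun _ _ => rfl
      map_smul' := fun _ _ => rfl } 1 fun x => by rw [one_mul]; rfl
  have hcomp : ∀ t ∈ Set.Icc (0 : ℝ) 1,
      ‖α.toFun t b - ((innerGroup g₀ hg₀).toFun t b₀ : B)‖ ≤ 4 * (κ / 40) * ‖b‖ := fun t ht =>
    α.norm_toFun_sub_le (innerGroup g₀ hg₀) L (hasGen_innerGroup hg₀) (by positivity)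
      (fun x => hB x x.2) b₀ ht
  -- The displacement is at most `κ/5` from comparing the two groups, `κ/20` from approximating `u`
  -- by `b`, and `κ/2` from the smallness of `δ_α(u)`.
  have hbt : ∀ t ∈ Set.Icc (0 : ℝ) 1, ‖(innerGroup g₀ hg₀).toFun t b₀ - b₀‖ ≤ κ := fun t ht => by
    change ‖(((innerGroup g₀ hg₀).toFun t b₀ : B) : A) - b‖ ≤ κ
    set z : A := (((innerGroup g₀ hg₀).toFun t b₀ : B) : A)
    have e : z - b = -(α.toFun t b - z) + -(α.toFun t (u - b)) + (α.toFun t u - u) + (u - b) := by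
      rw [map_sub]; abel
    rw [e]
    have h1 := norm_add_le (-(α.toFun t b - z) + -(α.toFun t (u - b)) + (α.toFun t u - u)) (u - b)
    have h2 := norm_add_le (-(α.toFun t b - z) + -(α.toFun t (u - b))) (α.toFun t u - u)
    have h3 := norm_add_le (-(α.toFun t b - z)) (-(α.toFun t (u - b)))
    rw [norm_neg, norm_neg, norm_toFun] at h3
    have h4 := huu.norm_orbit_sub_le t
    rw [abs_of_nonneg ht.1] at h4
    have h5 := hcomp t ht
    have h6 : ‖u'‖ * t ≤ κ / 2 := by nlinarith [ht.1, ht.2, norm_nonneg u']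
    have h7 : 4 * (κ / 40) * ‖b‖ ≤ 4 * (κ / 40) * 2 := by gcongr
    linarith
  obtain ⟨y, hyb, hy1, hy2⟩ := exists_near_with_small_commutators hg₀ hbt
  have hyu : ‖(y : A) - u‖ ≤ 3 * κ := by
    have h1 : ‖(y : A) - b‖ ≤ 2 * κ := hyb
    have h2 := norm_sub_le ((y : A) - b) (u - b)
    rw [sub_sub_sub_cancel_right] at h2
    linarith
  have hny : ‖y‖ ≤ 2 := by
    change ‖(y : A)‖ ≤ 2
    have h2 := norm_add_le ((y : A) - u) u
    rw [sub_add_cancel] at h2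
    linarith
  have hyy : ‖star y * y - 1‖ ≤ 9 * κ := by
    change ‖star (y : A) * y - 1‖ ≤ 9 * κ
    have e : star (y : A) * y - 1 = star (y : A) * (y - u) + star ((y : A) - u) * u := by
      rw [← hu1, star_sub]; noncomm_ring
    rw [e]
    have h1 := norm_add_le (star (y : A) * (y - u)) (star ((y : A) - u) * u)
    have h2 := norm_mul_le (star (y : A)) (y - u)
    have h3 := norm_mul_le (star ((y : A) - u)) u
    rw [norm_star] at h2 h3
    have h4 : ‖(y : A)‖ ≤ 2 := hny
    nlinarith [norm_nonneg ((y : A) - u), norm_nonneg (y : A), norm_nonneg u]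
  have hyy' : ‖y * star y - 1‖ ≤ 9 * κ := by
    change ‖(y : A) * star (y : A) - 1‖ ≤ 9 * κ
    have e : (y : A) * star (y : A) - 1 = (y - u) * star (y : A) + u * star ((y : A) - u) := by
      rw [← hu2, star_sub]; noncomm_ring
    rw [e]
    have h1 := norm_add_le ((y - u) * star (y : A)) (u * star ((y : A) - u))
    have h2 := norm_mul_le (y - u) (star (y : A))
    have h3 := norm_mul_le u (star ((y : A) - u))
    rw [norm_star] at h2 h3
    have h4 : ‖(y : A)‖ ≤ 2 := hny
    nlinarith [norm_nonneg ((y : A) - u), norm_nonneg (y : A), norm_nonneg u]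
  have hyU : IsUnit y := by
    have h1 := isUnit_of_norm_sub_one_lt (x := star y * y) (by linarith)
    have h2 := isUnit_of_norm_sub_one_lt (x := y * star y) (by linarith)
    obtain ⟨p, hp⟩ := h1.exists_left_inv
    obtain ⟨q, hq⟩ := h2.exists_right_inv
    rw [← mul_assoc] at hp
    rw [mul_assoc] at hq
    have : p * star y = star y * q := left_inv_eq_right_inv hp hq
    exact ⟨⟨y, star y * q, hq, by rw [← this, hp]⟩, rfl⟩
  set v : B := unitaryPart y with hv
  have hvU : v ∈ unitary B := unitaryPart_mem hyU
  obtain ⟨hv1, hv2⟩ := norm_commutators_unitaryPart_le hg₀ hyU (by linarith) hny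
    (ν := 2 * κ) (by linarith) hy1 hy2
  rw [← hv] at hv1 hv2
  have hvy : ‖v - y‖ ≤ 9 * κ := by
    have e : v - y = v * (1 - absValue y) := by
      rw [mul_sub, mul_one, hv, unitaryPart_mul_absValue hyU]
    rw [e, CStarRing.norm_mem_unitary_mul _ hvU, norm_sub_rev]
    exact norm_absValue_sub_one_le hyy
  have huv : ‖u - v‖ ≤ 1 / 8 := by
    have h1 : ‖(v : A) - y‖ ≤ 9 * κ := hvy
    have h2 := norm_add_le ((v : A) - y) (y - u)
    rw [sub_add_sub_cancel] at h2
    rw [norm_sub_rev]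
    linarith
  have hgen : ∀ x : B, α.HasGen (x : A) (α.generator x) := fun x => by
    obtain ⟨y, hy, -⟩ := hB x x.2
    exact hasGen_generator hy.mem
  have hnorm : ∀ x : B, ‖x‖ ≤ 1 → ‖α.generator (x : A)‖ ≤ ‖g₀ * x - x * g₀‖ + κ / 10 := fun x hx => by
    obtain ⟨y, hy, hyn⟩ := hB x x.2
    rw [hy.generator_eq]
    have h1 := norm_add_le (y - (g * x - x * g)) (g * x - x * g)
    rw [sub_add_cancel] at h1
    have h2 : ‖g * (x : A) - x * g‖ = ‖g₀ * x - x * g₀‖ := rfl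
    have h3 : 4 * (κ / 40) * ‖(x : A)‖ ≤ 4 * (κ / 40) * 1 := by gcongr; exact hx
    linarith
  -- The generator is linear on the finite-dimensional `B`, so norm-continuous paths in `B` are
  -- continuous in the graph norm.
  let M : B →ₗ[ℂ] A :=
    { toFun := fun x => α.generator (x : A)
      map_add' := fun x y => ((hgen x).add (hgen y)).generator_eq
      map_smul' := fun c x => ((hgen x).smul c).generator_eq }
  have hM : Continuous fun x : B => ((x : A), α.generator (x : A)) :=
    continuous_subtype_val.prodMk M.continuous_of_finiteDimensional
  have hvA : (v : A) ∈ unitary A := by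
    obtain ⟨h1, h2⟩ := Unitary.mem_iff.1 hvU
    exact Unitary.mem_iff.2 ⟨congrArg Subtype.val h1, congrArg Subtype.val h2⟩
  -- The bound `1701 κ` is `850 · 2κ` for the commutator of `v` with `g` plus the error `κ/10`; the
  -- factor `20` of the polar decomposition then explains `κ ≤ ε / 40000`.
  refine JoinedIn.trans (y := ((v : A), α.generator (v : A))) ?_
    (joinedIn_unitaryGraph_of_near hu hvA huu (hgen v) huv (c := 1701 * κ) (by linarith) ?_
      (by linarith))
  · have hcI : ∀ z : B, (Complex.I • g₀) * z - z * (Complex.I • g₀) =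
        Complex.I • (g₀ * z - z * g₀) := fun z => by
      rw [smul_mul_assoc, mul_smul_comm, smul_sub]
    have hnI : ∀ z : B, ‖Complex.I • z‖ = ‖z‖ := fun z => by
      rw [norm_smul, Complex.norm_I, one_mul]
    have hsa : IsSelfAdjoint (Complex.I • g₀) := by
      rw [IsSelfAdjoint, star_smul, hg₀]; simp
    obtain ⟨γ, hγ⟩ := joinedIn_one_of_commutators_small hsa hvU hτ hν hε
      (by rw [hcI, hnI]; linarith) (by
        rw [hcI, hcI, hnI, mul_smul_comm, smul_mul_assoc, ← smul_sub, hnI]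
        linarith)
    refine ⟨(γ.map hM).cast ?_ rfl, fun t => ?_⟩
    · have : α.generator ((1 : B) : A) = 0 := (hasGen_one (α := α)).generator_eq
      rw [this]; rfl
    · obtain ⟨h1, h2⟩ := Unitary.mem_iff.1 (hγ t).1
      refine ⟨Unitary.mem_iff.2 ⟨congrArg Subtype.val h1, congrArg Subtype.val h2⟩, hgen _, ?_⟩
      have h3 := (hγ t).2
      rw [hcI, hnI] at h3
      have h4 := hnorm (γ t) (norm_le_one_of_mem_unitary (hγ t).1)
      change ‖α.generator ((γ t : B) : A)‖ < ε
      linarith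
  · have h4 := hnorm v (norm_le_one_of_mem_unitary hvU)
    linarith

theorem homotopyCondition_of_nearly_inner
    (h : ∀ (u : A) (η : ℝ), 0 < η → ∃ B : StarSubalgebra ℂ A, FiniteDimensional ℂ B ∧
      ∃ g ∈ B, star g = -g ∧ ∃ b ∈ B, ‖u - b‖ < η ∧
        ∀ x ∈ B, ∃ y, α.HasGen x y ∧ ‖y - (g * x - x * g)‖ ≤ 4 * η * ‖x‖) :
    α.HomotopyCondition := by
  intro ε hε
  -- The order of choice matters: `τ` makes `6/τ = ε/4`, then `ν` makes the terms in `ν` and `τν`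
  -- add up to `ε/8`, and finally `κ` is small relative to `ν` and `ε`.
  set τ := 24 / ε with hτ
  have hτ0 : 0 < τ := by positivity
  set ν := ε / (8 * (15 + 6 * τ)) with hν
  have hν0 : 0 < ν := by positivity
  have hεν : 6 / τ + 15 * ν + 6 * (τ * ν) < ε / 2 := by
    have h1 : 6 / τ = ε / 4 := by rw [hτ]; field_simp; norm_num
    have h2 : 15 * ν + 6 * (τ * ν) = ε / 8 := by
      rw [hν]; field_simp
    linarith
  set κ := min (ν / 1700) (min (1 / 1000) (ε / 40000)) with hκ
  have hκ0 : 0 < κ := by positivity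
  have hκν : κ ≤ ν / 1700 := min_le_left _ _
  have hκ1 : κ ≤ 1 / 1000 := (min_le_right _ _).trans (min_le_left _ _)
  have hκε : κ ≤ ε / 40000 := (min_le_right _ _).trans (min_le_right _ _)
  refine ⟨κ / 2, half_pos hκ0, fun u hu huD hun => ?_⟩
  obtain ⟨B, hBf, g, hgB, hg, b, hb, hub, hB⟩ := h u (κ / 40) (by positivity)
  obtain ⟨γ, hγ⟩ := joinedIn_unitaryGraph_of_nearly_inner hu (hasGen_generator huD) hgB hg hb hκ0 hub
    hB hun hκ1 hκε hτ0 (by linarith) hεν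
  have hgen : ∀ t, α.generator (γ t).1 = (γ t).2 := fun t => (hγ t).2.1.generator_eq
  refine ⟨fun t => (γ t).1, continuous_fst.comp γ.continuous, ?_, by simp, by simp, fun t =>
    ⟨(hγ t).1, (hγ t).2.1.mem, ?_⟩⟩
  · simp only [hgen]
    exact continuous_snd.comp γ.continuous
  · rw [hgen]
    exact (hγ t).2.2

end OneParameterAutomorphismGroup

theorem mainTheorem6 {A : Type*} [CStarAlgebra A]
    (hsimple : IsSimpleCStarAlgebra A) (hAF : IsAFAlgebra A)
    (α : OneParameterAutomorphismGroup A)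
    (hmasa : ∃ C : NonUnitalStarSubalgebra ℂ A,
      IsCanonicalAFMasa C ∧ (C : Set A) ⊆ α.generatorDomain) :
    α.HomotopyCondition := by
  obtain ⟨C, hC, hCD⟩ := hmasa
  exact OneParameterAutomorphismGroup.homotopyCondition_of_nearly_inner fun u η hη =>
    α.exists_nearly_inner hsimple hC hCD u hη
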